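/- Let $d\in\{4,5\}$. Write $\langle\xi\rangle=(1+|\xi|^2)^{1/2}$, $|\cdot|$ for the Euclidean and $|\cdot|_\infty$ for the maximum norm on $\mathbb R^d$, $\mathscr F u(\xi)=\int u(x)e^{-ix\cdot\xi}\,dx$, and $m(\nabla/i)=\mathscr F^{-1}m\,\mathscr F$ for Fourier multipliers on $\mathcal S'(\mathbb R^d)$; in particular $\langle\nabla\rangle=\mathscr F^{-1}\langle\xi\rangle\mathscr F$. Let $\varphi\in C_0^\infty(\mathbb R^d)$ satisfy $0\le\varphi\le1$, $\varphi=1$ on $[-\frac14,\frac14]^d$, $\varphi=0$ outside $[-1,1]^d$ and $\sum_{k\in\mathbb Z^d}\varphi_k=1$, where $\varphi_k=\varphi(\cdot-k)$, and put $P_k=\mathscr F^{-1}\varphi_k\mathscr F$. Let $(X_k)_{k\in\mathbb Z^d}$ and $(Y_l)_{l\in\mathbb Z^d}$ be two families of independent, real-valued, mean zero random variables on probability spaces $\Omega_1$ and $\Omega_2$, uniformly sub-Gaussian: $\sup_k\sup_{1\le p<\infty}p^{-1/2}\|X_k\|_{L^p}<\infty$, and likewise for $Y_l$. Let $\Omega=\Omega_1\times\Omega_2$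 with the product measure, $\omega=(\omega_1,\omega_2)$. Let $s\in\mathbb R$, $f\in H^s(\mathbb R^d)$, $g\in H^{s-1}(\mathbb R^d)$, $\theta>0$ and $\delta>0$. For dyadic $N\in\{1,2,4,\dots\}$ let $K_N=\{k\in\mathbb Z^d:N<|k|_\infty\le 2N\}$ if $N\ge2$, and $K_1=\{k\in\mathbb Z^d:|k|_\infty\le2\}$, and let $$F^{\pm,\omega}_N(t)=\sum_{k\in K_N}\sum_{l\in\mathbb Z^d}X_k(\omega_1)Y_l(\omega_2)\,\tfrac12e^{\pm it\langle\nabla\rangle}\big(P_k(\varphi_lf)\mp i\langle\nabla\rangle^{-1}P_k(\varphi_lg)\big).$$ For $t_0\in\mathbb R$, $x_0\in\mathbb R^d$ let $$K^N_{t_0,x_0}=\{(t,x):t_0\le t\le t_0+N,\ |x-x_0|_\infty\le2N-t+t_0\},$$ let $\|u\|_{L^\infty_tL^q_x(K)}$ be the essential supremum over $t$ of the $L^q$ norm of $u(t,\cdot)$ over the slice $\{x:(t,x)\in K\}$, and let $$\mathcal F^N_{t_0,x_0}[u]=\sup_{\substack{t_0\le t'\le t_0+N\\|x'-x_0|_\infty\le3N}}\int_{t_0}^{t_0+N}\int_{||x-x'|-|t-t'||\le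 N^{5\delta}}|u(t,x)|^{\frac{2d}{d-2}}\,dx\,dt .$$ Then for almost every $\omega\in\Omega$ the series for $F^{\pm,\omega}_N(t)$ converges in $\mathcal S'(\mathbb R^d)$ for all $t\in\mathbb R$, all dyadic $N$ and both signs, and is represented by a continuous function of $(t,x)$; and there is a constant $C=C(\omega,\delta)<\infty$ (which may also depend on the fixed data $d,s,\theta,\varphi,f,g,(X_k),(Y_l)$) such that for both signs, all dyadic $N\ge1$, all $t_0\in\{0,N,2N,\dots,\lfloor N^\theta\rfloor N\}$, all $x_0\in N\mathbb Z^d$ and all measurable $u_1,u_2:\mathbb R\times\mathbb R^d\to\mathbb R$, $$\int_{K^N_{t_0,x_0}}|F^{\pm,\omega}_N||u_1||u_2|^{\frac4{d-2}}\,dx\,dt\le C\,N^{-s+\frac{d+2}8+2d\delta}\,\|u_1\|_{L^\infty_tL^2_x(K^N_{t_0,x_0})}\|u_2\|_{L^\infty_tL^2_x(K^N_{t_0,x_0})}^{\frac{d-4}2}\Big(\|u_2\|_{L^\infty_tL^{\frac{2d}{d-2}}_x(K^N_{t_0,x_0})}^{\frac{d(6-d)}{2(d-2)}}+\big(\mathcal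 F^N_{t_0,x_0}[u_2]\big)^{\frac{6-d}4}\Big),$$ where both sides take values in $[0,\infty]$ and $a^0=1$, $0\cdot\infty=0$. -/

import Mathlib

open MeasureTheory ProbabilityTheory TemperedDistribution
open scoped ENNReal NNReal SchwartzMap

noncomputable section

namespace RandomKG

/-- Physical space `ℝ^d` with its Euclidean norm. -/
abbrev E (d : ℕ) : Type := EuclideanSpace ℝ (Fin d)

/-- A lattice point `k ∈ ℤ^d`, seen as a point of `ℝ^d`. -/
def latt {d : ℕ} (k : Fin d → ℤ) : E d := WithLp.toLp 2 (fun i => (k i : ℝ))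

/-- The Japanese bracket `⟨ξ⟩ = (1 + |ξ|²)^{1/2}`. -/
def jb {d : ℕ} (ξ : E d) : ℝ := Real.sqrt (1 + ‖ξ‖ ^ 2)

/-- The admissible cut-offs `φ` whose integer translates form a smooth partition of unity. -/
structure IsUnitCutoff (d : ℕ) (φ : E d → ℝ) : Prop where
  smooth : ContDiff ℝ ((⊤ : ℕ∞) : WithTop ℕ∞) φ
  nonneg : ∀ ξ, 0 ≤ φ ξ
  le_one : ∀ ξ, φ ξ ≤ 1
  eq_one : ∀ ξ : E d, (∀ i, |ξ i| ≤ 1 / 4) → φ ξ = 1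
  eq_zero : ∀ ξ : E d, (∃ i, 1 < |ξ i|) → φ ξ = 0
  sum_translates : ∀ ξ, HasSum (fun k : Fin d → ℤ => φ (ξ - latt k)) 1

/-- The Fourier multiplier `m(∇/i) = ℱ⁻¹ m ℱ` on tempered distributions, for the convention
`ℱ u(ξ) = ∫ u(x) e^{-i x·ξ} dx`. Mathlib's Fourier transform uses `e^{-2π i x·ξ}`, so that its
frequency variable has to be rescaled by `2π`. -/
def fmult {d : ℕ} (m : E d → ℂ) : 𝓢'(E d, ℂ) →L[ℂ] 𝓢'(E d, ℂ) :=
  fourierMultiplierCLM ℂ (fun ξ => m ((2 * Real.pi) • ξ))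

/-- The phase space block `P_k (φ_l u)`, with `φ_l = φ(· - l)` and `P_k = ℱ⁻¹ φ_k ℱ`. -/
def block {d : ℕ} (φ : E d → ℝ) (k l : Fin d → ℤ) (u : 𝓢'(E d, ℂ)) : 𝓢'(E d, ℂ) :=
  fmult (fun ξ => (φ (ξ - latt k) : ℂ)) (smulLeftCLM ℂ (fun x => (φ (x - latt l) : ℂ)) u)

/-- `½ e^{± i t ⟨∇⟩} (P_k (φ_l f) ∓ i ⟨∇⟩⁻¹ P_k (φ_l g))`, with the sign `ε = ±1`. -/
def halfWave {d : ℕ} (φ : E d → ℝ) (f g : 𝓢'(E d, ℂ)) (ε : ℤˣ) (k l : Fin d → ℤ) (t : ℝ) :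
    𝓢'(E d, ℂ) :=
  (1 / 2 : ℂ) • fmult (fun ξ => Complex.exp (((ε : ℤ) : ℂ) * Complex.I * t * jb ξ))
    (block φ k l f -
      (((ε : ℤ) : ℂ) * Complex.I) • fmult (fun ξ => ((jb ξ)⁻¹ : ℂ)) (block φ k l g))

/-- The frequency shell `{k ∈ ℤ^d : N < |k|_∞ ≤ 2N}` for `N ≥ 2`, and `{k : |k|_∞ ≤ 2}` for
`N = 1`. -/
def shell (d N : ℕ) : Finset (Fin d → ℤ) :=
  open Classical in
  (Finset.Icc (fun _ => -(2 * N : ℤ)) (fun _ => (2 * N : ℤ))).filter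
    (fun k => N = 1 ∨ ∃ i, (N : ℤ) < |k i|)

/-- `F : ℝ × ℝ^d → ℂ` is the continuous function which, at every time `t`, represents the
tempered distribution
`∑_{k ∈ K_N} ∑_{l ∈ ℤ^d} x_k y_l ½ e^{± i t ⟨∇⟩} (P_k (φ_l f) ∓ i ⟨∇⟩⁻¹ P_k (φ_l g))`,
the series being (unconditionally) convergent in `𝓢'`. -/
structure IsShellWave {d : ℕ} (φ : E d → ℝ) (f g : 𝓢'(E d, ℂ)) (x y : (Fin d → ℤ) → ℝ)
    (ε : ℤˣ) (N : ℕ) (F : ℝ × E d → ℂ) : Prop where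
  continuous : Continuous F
  represents : ∀ t : ℝ, ∃ U : 𝓢'(E d, ℂ),
    HasSum (fun l : Fin d → ℤ => ∑ k ∈ shell d N, ((x k : ℂ) * (y l : ℂ)) •
      halfWave φ f g ε k l t) U ∧
    ∀ ψ : 𝓢(E d, ℂ), Integrable (fun z => F (t, z) * ψ z) ∧ U ψ = ∫ z, F (t, z) * ψ z

/-- `‖X‖_Ψ = sup_{1 ≤ p < ∞} p^{-1/2} ‖X‖_{L^p}`. -/
def subGaussianNorm {Ω : Type*} [MeasurableSpace Ω] (X : Ω → ℝ) (μ : Measure Ω) : ℝ≥0∞ :=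
  ⨆ p : ℝ≥0, ⨆ _ : 1 ≤ p, (p : ℝ≥0∞) ^ (-(1 / 2) : ℝ) * eLpNorm X p μ

/-- Independent, mean zero, uniformly sub-Gaussian real random variables. -/
structure IsRandomizer {Ω ι : Type*} [MeasurableSpace Ω] (X : ι → Ω → ℝ) (μ : Measure Ω) :
    Prop where
  measurable : ∀ k, Measurable (X k)
  indep : iIndepFun X μ
  mean_zero : ∀ k, ∫ ω, X k ω ∂μ = 0
  subGaussian : ⨆ k, subGaussianNorm (X k) μ < ∞

/-- The truncated cone
`K^N_{t₀,x₀} = {(t,x) : t₀ ≤ t ≤ t₀ + N, |x - x₀|_∞ ≤ 2N - t + t₀}`. -/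
def cone {d : ℕ} (N : ℕ) (t₀ : ℝ) (x₀ : E d) : Set (ℝ × E d) :=
  {p | t₀ ≤ p.1 ∧ p.1 ≤ t₀ + N ∧ ∀ i, |p.2 i - x₀ i| ≤ 2 * (N : ℝ) - p.1 + t₀}

/-- `‖u‖_{L^∞_t L^q_x(K)}`, the essential supremum over `t` of the `L^q` norm of `u(t)` on the
slice `K(t)`. -/
def normLinfLq {d : ℕ} (q : ℝ≥0∞) (K : Set (ℝ × E d)) (u : ℝ × E d → ℝ) : ℝ≥0∞ :=
  essSup (fun t : ℝ => eLpNorm (fun x => u (t, x)) q (volume.restrict {x | (t, x) ∈ K})) volume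

/-- The supremum of `∫ |u|^{2d/(d-2)}` over the `N^{5δ}`-neighbourhoods, within the time interval
`[t₀, t₀ + N]`, of the light cones with vertex `(t', x')`, `t₀ ≤ t' ≤ t₀ + N`,
`|x' - x₀|_∞ ≤ 3N`. -/
def flux {d : ℕ} (δ : ℝ) (N : ℕ) (t₀ : ℝ) (x₀ : E d) (u : ℝ × E d → ℝ) : ℝ≥0∞ :=
  ⨆ (t' : ℝ) (_ : t₀ ≤ t' ∧ t' ≤ t₀ + N) (x' : E d) (_ : ∀ i, |x' i - x₀ i| ≤ 3 * (N : ℝ)),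
    ∫⁻ p in {p : ℝ × E d | (t₀ ≤ p.1 ∧ p.1 ≤ t₀ + N) ∧
        |‖p.2 - x'‖ - (|p.1 - t'|)| ≤ (N : ℝ) ^ (5 * δ)},
      ‖u p‖ₑ ^ (2 * d / (d - 2) : ℝ)

end RandomKG

end

noncomputable section

namespace RandomKG

open FourierTransform

variable {d : ℕ}

/-! ### Characters and lattice sums -/

/-! The argument runs on the Fourier side and treats the two randomizations separately.

The physical randomization costs no regularity. The blocks `φ_l f` are square summable in `H^s`, by
a Bessel inequality for modulated Schwartz functions (`tsum_wnorm_lblock_lt_top`). Independence and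
mean zero make the series `∑ Y_l φ_l f` orthogonal in a weighted `L²(Ω₂ × ℝ^d)`, so almost surely
its Fourier transform lies in the same weighted space as that of `f`
(`IsRandomizer.exists_randomized_side`). Once `ω₂` is fixed, the half-wave is `½ ∑ X_k v_k`, where
`v_k` is the unit frequency packet at `k` of a single `amplitude`.

The frequency randomization gives square root cancellation at every point: almost surely `|∑ X_k
v_k|² ≲ N^{1/4} (∑ |v_k|² + N^{-1-2s})`, for all `x` and for `|t|` up to a power of `N`
(`IsRandomizer.ae_pointwise_bound`). High moments are taken on a space-time grid whose mesh is a
large negative power of `N`. Dividing them by a power of the square function leaves something linear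
in `∑ |v_k|²`, which the Bessel inequality sums over the unbounded grid. Since the order of the
moment is free, the polynomial number of times and the grid density cost only a small power of `N`;
off the grid, packets are Lipschitz.

The square function no longer involves `ω₁`. Second derivatives of `⟨ξ⟩` are `O(1/N)` on the shell,
so for times up to `N` a packet only translates, with velocity `k/⟨k⟩`, up to rapidly decaying tails
(`exists_kernel`). Its speed is within `N^{-2}` of one. The part of `v_k` that starts at `y`
therefore stays near the light cone with vertex `(t₀, y)`. Integrating `|v_k|² |u₂|^{2d/(d-2)}` over
the truncated cone produces the flux plus a tail of relative size `1/N`, which the energy norm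
absorbs (`exists_cone_estimate`).

Cauchy–Schwarz then splits off `u₁`. For `d = 4` the remaining integral already has the power
`2d/(d-2) = 4` of `u₂`. For `d = 5` its power `8/3` is the midpoint of `2` and `10/3`, and a second
Cauchy–Schwarz interpolates (`exists_wave_estimate`). -/

/-- The character `e^{2πi x·ξ}`. -/
def ech {d : ℕ} (x ξ : E d) : ℂ := Complex.exp (((2 * Real.pi * inner ℝ x ξ : ℝ) : ℂ) * Complex.I)

@[simp] lemma norm_ech (x ξ : E d) : ‖ech x ξ‖ = 1 := Complex.norm_exp_ofReal_mul_I _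

lemma ech_add_left (x y ξ : E d) : ech (x + y) ξ = ech x ξ * ech y ξ := by
  rw [ech, ech, ech, ← Complex.exp_add, inner_add_left]; push_cast; ring_nf

lemma ech_add_right (x ξ η : E d) : ech x (ξ + η) = ech x ξ * ech x η := by
  rw [ech, ech, ech, ← Complex.exp_add, inner_add_right]; push_cast; ring_nf

lemma ech_sub_right (x ξ η : E d) : ech x (ξ - η) = ech x ξ * ech x (-η) := by
  rw [sub_eq_add_neg, ech_add_right]

lemma ech_comm (x ξ : E d) : ech x ξ = ech ξ x := by rw [ech, ech, real_inner_comm]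

lemma ech_neg_left (x ξ : E d) : ech (-x) ξ = ech x (-ξ) := by simp [ech]

lemma conj_ech (x ξ : E d) : (starRingEnd ℂ) (ech x ξ) = ech x (-ξ) := by
  rw [ech, ech, ← Complex.exp_conj, map_mul, Complex.conj_ofReal, Complex.conj_I]; simp

@[fun_prop] lemma continuous_ech : Continuous (fun p : E d × E d => ech p.1 p.2) := by
  unfold ech; fun_prop

@[fun_prop] lemma continuous_ech_comp {α : Type*} [TopologicalSpace α] {f g : α → E d}
    (hf : Continuous f) (hg : Continuous g) : Continuous (fun a => ech (f a) (g a)) :=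
  continuous_ech.comp (hf.prodMk hg)

lemma fourierInv_eq_ech (f : E d → ℂ) (x : E d) : 𝓕⁻ f x = ∫ ξ, ech x ξ * f ξ := by
  rw [Real.fourierInv_eq']; simp [ech, real_inner_comm]

lemma fourier_eq_ech (f : E d → ℂ) (x : E d) : 𝓕 f x = ∫ ξ, ech x (-ξ) * f ξ := by
  rw [Real.fourier_eq']; simp [ech, real_inner_comm]

lemma latt_sub (k l : Fin d → ℤ) : latt (k - l) = latt k - latt l := by
  ext i; simp [latt]

lemma abs_le_norm_latt (k : Fin d → ℤ) (i : Fin d) : |(k i : ℝ)| ≤ ‖latt k‖ := by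
  simpa [latt] using PiLp.norm_apply_le (latt k) i

lemma summable_pi_prod {a : ℤ → ℝ} (ha : Summable a) (h0 : ∀ n, 0 ≤ a n) (d : ℕ) :
    Summable (fun l : Fin d → ℤ => ∏ i, a (l i)) := by
  induction d with
  | zero => exact Summable.of_finite
  | succ d ih =>
    rw [← (Fin.consEquiv (fun _ : Fin (d + 1) => ℤ)).summable_iff]
    have := ha.mul_of_nonneg ih h0 (fun l => Finset.prod_nonneg (fun i _ => h0 _))
    refine this.congr fun p => ?_
    simp [Fin.consEquiv, Fin.prod_univ_succ]

/-- Every coordinate satisfies `1 + |l_i| ≤ 1 + ‖latt l‖`, so the summand is dominated by a product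
of `d` one-dimensional terms `(1 + |l_i|)^{-2}`; hence the exponent `2d`. -/
lemma summable_latt (d : ℕ) :
    Summable (fun l : Fin d → ℤ => ((1 + ‖latt l‖) ^ (2 * d))⁻¹) := by
  have h1 : Summable (fun n : ℤ => ((1 + |(n : ℝ)|) ^ 2)⁻¹) := by
    have h2 : Summable (fun n : ℤ => 1 / (n : ℝ) ^ 2) :=
      Real.summable_one_div_int_pow.mpr (by norm_num)
    refine Summable.of_norm_bounded_eventually (g := fun n : ℤ => 1 / (n : ℝ) ^ 2) h2 ?_
    have : {n : ℤ | n ≠ 0} ∈ Filter.cofinite := by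
      rw [Filter.mem_cofinite]
      exact (Set.finite_singleton 0).subset fun n hn => by simpa using hn
    filter_upwards [this] with n hn
    have h3 : (0 : ℝ) < |(n : ℝ)| := by simpa using hn
    rw [Real.norm_of_nonneg (by positivity), one_div, ← sq_abs (n : ℝ)]
    gcongr
    linarith
  refine Summable.of_nonneg_of_le (fun l => by positivity) (fun l => ?_)
    (summable_pi_prod h1 (fun n => by positivity) d)
  rw [Finset.prod_inv_distrib, pow_mul]
  refine inv_anti₀ (Finset.prod_pos fun i _ => by positivity) ?_
  calc ∏ i : Fin d, (1 + |(l i : ℝ)|) ^ 2 ≤ ∏ _i : Fin d, (1 + ‖latt l‖) ^ 2 := by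
        gcongr with i; exact abs_le_norm_latt l i
    _ = ((1 + ‖latt l‖) ^ 2) ^ d := by simp

lemma exists_decay (ψ : 𝓢(E d, ℂ)) (M : ℕ) : ∃ C : ℝ, 0 < C ∧ ∀ x, (1 + ‖x‖) ^ M * ‖ψ x‖ ≤ C := by
  refine ⟨2 ^ M * ((Finset.Iic (M, 0)).sup fun m => SchwartzMap.seminorm ℝ m.1 m.2) ψ + 1,
    by positivity, fun x => ?_⟩
  have := SchwartzMap.one_add_le_sup_seminorm_apply (𝕜 := ℝ) (m := (M, 0)) (k := M) (n := 0)
    le_rfl le_rfl ψ x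
  simp only [norm_iteratedFDeriv_zero] at this
  linarith

/-! ### A Bessel inequality for modulated Schwartz functions -/

/-- Schur test and duality. With `w = ∑ ⟨v_z, G⟩ v_z`, the sum `S` of squares equals `⟨w, G⟩`, while
the row sums of the Gram matrix give `‖w‖² ≤ K S`. Cauchy–Schwarz yields `S² ≤ K S ‖G‖²`. -/
lemma bessel_of_gram {ι H : Type*} [NormedAddCommGroup H] [InnerProductSpace ℂ H] (v : ι → H)
    (J : Finset ι) {K : ℝ} (hK0 : 0 ≤ K)
    (hK : ∀ z ∈ J, ∑ z' ∈ J, ‖inner ℂ (v z) (v z')‖ ≤ K) (G : H) :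
    ∑ z ∈ J, ‖inner ℂ (v z) G‖ ^ 2 ≤ K * ‖G‖ ^ 2 := by
  set a : ι → ℂ := fun z => inner ℂ (v z) G with ha
  set S : ℝ := ∑ z ∈ J, ‖a z‖ ^ 2 with hS
  set w : H := ∑ z ∈ J, a z • v z with hw
  have hS0 : 0 ≤ S := Finset.sum_nonneg fun _ _ => by positivity
  have h1 : inner ℂ w G = (S : ℂ) := by
    rw [hw, sum_inner, hS]
    push_cast
    refine Finset.sum_congr rfl fun z _ => ?_
    rw [inner_smul_left, ← Complex.conj_mul']
  have h2 : S ≤ ‖w‖ * ‖G‖ := by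
    have := norm_inner_le_norm (𝕜 := ℂ) w G
    rwa [h1, Complex.norm_real, Real.norm_of_nonneg hS0] at this
  have h3 : ‖w‖ ^ 2 ≤ K * S := by
    have hww : ‖w‖ ^ 2 = ‖inner ℂ w w‖ := by
      rw [inner_self_eq_norm_sq_to_K]; simp
    have hgram : ‖inner ℂ w w‖ ≤ ∑ z ∈ J, ∑ z' ∈ J, ‖a z‖ * ‖a z'‖ * ‖inner ℂ (v z) (v z')‖ := by
      rw [hw, sum_inner]
      refine (norm_sum_le _ _).trans (Finset.sum_le_sum fun z _ => ?_)
      rw [inner_sum]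
      refine (norm_sum_le _ _).trans (Finset.sum_le_sum fun z' _ => ?_)
      rw [inner_smul_left, inner_smul_right, norm_mul, norm_mul, RCLike.norm_conj]
      apply le_of_eq; ring
    have hsplit : ∀ z z', ‖a z‖ * ‖a z'‖ * ‖inner ℂ (v z) (v z')‖ ≤
        ‖a z‖ ^ 2 / 2 * ‖inner ℂ (v z) (v z')‖ + ‖a z'‖ ^ 2 / 2 * ‖inner ℂ (v z') (v z)‖ := by
      intro z z'
      rw [norm_inner_symm (v z') (v z), ← add_mul]
      gcongr
      nlinarith [sq_nonneg (‖a z‖ - ‖a z'‖)]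
    have hA : ∑ z ∈ J, ∑ z' ∈ J, ‖a z‖ ^ 2 / 2 * ‖inner ℂ (v z) (v z')‖ ≤ K * S / 2 := by
      calc _ = ∑ z ∈ J, ‖a z‖ ^ 2 / 2 * ∑ z' ∈ J, ‖inner ℂ (v z) (v z')‖ := by
            simp_rw [Finset.mul_sum]
        _ ≤ ∑ z ∈ J, ‖a z‖ ^ 2 / 2 * K := by
            refine Finset.sum_le_sum fun z hz => ?_
            gcongr; exact hK z hz
        _ = K * S / 2 := by rw [← Finset.sum_mul, ← Finset.sum_div]; ring
    have hB : ∑ z ∈ J, ∑ z' ∈ J, ‖a z'‖ ^ 2 / 2 * ‖inner ℂ (v z') (v z)‖ ≤ K * S / 2 := by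
      rw [Finset.sum_comm]; exact hA
    rw [hww]
    refine hgram.trans ((Finset.sum_le_sum fun z _ => Finset.sum_le_sum fun z' _ =>
      hsplit z z').trans ?_)
    simp_rw [Finset.sum_add_distrib]
    linarith
  by_cases hS1 : S = 0
  · rw [hS1]; positivity
  · have hSpos : 0 < S := lt_of_le_of_ne hS0 (Ne.symm hS1)
    have : S * S ≤ (K * ‖G‖ ^ 2) * S := by
      calc S * S ≤ (‖w‖ * ‖G‖) * (‖w‖ * ‖G‖) := by gcongr
        _ = ‖w‖ ^ 2 * ‖G‖ ^ 2 := by ring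
        _ ≤ K * S * ‖G‖ ^ 2 := by gcongr
        _ = _ := by ring
    exact le_of_mul_le_mul_right this hSpos

/-- Up to a phase, the Gram entry for `z, z'` is the inverse Fourier transform of `|ρ|²` at `(z -
z')/n`, which decays rapidly. Bounding `1 + ‖(z - z')/n‖` below by `(1 + ‖z - z'‖)/n` costs the
crude factor `n^{2d}`. It is harmless, because powers of `n` are later reduced by taking a root of
high order. -/
lemma bessel (ρ : 𝓢(E d, ℂ)) : ∃ C : ℝ≥0, ∀ n : ℕ, 1 ≤ n → ∀ (ξ₀ : E d) (G : E d → ℂ),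
    AEStronglyMeasurable G → ∑' z : Fin d → ℤ,
      ‖∫ ζ, G ζ * (ρ (ζ - ξ₀) * ech ((n : ℝ)⁻¹ • latt z) ζ)‖ₑ ^ 2 ≤
        C * n ^ (2 * d) * ∫⁻ ζ, ‖G ζ‖ₑ ^ 2 := by
  set R : 𝓢(E d, ℂ) := SchwartzMap.smulLeftCLM ℂ ρ
    (SchwartzMap.postcompCLM (𝕜 := ℝ) (Complex.conjCLE : ℂ →L[ℝ] ℂ) ρ) with hR
  have hRa : ∀ ζ, R ζ = ρ ζ * (starRingEnd ℂ) (ρ ζ) := fun ζ => by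
    rw [hR, SchwartzMap.smulLeftCLM_apply_apply ρ.hasTemperateGrowth]; simp
  obtain ⟨C, hC0, hC⟩ := exists_decay (𝓕⁻ R) (2 * d)
  set T₀ : ℝ := ∑' l : Fin d → ℤ, ((1 + ‖latt l‖) ^ (2 * d))⁻¹ with hT
  have hT0 : 0 ≤ T₀ := tsum_nonneg fun _ => by positivity
  refine ⟨(C * T₀ + 1).toNNReal, fun n hn ξ₀ G hG => ?_⟩
  have hn' : (1 : ℝ) ≤ n := by exact_mod_cast hn
  have hCC : ((C * T₀ + 1).toNNReal : ℝ≥0∞) = ENNReal.ofReal (C * T₀ + 1) := rfl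
  -- If `G` is not in `L²` the right side has to be infinite; the `+ 1` in the constant prevents `0
  -- * ∞`.
  by_cases hfin : ∫⁻ ζ, ‖G ζ‖ₑ ^ 2 = ∞
  · rw [hfin, ENNReal.mul_top]
    · exact le_top
    · refine mul_ne_zero ?_ (by positivity)
      rw [hCC, Ne, ENNReal.ofReal_eq_zero]; push Not; positivity
  have hGL : MemLp G 2 := by
    refine ⟨hG, ?_⟩
    rw [eLpNorm_lt_top_iff_lintegral_rpow_enorm_lt_top (by norm_num) (by norm_num)]
    simpa using lt_top_iff_ne_top.mpr hfin
  set V : (Fin d → ℤ) → E d → ℂ := fun z ζ =>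
    (starRingEnd ℂ) (ρ (ζ - ξ₀) * ech ((n : ℝ)⁻¹ • latt z) ζ) with hV
  have hVL : ∀ z, MemLp (V z) 2 := by
    intro z
    have h1 : MemLp (SchwartzMap.compSubConstCLM ℂ ξ₀ ρ) 2 (volume : Measure (E d)) :=
      SchwartzMap.memLp _ _ volume
    refine h1.of_le (Continuous.aestronglyMeasurable ?_) (Filter.Eventually.of_forall fun ζ => ?_)
    · have := ρ.continuous
      simp only [hV]; fun_prop
    · simp [hV]
  set v : (Fin d → ℤ) → Lp ℂ 2 (volume : Measure (E d)) := fun z => (hVL z).toLp (V z) with hv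
  have hcoe : ∀ z, v z =ᵐ[volume] V z := fun z => (hVL z).coeFn_toLp
  have hinner : ∀ z, inner ℂ (v z) (hGL.toLp G) =
      ∫ ζ, G ζ * (ρ (ζ - ξ₀) * ech ((n : ℝ)⁻¹ • latt z) ζ) := by
    intro z
    rw [L2.inner_def]
    refine integral_congr_ae ?_
    filter_upwards [hcoe z, hGL.coeFn_toLp] with ζ h1 h2
    simp [h1, h2, hV]
  have hgram : ∀ z z', ‖inner ℂ (v z) (v z')‖ ≤
      C * n ^ (2 * d) * ((1 + ‖latt (z - z')‖) ^ (2 * d))⁻¹ := by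
    intro z z'
    set y : E d := (n : ℝ)⁻¹ • latt (z - z') with hy
    have h1 : inner ℂ (v z) (v z') = ech y ξ₀ * (𝓕⁻ R) y := by
      rw [L2.inner_def, SchwartzMap.fourierInv_coe, fourierInv_eq_ech, ← integral_const_mul,
        ← integral_sub_right_eq_self (fun ζ => ech y ξ₀ * (ech y ζ * R ζ)) ξ₀]
      refine integral_congr_ae ?_
      filter_upwards [hcoe z, hcoe z'] with ζ h1 h2
      rw [h1, h2, hRa]
      simp only [hV, RCLike.inner_apply, map_mul, RingHomCompTriple.comp_apply, RingHom.id_apply,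
        conj_ech]
      have e1 : ech y ξ₀ * ech y (ζ - ξ₀) = ech y ζ := by rw [← ech_add_right]; simp
      have e2 : ech y ζ = ech ((n : ℝ)⁻¹ • latt z) ζ * ech ((n : ℝ)⁻¹ • latt z') (-ζ) := by
        rw [hy, latt_sub, smul_sub, sub_eq_add_neg, ech_add_left, ech_neg_left]
      rw [neg_neg]
      linear_combination (-(ρ (ζ - ξ₀) * (starRingEnd ℂ) (ρ (ζ - ξ₀)))) * (e1.trans e2)
    rw [h1, norm_mul, norm_ech, one_mul]
    have h2 := hC y
    have h3 : (1 + ‖latt (z - z')‖) ≤ n * (1 + ‖y‖) := by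
      rw [hy, norm_smul, norm_inv, Real.norm_natCast, mul_add, ← mul_assoc,
        mul_inv_cancel₀ (by positivity)]
      linarith
    have h4 : (1 + ‖latt (z - z')‖) ^ (2 * d) * ‖(𝓕⁻ R) y‖ ≤ C * n ^ (2 * d) := by
      calc _ ≤ (n * (1 + ‖y‖)) ^ (2 * d) * ‖(𝓕⁻ R) y‖ := by gcongr
        _ = n ^ (2 * d) * ((1 + ‖y‖) ^ (2 * d) * ‖(𝓕⁻ R) y‖) := by rw [mul_pow]; ring
        _ ≤ n ^ (2 * d) * C := by gcongr
        _ = _ := by ring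
    rw [← div_eq_mul_inv, le_div_iff₀ (by positivity)]
    linarith
  have hrow : ∀ J : Finset (Fin d → ℤ), ∀ z ∈ J, ∑ z' ∈ J, ‖inner ℂ (v z) (v z')‖ ≤
      C * n ^ (2 * d) * T₀ := by
    intro J z _
    refine (Finset.sum_le_sum fun z' _ => hgram z z').trans ?_
    rw [← Finset.mul_sum]
    gcongr
    have hs := (Equiv.subLeft z).summable_iff.mpr (summable_latt d)
    have ht := (Equiv.subLeft z).tsum_eq (fun l : Fin d → ℤ => ((1 + ‖latt l‖) ^ (2 * d))⁻¹)
    rw [hT, ← ht]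
    exact hs.sum_le_tsum J fun _ _ => by positivity
  rw [ENNReal.tsum_eq_iSup_sum]
  refine iSup_le fun J => ?_
  have hb := bessel_of_gram v J (by positivity) (hrow J) (hGL.toLp G)
  simp_rw [hinner] at hb
  have hnorm : ENNReal.ofReal (‖hGL.toLp G‖ ^ 2) = ∫⁻ ζ, ‖G ζ‖ₑ ^ 2 := by
    rw [Lp.norm_toLp, ← ENNReal.toReal_pow, ENNReal.ofReal_toReal (by
      exact ENNReal.pow_ne_top hGL.2.ne),
      eLpNorm_eq_lintegral_rpow_enorm_toReal (by norm_num) (by norm_num)]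
    simp only [ENNReal.toReal_ofNat, ENNReal.rpow_ofNat, one_div]
    rw [← ENNReal.rpow_natCast, ← ENNReal.rpow_mul]; simp
  calc ∑ z ∈ J, ‖∫ ζ, G ζ * (ρ (ζ - ξ₀) * ech ((n : ℝ)⁻¹ • latt z) ζ)‖ₑ ^ 2
      = ENNReal.ofReal (∑ z ∈ J, ‖∫ ζ, G ζ * (ρ (ζ - ξ₀) * ech ((n : ℝ)⁻¹ • latt z) ζ)‖ ^ 2) := by
        rw [ENNReal.ofReal_sum_of_nonneg fun _ _ => by positivity]
        refine Finset.sum_congr rfl fun z _ => ?_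
        rw [ENNReal.ofReal_pow (norm_nonneg _), ofReal_norm]
    _ ≤ ENNReal.ofReal ((C * T₀ + 1) * n ^ (2 * d) * ‖hGL.toLp G‖ ^ 2) := by
        refine ENNReal.ofReal_le_ofReal (hb.trans ?_)
        refine mul_le_mul_of_nonneg_right ?_ (by positivity)
        nlinarith [pow_pos (lt_of_lt_of_le one_pos hn') (2 * d)]
    _ = _ := by
        rw [ENNReal.ofReal_mul (by positivity), ENNReal.ofReal_mul (by positivity), hnorm, hCC,
          ENNReal.ofReal_pow (by positivity), ENNReal.ofReal_natCast]

/-! ### Moments of sums of independent sub-Gaussian variables -/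

section Moments

variable {Ω ι : Type*} [MeasurableSpace Ω] {μ : Measure Ω} {X : ι → Ω → ℝ}

/-- This is the only use of sub-Gaussianity: for each fixed `p`, the `p`-th moments are bounded
uniformly in the index. -/
lemma IsRandomizer.exists_lintegral_pow_le [IsProbabilityMeasure μ] (hX : IsRandomizer X μ) (p : ℕ) :
    ∃ B : ℝ≥0, ∀ k, ∫⁻ ω, ‖X k ω‖ₑ ^ p ∂μ ≤ B := by
  rcases Nat.eq_zero_or_pos p with rfl | hp
  · exact ⟨1, fun k => by simp⟩
  set B : ℝ≥0∞ := ⨆ k, subGaussianNorm (X k) μ with hB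
  have hBt : B ≠ ∞ := hX.subGaussian.ne
  have hp1 : (1 : ℝ≥0) ≤ (p : ℝ≥0) := by exact_mod_cast hp
  have hp0 : (p : ℝ≥0∞) ≠ 0 := by exact_mod_cast hp.ne'
  have key : ∀ k, eLpNorm (X k) p μ ≤ (p : ℝ≥0∞) ^ (1 / 2 : ℝ) * B := by
    intro k
    have h1 : (p : ℝ≥0∞) ^ (-(1 / 2) : ℝ) * eLpNorm (X k) p μ ≤ B := by
      refine le_trans ?_ (le_iSup (fun k => subGaussianNorm (X k) μ) k)
      have := le_iSup₂ (f := fun (p : ℝ≥0) (_ : 1 ≤ p) =>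
        (p : ℝ≥0∞) ^ (-(1 / 2) : ℝ) * eLpNorm (X k) p μ) (p : ℝ≥0) hp1
      simpa [subGaussianNorm] using this
    calc eLpNorm (X k) p μ = (p : ℝ≥0∞) ^ (1 / 2 : ℝ) *
          ((p : ℝ≥0∞) ^ (-(1 / 2) : ℝ) * eLpNorm (X k) p μ) := by
          rw [← mul_assoc, ← ENNReal.rpow_add _ _ hp0 (ENNReal.natCast_ne_top p)]; simp
      _ ≤ _ := by gcongr
  have hfin : ((p : ℝ≥0∞) ^ (1 / 2 : ℝ) * B) ^ p ≠ ∞ := by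
    refine ENNReal.pow_ne_top (ENNReal.mul_ne_top ?_ hBt)
    exact ENNReal.rpow_ne_top_of_nonneg (by norm_num) (ENNReal.natCast_ne_top p)
  refine ⟨(((p : ℝ≥0∞) ^ (1 / 2 : ℝ) * B) ^ p).toNNReal, fun k => ?_⟩
  rw [ENNReal.coe_toNNReal hfin]
  have h2 := key k
  rw [eLpNorm_eq_lintegral_rpow_enorm_toReal hp0 (ENNReal.natCast_ne_top p)] at h2
  calc ∫⁻ ω, ‖X k ω‖ₑ ^ p ∂μ
      = ((∫⁻ ω, ‖X k ω‖ₑ ^ (p : ℝ≥0∞).toReal ∂μ) ^ (1 / (p : ℝ≥0∞).toReal)) ^ p := by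
        rw [← ENNReal.rpow_natCast _ p, ← ENNReal.rpow_mul]
        have : (p : ℝ) ≠ 0 := by exact_mod_cast hp.ne'
        simp [this]
    _ ≤ _ := by gcongr

lemma IsRandomizer.memLp [IsProbabilityMeasure μ] (hX : IsRandomizer X μ) (k : ι) (p : ℕ) :
    MemLp (X k) p μ := by
  refine ⟨(hX.measurable k).aestronglyMeasurable, ?_⟩
  rcases Nat.eq_zero_or_pos p with rfl | hp
  · simp
  rw [eLpNorm_lt_top_iff_lintegral_rpow_enorm_lt_top (by exact_mod_cast hp.ne') (by simp)]
  obtain ⟨B, hB⟩ := hX.exists_lintegral_pow_le p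
  simpa using (hB k).trans_lt ENNReal.coe_lt_top

lemma IsRandomizer.exists_integral_pow_le [IsProbabilityMeasure μ] (hX : IsRandomizer X μ) (p : ℕ) :
    ∃ B : ℝ, 0 ≤ B ∧ ∀ k, ∫ ω, |X k ω| ^ p ∂μ ≤ B := by
  obtain ⟨B, hB⟩ := hX.exists_lintegral_pow_le p
  refine ⟨B, B.2, fun k => ?_⟩
  rw [integral_eq_lintegral_of_nonneg_ae (Filter.Eventually.of_forall fun ω => by positivity)
    (by simpa using ((hX.measurable k).norm.pow_const p).aestronglyMeasurable)]
  refine ENNReal.toReal_le_of_le_ofReal B.2 ?_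
  rw [ENNReal.ofReal_coe_nnreal]
  refine le_trans (le_of_eq (lintegral_congr fun ω => ?_)) (hB k)
  rw [ENNReal.ofReal_pow (abs_nonneg _), Real.enorm_eq_ofReal_abs]

lemma pow_mul_pow_le_add {x y : ℝ} (hx : 0 ≤ x) (hy : 0 ≤ y) {i j n : ℕ} (h : i + j = n) :
    x ^ i * y ^ j ≤ x ^ n + y ^ n := by
  rcases le_total x y with hxy | hxy
  · calc x ^ i * y ^ j ≤ y ^ i * y ^ j := by gcongr
      _ = y ^ n := by rw [← pow_add, h]
      _ ≤ _ := by have := pow_nonneg hx n; linarith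
  · calc x ^ i * y ^ j ≤ x ^ i * x ^ j := by gcongr
      _ = x ^ n := by rw [← pow_add, h]
      _ ≤ _ := by have := pow_nonneg hy n; linarith

/-- The right side is the increment of `v ↦ v^m` when a variance grows from `r²` to `r² + a²`. It is
at least `a² r^{2m-2}` and at least `a^{2m}`, which settles `a ≤ r` and `a ≥ r` respectively. A
single factor `a` could not be controlled; mean zero removes that order. -/
lemma pow_mul_pow_le_sub {r a : ℝ} (hr : 0 ≤ r) (ha : 0 ≤ a) {j m : ℕ} (hm : 1 ≤ m) (hj : 2 ≤ j)
    (hjm : j ≤ 2 * m) : a ^ j * r ^ (2 * m - j) ≤ (r ^ 2 + a ^ 2) ^ m - r ^ (2 * m) := by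
  obtain ⟨m, rfl⟩ : ∃ m', m = m' + 1 := ⟨m - 1, by omega⟩
  rcases le_total a r with h | h
  · have h1 : a ^ j * r ^ (2 * (m + 1) - j) ≤ a ^ 2 * r ^ (2 * m) := by
      obtain ⟨i, rfl⟩ : ∃ i, j = 2 + i := ⟨j - 2, by omega⟩
      rw [pow_add, mul_assoc]
      gcongr
      calc a ^ i * r ^ (2 * (m + 1) - (2 + i)) ≤ r ^ i * r ^ (2 * (m + 1) - (2 + i)) := by gcongr
        _ = r ^ (2 * m) := by rw [← pow_add]; congr 1; omega
    have h2 : (r ^ 2 + a ^ 2) ^ (m + 1) ≥ (r ^ 2) ^ m * (r ^ 2 + a ^ 2) := by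
      rw [pow_succ]; gcongr; nlinarith
    have h3 : r ^ (2 * (m + 1)) = (r ^ 2) ^ m * r ^ 2 := by rw [← pow_mul]; ring
    have h4 : r ^ (2 * m) = (r ^ 2) ^ m := by rw [← pow_mul]
    rw [h3]; rw [h4] at h1; nlinarith
  · have h1 : a ^ j * r ^ (2 * (m + 1) - j) ≤ (a ^ 2) ^ (m + 1) := by
      calc _ ≤ a ^ j * a ^ (2 * (m + 1) - j) := by gcongr
        _ = (a ^ 2) ^ (m + 1) := by rw [← pow_add, ← pow_mul]; congr 1; omega
    have h2 : (r ^ 2) ^ (m + 1) + (a ^ 2) ^ (m + 1) ≤ (r ^ 2 + a ^ 2) ^ (m + 1) :=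
      pow_add_pow_le (by positivity) (by positivity) (by omega)
    rw [pow_mul]; linarith

lemma integrable_pow_of_memLp [IsProbabilityMeasure μ] {Z : Ω → ℝ} (hZ : ∀ p : ℕ, MemLp Z p μ)
    (p : ℕ) : Integrable (fun ω => Z ω ^ p) μ := by
  rcases Nat.eq_zero_or_pos p with rfl | hp
  · simp
  refine ((hZ p).integrable_norm_pow hp.ne').mono' ((hZ p).1.pow p) ?_
  exact Filter.Eventually.of_forall fun ω => by simp

/-- Induction on `J`, adding one independent summand `Z` to `S`. In the binomial expansion of `(S +
Z)^{2m}` the term linear in `Z` has mean zero, and `pow_mul_pow_le_sub` bounds all higher ones by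
the increment of the `m`-th power of the variance. These increments telescope, so `D` does not
depend on the number of terms. The parameter `η` keeps the standard deviation `r` positive and is
sent to zero in the next lemma. -/
lemma IsRandomizer.exists_integral_sum_pow_le [IsProbabilityMeasure μ] (hX : IsRandomizer X μ)
    {m : ℕ} (hm : 1 ≤ m) : ∃ D : ℝ, 0 ≤ D ∧ ∀ (J : Finset ι) (a : ι → ℝ) (η : ℝ), 0 < η →
      ∫ ω, (∑ k ∈ J, a k * X k ω) ^ (2 * m) ∂μ ≤ D ^ (2 * m) * (η + ∑ k ∈ J, a k ^ 2) ^ m := by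
  classical
  choose B hB0 hB using hX.exists_integral_pow_le
  set K : ℝ := ∑ j ∈ Finset.range (2 * m + 1), 2 * ((2 * m).choose j : ℝ) * B j with hK
  have hK0 : 0 ≤ K := Finset.sum_nonneg fun j _ => by have := hB0 j; positivity
  -- One induction step adds at most `K D^{2m-2}` times the increment, so `K ≤ D²` closes the
  -- induction.
  set D : ℝ := 1 + K with hD
  have hD1 : 1 ≤ D := by linarith
  refine ⟨D, by linarith, fun J a η hη => ?_⟩
  set Z : ι → Ω → ℝ := fun k ω => a k * X k ω with hZ
  have hZm : ∀ k, Measurable (Z k) := fun k => (hX.measurable k).const_mul _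
  have hZL : ∀ k (p : ℕ), MemLp (Z k) p μ := fun k p => (hX.memLp k p).const_mul _
  have hZi : iIndepFun Z μ :=
    hX.indep.comp (fun k x => a k * x) (fun k => measurable_const_mul _)
  induction J using Finset.induction_on with
  | empty =>
    have : 2 * m ≠ 0 := by omega
    simp only [Finset.sum_empty, ne_eq, this, not_false_eq_true, zero_pow, integral_zero, add_zero]
    have : 0 ≤ D := by linarith
    positivity
  | insert k J hk ih =>
    set S : Ω → ℝ := fun ω => ∑ i ∈ J, Z i ω with hS
    set r : ℝ := Real.sqrt (η + ∑ i ∈ J, a i ^ 2) with hr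
    have hv : 0 < η + ∑ i ∈ J, a i ^ 2 := by
      have : 0 ≤ ∑ i ∈ J, a i ^ 2 := Finset.sum_nonneg fun _ _ => sq_nonneg _
      linarith
    have hr0 : 0 < r := Real.sqrt_pos.mpr hv
    have hr2 : r ^ 2 = η + ∑ i ∈ J, a i ^ 2 := Real.sq_sqrt hv.le
    have hSL : ∀ p : ℕ, MemLp S p μ := fun p => memLp_finsetSum J fun i _ => hZL i p
    have hSm : Measurable S := Finset.measurable_sum J fun i _ => hZm i
    have hind : IndepFun S (Z k) μ := by
      have := hZi.indepFun_finsetSum_of_notMem hZm hk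
      convert this using 1
      ext ω; simp [hS]
    have ih' : ∫ ω, S ω ^ (2 * m) ∂μ ≤ (D * r) ^ (2 * m) := by
      rw [mul_pow, pow_mul r, hr2]; exact ih
    -- Lower moments follow from the one of order `2m` by comparing `|S|` with the level `D r`;
    -- dividing by `(D r)^{2m-i}` needs `r > 0`.
    have hSabs : ∀ i, i ≤ 2 * m → ∫ ω, |S ω| ^ i ∂μ ≤ 2 * (D * r) ^ i := by
      intro i hi
      have hDr : 0 < D * r := by positivity
      have h1 : ∫ ω, |S ω| ^ i * (D * r) ^ (2 * m - i) ∂μ ≤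
          ∫ ω, S ω ^ (2 * m) + (D * r) ^ (2 * m) ∂μ := by
        refine integral_mono_of_nonneg (Filter.Eventually.of_forall fun ω => by positivity) ?_
          (Filter.Eventually.of_forall fun ω => ?_)
        · exact (integrable_pow_of_memLp hSL _).add (integrable_const _)
        · have := pow_mul_pow_le_add (abs_nonneg (S ω)) hDr.le (i := i) (j := 2 * m - i)
            (n := 2 * m) (by omega)
          rwa [pow_mul |S ω|, sq_abs, ← pow_mul] at this
      rw [integral_mul_const, integral_add (integrable_pow_of_memLp hSL _) (integrable_const _)] at h1
      simp only [integral_const, probReal_univ, smul_eq_mul, one_mul] at h1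
      have h2 : (D * r) ^ (2 * m) = (D * r) ^ i * (D * r) ^ (2 * m - i) := by
        rw [← pow_add]; congr 1; omega
      have h3 : (∫ ω, |S ω| ^ i ∂μ) * (D * r) ^ (2 * m - i) ≤
          2 * (D * r) ^ i * (D * r) ^ (2 * m - i) := by
        rw [mul_assoc, ← h2]; linarith
      exact le_of_mul_le_mul_right h3 (by positivity)
    have hexp : ∫ ω, (S ω + Z k ω) ^ (2 * m) ∂μ = ∑ i ∈ Finset.range (2 * m + 1),
        (∫ ω, S ω ^ i ∂μ) * (∫ ω, Z k ω ^ (2 * m - i) ∂μ) * ((2 * m).choose i : ℝ) := by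
      simp_rw [add_pow]
      have hprod : ∀ i, IndepFun (fun ω => S ω ^ i) (fun ω => Z k ω ^ (2 * m - i)) μ := fun i =>
        hind.comp (measurable_id.pow_const i) (measurable_id.pow_const (2 * m - i))
      rw [integral_finsetSum]
      · refine Finset.sum_congr rfl fun i _ => ?_
        rw [integral_mul_const, (hprod i).integral_fun_mul_eq_mul_integral
          (hSm.pow_const i).aestronglyMeasurable ((hZm k).pow_const _).aestronglyMeasurable]
      · intro i _
        exact ((hprod i).integrable_mul (integrable_pow_of_memLp hSL i)
          (integrable_pow_of_memLp (hZL k) _)).mul_const _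
    set Δ : ℝ := (r ^ 2 + |a k| ^ 2) ^ m - r ^ (2 * m) with hΔ
    have hΔ0 : 0 ≤ Δ := le_trans (by positivity)
      (pow_mul_pow_le_sub hr0.le (abs_nonneg (a k)) hm le_rfl (by omega : 2 ≤ 2 * m))
    have hterm : ∀ i ∈ Finset.range (2 * m), (∫ ω, S ω ^ i ∂μ) * (∫ ω, Z k ω ^ (2 * m - i) ∂μ) *
        ((2 * m).choose i : ℝ) ≤
        2 * ((2 * m).choose (2 * m - i) : ℝ) * B (2 * m - i) * (D ^ (2 * m - 2) * Δ) := by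
      intro i hi
      rw [Finset.mem_range] at hi
      have hnn : 0 ≤ 2 * ((2 * m).choose (2 * m - i) : ℝ) * B (2 * m - i) * (D ^ (2 * m - 2) * Δ) := by
        have := hB0 (2 * m - i)
        have : 0 ≤ D := by linarith
        positivity
      rcases Nat.lt_or_ge (2 * m - i) 2 with h1 | h1
      · have h2 : 2 * m - i = 1 := by omega
        have h3 : ∫ ω, Z k ω ^ (2 * m - i) ∂μ = 0 := by
          rw [h2]; simp only [pow_one, hZ]
          rw [integral_const_mul, hX.mean_zero k, mul_zero]
        rw [h3]; simpa using hnn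
      · set j := 2 * m - i with hj
        have hij : i = 2 * m - j := by omega
        have hc : (2 * m).choose i = (2 * m).choose j := (Nat.choose_symm hi.le).symm
        have e1 : |∫ ω, S ω ^ i ∂μ| ≤ 2 * (D * r) ^ i := by
          refine (abs_integral_le_integral_abs).trans ?_
          simp_rw [abs_pow]; exact hSabs i hi.le
        have e2 : |∫ ω, Z k ω ^ j ∂μ| ≤ |a k| ^ j * B j := by
          refine (abs_integral_le_integral_abs).trans ?_
          simp_rw [hZ, abs_pow, abs_mul, mul_pow]
          rw [integral_const_mul]
          gcongr
          exact hB j k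
        have e3 := pow_mul_pow_le_sub hr0.le (abs_nonneg (a k)) hm h1 (by omega : j ≤ 2 * m)
        have e4 : D ^ i ≤ D ^ (2 * m - 2) := pow_le_pow_right₀ hD1 (by omega)
        have hB' := hB0 j
        calc _ ≤ |∫ ω, S ω ^ i ∂μ| * |∫ ω, Z k ω ^ j ∂μ| * ((2 * m).choose i : ℝ) := by
              rw [← abs_mul]; gcongr; exact le_abs_self _
          _ ≤ (2 * (D * r) ^ i) * (|a k| ^ j * B j) * ((2 * m).choose j : ℝ) := by
              rw [hc]; gcongr
          _ = 2 * ((2 * m).choose j : ℝ) * B j * (D ^ i * (|a k| ^ j * r ^ (2 * m - j))) := by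
              rw [mul_pow, ← hij]; ring
          _ ≤ _ := by gcongr
    have hfinal : ∫ ω, (S ω + Z k ω) ^ (2 * m) ∂μ ≤ D ^ (2 * m) * (r ^ 2 + |a k| ^ 2) ^ m := by
      rw [hexp, Finset.sum_range_succ]
      have h1 := Finset.sum_le_sum hterm
      rw [← Finset.sum_mul] at h1
      have h2 : ∑ i ∈ Finset.range (2 * m), 2 * ((2 * m).choose (2 * m - i) : ℝ) * B (2 * m - i) ≤ K := by
        rw [hK, ← Finset.sum_range_reflect (fun j => 2 * ((2 * m).choose j : ℝ) * B j) (2 * m + 1),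
          Finset.sum_range_succ]
        simp only [Nat.add_sub_cancel]
        have := hB0 (2 * m - 2 * m)
        have : 0 ≤ 2 * ((2 * m).choose (2 * m - 2 * m) : ℝ) * B (2 * m - 2 * m) := by positivity
        linarith
      have h3 : K * (D ^ (2 * m - 2) * Δ) ≤ D ^ (2 * m) * Δ := by
        have : D ^ (2 * m) = D ^ 2 * D ^ (2 * m - 2) := by rw [← pow_add]; congr 1; omega
        rw [this, mul_assoc]
        gcongr
        nlinarith
      have h4 : (∑ i ∈ Finset.range (2 * m), 2 * ((2 * m).choose (2 * m - i) : ℝ) * B (2 * m - i)) *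
          (D ^ (2 * m - 2) * Δ) ≤ K * (D ^ (2 * m - 2) * Δ) := by gcongr
      have h5 : D ^ (2 * m) * (r ^ 2 + |a k| ^ 2) ^ m = (D * r) ^ (2 * m) + D ^ (2 * m) * Δ := by
        rw [hΔ, mul_pow]; ring
      simp only [Nat.sub_self, pow_zero, integral_const, probReal_univ, smul_eq_mul, mul_one,
        Nat.choose_self, Nat.cast_one]
      linarith
    rw [sq_abs, hr2] at hfinal
    calc _ = ∫ ω, (S ω + Z k ω) ^ (2 * m) ∂μ := by
          refine integral_congr_ae (Filter.Eventually.of_forall fun ω => ?_)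
          simp only [Finset.sum_insert hk, hS, hZ]; rw [add_comm]
      _ ≤ _ := hfinal
      _ = _ := by rw [Finset.sum_insert hk]; ring

lemma IsRandomizer.exists_lintegral_real_sum_pow_le [IsProbabilityMeasure μ] (hX : IsRandomizer X μ)
    {m : ℕ} (hm : 1 ≤ m) : ∃ D : ℝ, 0 ≤ D ∧ ∀ (J : Finset ι) (a : ι → ℝ),
      ∫⁻ ω, ‖∑ k ∈ J, a k * X k ω‖ₑ ^ (2 * m) ∂μ ≤ ENNReal.ofReal (D * (∑ k ∈ J, a k ^ 2) ^ m) := by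
  obtain ⟨D, hD0, hD⟩ := hX.exists_integral_sum_pow_le hm
  refine ⟨D ^ (2 * m), by positivity, fun J a => ?_⟩
  have hL : ∀ p : ℕ, MemLp (fun ω => ∑ k ∈ J, a k * X k ω) p μ := fun p =>
    memLp_finsetSum J fun i _ => (hX.memLp i p).const_mul _
  have h1 : ∫ ω, (∑ k ∈ J, a k * X k ω) ^ (2 * m) ∂μ ≤ D ^ (2 * m) * (∑ k ∈ J, a k ^ 2) ^ m := by
    have hc : Filter.Tendsto (fun η : ℝ => D ^ (2 * m) * (η + ∑ k ∈ J, a k ^ 2) ^ m)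
        (nhdsWithin 0 (Set.Ioi 0)) (nhds (D ^ (2 * m) * (0 + ∑ k ∈ J, a k ^ 2) ^ m)) :=
      (Continuous.tendsto (by fun_prop) 0).mono_left nhdsWithin_le_nhds
    rw [zero_add] at hc
    exact ge_of_tendsto hc (by filter_upwards [self_mem_nhdsWithin] with η hη using hD J a η hη)
  refine le_trans (le_of_eq ?_) (ENNReal.ofReal_le_ofReal h1)
  rw [ofReal_integral_eq_lintegral_ofReal (integrable_pow_of_memLp hL _)
    (Filter.Eventually.of_forall fun ω => (even_two_mul m).pow_nonneg _)]
  refine lintegral_congr fun ω => ?_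
  rw [Real.enorm_eq_ofReal_abs, ← ENNReal.ofReal_pow (abs_nonneg _), pow_mul, sq_abs, ← pow_mul]

/-- Moment bounds for complex linear combinations of independent sub-Gaussian variables. -/
lemma IsRandomizer.exists_lintegral_sum_pow_le [IsProbabilityMeasure μ] (hX : IsRandomizer X μ)
    {m : ℕ} (hm : 1 ≤ m) : ∃ D : ℝ≥0, ∀ (J : Finset ι) (a : ι → ℂ),
      ∫⁻ ω, ‖∑ k ∈ J, (X k ω : ℂ) * a k‖ₑ ^ (2 * m) ∂μ ≤ D * (∑ k ∈ J, ‖a k‖ₑ ^ 2) ^ m := by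
  obtain ⟨D, hD0, hD⟩ := hX.exists_lintegral_real_sum_pow_le hm
  refine ⟨(2 ^ m * D).toNNReal, fun J a => ?_⟩
  have hpt : ∀ ω, ‖∑ k ∈ J, (X k ω : ℂ) * a k‖ₑ ^ (2 * m) ≤
      ENNReal.ofReal (2 ^ (m - 1)) * (‖∑ k ∈ J, (a k).re * X k ω‖ₑ ^ (2 * m) +
        ‖∑ k ∈ J, (a k).im * X k ω‖ₑ ^ (2 * m)) := by
    intro ω
    set z : ℂ := ∑ k ∈ J, (X k ω : ℂ) * a k with hz
    have hre : z.re = ∑ k ∈ J, (a k).re * X k ω := by simp [hz, mul_comm]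
    have him : z.im = ∑ k ∈ J, (a k).im * X k ω := by simp [hz, mul_comm]
    rw [← hre, ← him, ← ofReal_norm, Real.enorm_eq_ofReal_abs, Real.enorm_eq_ofReal_abs,
      ← ENNReal.ofReal_pow (norm_nonneg _), ← ENNReal.ofReal_pow (abs_nonneg _),
      ← ENNReal.ofReal_pow (abs_nonneg _), ← ENNReal.ofReal_add (by positivity) (by positivity),
      ← ENNReal.ofReal_mul (by positivity)]
    refine ENNReal.ofReal_le_ofReal ?_
    rw [pow_mul, pow_mul, pow_mul, sq_abs, sq_abs, Complex.sq_norm, Complex.normSq_apply,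
      ← sq, ← sq]
    exact add_pow_le (sq_nonneg _) (sq_nonneg _) m
  have hsum : ∀ b : ι → ℝ, (∀ k, |b k| ≤ ‖a k‖) → ENNReal.ofReal (D * (∑ k ∈ J, b k ^ 2) ^ m) ≤
      ENNReal.ofReal D * (∑ k ∈ J, ‖a k‖ₑ ^ 2) ^ m := by
    intro b hb
    have : (∑ k ∈ J, ‖a k‖ₑ ^ 2) = ENNReal.ofReal (∑ k ∈ J, ‖a k‖ ^ 2) := by
      rw [ENNReal.ofReal_sum_of_nonneg fun _ _ => by positivity]
      exact Finset.sum_congr rfl fun k _ => by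
        rw [ENNReal.ofReal_pow (norm_nonneg _), ofReal_norm]
    rw [this, ← ENNReal.ofReal_pow (Finset.sum_nonneg fun _ _ => by positivity),
      ← ENNReal.ofReal_mul hD0]
    refine ENNReal.ofReal_le_ofReal ?_
    gcongr D * ?_ ^ m
    refine Finset.sum_le_sum fun k _ => ?_
    rw [← sq_abs]; gcongr; exact hb k
  have hmeas : ∀ b : ι → ℝ, Measurable fun ω => ‖∑ k ∈ J, b k * X k ω‖ₑ ^ (2 * m) := fun b =>
    (Finset.measurable_sum J fun i _ => (hX.measurable i).const_mul _).enorm.pow_const _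
  calc _ ≤ ∫⁻ ω, ENNReal.ofReal (2 ^ (m - 1)) * (‖∑ k ∈ J, (a k).re * X k ω‖ₑ ^ (2 * m) +
        ‖∑ k ∈ J, (a k).im * X k ω‖ₑ ^ (2 * m)) ∂μ := lintegral_mono hpt
    _ = ENNReal.ofReal (2 ^ (m - 1)) * (∫⁻ ω, ‖∑ k ∈ J, (a k).re * X k ω‖ₑ ^ (2 * m) ∂μ +
        ∫⁻ ω, ‖∑ k ∈ J, (a k).im * X k ω‖ₑ ^ (2 * m) ∂μ) := by
        rw [lintegral_const_mul' _ _ (by simp), lintegral_add_left (hmeas _)]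
    _ ≤ ENNReal.ofReal (2 ^ (m - 1)) * (ENNReal.ofReal D * (∑ k ∈ J, ‖a k‖ₑ ^ 2) ^ m +
        ENNReal.ofReal D * (∑ k ∈ J, ‖a k‖ₑ ^ 2) ^ m) := by
        gcongr
        · exact (hD J _).trans (hsum _ fun k => Complex.abs_re_le_norm _)
        · exact (hD J _).trans (hsum _ fun k => Complex.abs_im_le_norm _)
    _ = _ := by
        rw [← two_mul, ← mul_assoc, ← mul_assoc]
        congr 1
        change _ = ENNReal.ofReal (2 ^ m * D)
        rw [show (2 : ℝ≥0∞) = ENNReal.ofReal 2 by simp, ← ENNReal.ofReal_mul (by positivity),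
          ← ENNReal.ofReal_mul (by positivity), ← pow_succ, Nat.sub_add_cancel hm]

end Moments

/-! ### Sobolev distributions on the Fourier side -/

/-- `∫ (1 + |ξ|²)^s |h(ξ)|² dξ`. -/
def wnorm (s : ℝ) (h : E d → ℂ) : ℝ≥0∞ :=
  ∫⁻ ξ, ENNReal.ofReal ((1 + ‖ξ‖ ^ 2) ^ s) * ‖h ξ‖ₑ ^ 2

/-- `h` is the Fourier transform of `f`, with `(1 + |ξ|²)^{s/2} h` square integrable. -/
structure IsFourierSide (s : ℝ) (f : 𝓢'(E d, ℂ)) (h : E d → ℂ) : Prop where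
  meas : StronglyMeasurable h
  finite : wnorm s h < ∞
  rep : ∀ Ψ : 𝓢(E d, ℂ), f Ψ = ∫ ζ, h ζ * (𝓕⁻ Ψ) ζ

lemma exists_isFourierSide {s : ℝ} {f : 𝓢'(E d, ℂ)} (hf : MemSobolev s 2 f) :
    ∃ h, IsFourierSide s f h := by
  obtain ⟨f', hf'⟩ := memSobolev_iff_exists_smulLeftCLM_fourier.mp hf
  have hmul : ∀ (t : ℝ) (ξ : E d), (((1 + ‖ξ‖ ^ 2) ^ (t / 2) : ℝ) : ℂ) *
      (((1 + ‖ξ‖ ^ 2) ^ (-t / 2) : ℝ) : ℂ) = 1 := by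
    intro t ξ
    rw [← Complex.ofReal_mul, ← Real.rpow_add (by positivity)]
    ring_nf; simp
  refine ⟨fun ξ => (((1 + ‖ξ‖ ^ 2) ^ (-s / 2) : ℝ) : ℂ) * f' ξ, ?_, ?_, ?_⟩
  · refine StronglyMeasurable.mul (Measurable.stronglyMeasurable ?_) (Lp.stronglyMeasurable f')
    fun_prop
  · have h1 := Lp.eLpNorm_lt_top f'
    rw [eLpNorm_lt_top_iff_lintegral_rpow_enorm_lt_top (by norm_num) (by norm_num)] at h1
    refine lt_of_eq_of_lt (lintegral_congr fun ξ => ?_) h1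
    simp only [ENNReal.toReal_ofNat, ENNReal.rpow_ofNat]
    rw [enorm_mul, mul_pow, ← mul_assoc, ← ofReal_norm, Complex.norm_real,
      Real.norm_of_nonneg (by positivity), ← ENNReal.ofReal_pow (by positivity),
      ← ENNReal.ofReal_mul (by positivity), ← Real.rpow_mul_natCast (by positivity),
      ← Real.rpow_add (by positivity)]
    ring_nf; simp
  · intro Ψ
    have h1 : f Ψ = (𝓕 f) (𝓕⁻ Ψ) := by
      rw [TemperedDistribution.fourier_apply, FourierTransform.fourier_fourierInv_eq]
    have h2 : 𝓕⁻ Ψ = SchwartzMap.smulLeftCLM ℂ (fun x : E d => (((1 + ‖x‖ ^ 2) ^ (s / 2) : ℝ) : ℂ))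
        (SchwartzMap.smulLeftCLM ℂ (fun x : E d => (((1 + ‖x‖ ^ 2) ^ (-s / 2) : ℝ) : ℂ)) (𝓕⁻ Ψ)) := by
      ext ξ
      rw [SchwartzMap.smulLeftCLM_apply_apply (by fun_prop),
        SchwartzMap.smulLeftCLM_apply_apply (by fun_prop), smul_eq_mul, smul_eq_mul, ← mul_assoc,
        hmul, one_mul]
    rw [h1, h2, ← smulLeftCLM_apply_apply, hf', Lp.toTemperedDistribution_apply, ← h2]
    refine integral_congr_ae (Filter.Eventually.of_forall fun ξ => ?_)
    simp only
    rw [SchwartzMap.smulLeftCLM_apply_apply (by fun_prop), smul_eq_mul, smul_eq_mul]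
    ring

/-- Peetre's inequality. The elementary bound `key` is symmetric in its two points, and each sign of
`s` uses one of its two directions. -/
lemma one_add_norm_sq_rpow_le (s : ℝ) {n : ℕ} (hn : |s| ≤ n) (ξ ζ : E d) :
    (1 + ‖ξ‖ ^ 2) ^ s ≤ 2 ^ n * (1 + ‖ζ‖ ^ 2) ^ s * (1 + ‖ζ - ξ‖ ^ 2) ^ n := by
  have key : ∀ x y : E d, 1 + ‖x‖ ^ 2 ≤ 2 * (1 + ‖y - x‖ ^ 2) * (1 + ‖y‖ ^ 2) := by
    intro x y
    have : ‖x‖ ≤ ‖y - x‖ + ‖y‖ := by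
      calc ‖x‖ = ‖y - (y - x)‖ := by congr 1; abel
        _ ≤ ‖y‖ + ‖y - x‖ := norm_sub_le _ _
        _ = _ := add_comm _ _
    nlinarith [sq_nonneg (‖y - x‖ - ‖y‖), norm_nonneg x, mul_nonneg (sq_nonneg ‖y - x‖) (sq_nonneg ‖y‖)]
  set T : ℝ := 2 * (1 + ‖ζ - ξ‖ ^ 2) with hT
  have hT1 : 1 ≤ T := by nlinarith [sq_nonneg ‖ζ - ξ‖]
  have h1 := key ξ ζ
  have h2 := key ζ ξ
  rw [norm_sub_rev ξ ζ] at h2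
  have hz : 0 < 1 + ‖ζ‖ ^ 2 := by positivity
  have hx : 0 < 1 + ‖ξ‖ ^ 2 := by positivity
  have hTn : T ^ |s| ≤ T ^ n := by
    rw [← Real.rpow_natCast]; exact Real.rpow_le_rpow_of_exponent_le hT1 hn
  have main : (1 + ‖ξ‖ ^ 2) ^ s ≤ T ^ |s| * (1 + ‖ζ‖ ^ 2) ^ s := by
    rcases le_total 0 s with hs | hs
    · rw [abs_of_nonneg hs, ← Real.mul_rpow (by positivity) hz.le]
      exact Real.rpow_le_rpow hx.le h1 hs
    · rw [abs_of_nonpos hs]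
      have h3 : (1 + ‖ζ‖ ^ 2) ^ (-s) ≤ (T * (1 + ‖ξ‖ ^ 2)) ^ (-s) :=
        Real.rpow_le_rpow hz.le h2 (by linarith)
      rw [Real.mul_rpow (by positivity) hx.le, Real.rpow_neg hz.le, Real.rpow_neg hx.le] at h3
      have e1 : 0 < (1 + ‖ζ‖ ^ 2) ^ s := by positivity
      have e2 : 0 < (1 + ‖ξ‖ ^ 2) ^ s := by positivity
      rw [← div_eq_mul_inv, inv_le_comm₀ e1 (by positivity), inv_div] at h3
      rwa [div_le_iff₀ (by positivity), mul_comm] at h3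
  calc _ ≤ _ := main
    _ ≤ T ^ n * (1 + ‖ζ‖ ^ 2) ^ s := by gcongr
    _ = _ := by rw [hT, mul_pow]; ring

lemma one_add_norm_sq_rpow_le_pow (s : ℝ) {n : ℕ} (hn : |s| ≤ n) (ξ : E d) :
    (1 + ‖ξ‖ ^ 2) ^ s ≤ 2 ^ n * (1 + ‖ξ‖) ^ (2 * n) := by
  have h := one_add_norm_sq_rpow_le s hn ξ 0
  simp only [norm_zero, zero_sub, norm_neg] at h
  norm_num at h
  refine h.trans ?_
  rw [pow_mul]
  gcongr
  nlinarith [norm_nonneg ξ]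

lemma integrable_inv_one_add_norm {n : ℕ} (hn : d < n) :
    Integrable (fun x : E d => ((1 + ‖x‖) ^ n)⁻¹) := by
  have := integrable_one_add_norm (E := E d) (μ := volume) (r := n) (by simpa using hn)
  refine this.congr (Filter.Eventually.of_forall fun x => ?_)
  simp only
  rw [Real.rpow_neg (by positivity), Real.rpow_natCast]

/-- Young's inequality splits the product into the weighted square of `h` and a pure power. Of the
exponent `n + d + 1`, the part `n` absorbs the weight, and the remaining `d + 1`, doubled by
squaring, gives integrability. This is what justifies Fubini when `h` is paired with Schwartz
functions. -/
lemma integrable_mul_inv_one_add_norm {s : ℝ} {h : E d → ℂ} (hm : AEStronglyMeasurable h)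
    (hfin : wnorm s h < ∞) {n : ℕ} (hn : |s| ≤ n) :
    Integrable (fun ζ => ‖h ζ‖ * ((1 + ‖ζ‖) ^ (n + d + 1))⁻¹) := by
  have h1 : Integrable (fun ζ : E d => (1 + ‖ζ‖ ^ 2) ^ s * ‖h ζ‖ ^ 2) := by
    refine ⟨?_, ?_⟩
    · exact (Measurable.aestronglyMeasurable (by fun_prop)).mul (hm.norm.pow 2)
    · rw [HasFiniteIntegral]
      refine lt_of_eq_of_lt (lintegral_congr fun ζ => ?_) hfin
      rw [enorm_mul, enorm_pow, enorm_norm, Real.enorm_of_nonneg (by positivity)]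
  have h2 : Integrable (fun ζ : E d => 2 ^ n * ((1 + ‖ζ‖) ^ (2 * d + 2))⁻¹) :=
    (integrable_inv_one_add_norm (by omega)).const_mul _
  refine (h1.add h2).mono' ?_ (Filter.Eventually.of_forall fun ζ => ?_)
  · refine hm.norm.mul (Continuous.aestronglyMeasurable ?_)
    refine Continuous.inv₀ (by fun_prop) fun x => by positivity
  · rw [Real.norm_of_nonneg (by positivity)]
    simp only [Pi.add_apply]
    set a := (1 + ‖ζ‖ ^ 2) ^ (s / 2) with ha
    have ha0 : 0 < a := by positivity
    have ha2 : a ^ 2 = (1 + ‖ζ‖ ^ 2) ^ s := by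
      rw [ha, ← Real.rpow_natCast, ← Real.rpow_mul (by positivity)]; congr 1; push_cast; ring
    have hinv : a⁻¹ ^ 2 ≤ 2 ^ n * (1 + ‖ζ‖) ^ (2 * n) := by
      rw [inv_pow, ha2, ← Real.rpow_neg (by positivity)]
      exact one_add_norm_sq_rpow_le_pow (-s) (by rwa [abs_neg]) ζ
    set b := ((1 + ‖ζ‖) ^ (n + d + 1))⁻¹ with hb
    have hb2 : (a⁻¹ * b) ^ 2 ≤ 2 ^ n * ((1 + ‖ζ‖) ^ (2 * d + 2))⁻¹ := by
      rw [mul_pow]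
      calc a⁻¹ ^ 2 * b ^ 2 ≤ (2 ^ n * (1 + ‖ζ‖) ^ (2 * n)) * b ^ 2 := by gcongr
        _ = 2 ^ n * ((1 + ‖ζ‖) ^ (2 * d + 2))⁻¹ := by
          have hne : (1 + ‖ζ‖) ≠ 0 := by positivity
          rw [hb, inv_pow, ← pow_mul, show (n + d + 1) * 2 = 2 * n + (2 * d + 2) by ring, pow_add]
          field_simp
    have : ‖h ζ‖ * b = (a * ‖h ζ‖) * (a⁻¹ * b) := by field_simp
    rw [this, ← ha2, ← mul_pow]
    nlinarith [sq_nonneg (a * ‖h ζ‖ - a⁻¹ * b), sq_nonneg (a * ‖h ζ‖), sq_nonneg (a⁻¹ * b)]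

/-- The Fourier transform of `Φ(· - l) f` in terms of the Fourier transform `h` of `f`. -/
def lblock (Φ : 𝓢(E d, ℂ)) (h : E d → ℂ) (l : Fin d → ℤ) (ξ : E d) : ℂ :=
  ∫ ζ, h ζ * ((𝓕⁻ Φ) (ζ - ξ) * ech (latt l) (ζ - ξ))

lemma fourierInv_comp_sub (Φ : 𝓢(E d, ℂ)) (a η : E d) :
    (𝓕⁻ (SchwartzMap.compSubConstCLM ℂ a Φ)) η = (𝓕⁻ Φ) η * ech a η := by
  rw [SchwartzMap.fourierInv_coe, SchwartzMap.fourierInv_coe, fourierInv_eq_ech, fourierInv_eq_ech,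
    ← integral_mul_const, ← integral_sub_right_eq_self (fun ξ => ech η ξ * Φ ξ * ech a η) a]
  refine integral_congr_ae (Filter.Eventually.of_forall fun ξ => ?_)
  simp only [SchwartzMap.compSubConstCLM_apply]
  have : ech η ξ = ech η (ξ - a) * ech a η := by
    rw [ech_comm a η, ← ech_add_right]; congr 1; abel
  rw [this]; ring

lemma fourierInv_mul_fourier (Φ Θ : 𝓢(E d, ℂ)) (ζ : E d) :
    (𝓕⁻ (SchwartzMap.smulLeftCLM ℂ Φ (𝓕 Θ))) ζ = ∫ ξ, (𝓕⁻ Φ) (ζ - ξ) * Θ ξ := by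
  have h : SchwartzMap.smulLeftCLM ℂ Φ (𝓕 Θ) =
      𝓕 (SchwartzMap.convolution (ContinuousLinearMap.mul ℂ ℂ) Θ (𝓕⁻ Φ)) := by
    rw [SchwartzMap.fourier_convolution, FourierTransform.fourier_fourierInv_eq]
    ext x
    rw [SchwartzMap.smulLeftCLM_apply_apply Φ.hasTemperateGrowth, SchwartzMap.pairing_apply_apply]
    simp [mul_comm]
  rw [h, FourierTransform.fourierInv_fourier_eq, SchwartzMap.convolution_apply, convolution]
  simp [mul_comm]

/-- Fubini. Absolute convergence rests on `1 + ‖ζ‖ ≤ (1 + ‖ζ - ξ‖)(1 + ‖ξ‖)`: the decay of `𝓕⁻ Φ` in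
`ζ - ξ` and of `Θ` in `ξ` together give the decay in `ζ` that compensates for the growth of `h`. -/
lemma IsFourierSide.apply_mul_fourier {s : ℝ} {f : 𝓢'(E d, ℂ)} {h : E d → ℂ}
    (hf : IsFourierSide s f h) (Φ Θ : 𝓢(E d, ℂ)) (l : Fin d → ℤ) :
    f (SchwartzMap.smulLeftCLM ℂ (fun x => Φ (x - latt l)) (𝓕 Θ)) = ∫ ξ, lblock Φ h l ξ * Θ ξ := by
  have h1 : (fun x => Φ (x - latt l)) = SchwartzMap.compSubConstCLM ℂ (latt l) Φ := by
    ext x; simp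
  rw [hf.rep, h1]
  simp_rw [fourierInv_mul_fourier, fourierInv_comp_sub, lblock, ← integral_const_mul,
    ← integral_mul_const, ← mul_assoc]
  refine integral_integral_swap ?_
  set n := ⌈|s|⌉₊ with hn
  obtain ⟨C₁, hC₁, h₁⟩ := exists_decay (𝓕⁻ Φ) (n + d + 1)
  obtain ⟨C₂, hC₂, h₂⟩ := exists_decay Θ ((n + d + 1) + (d + 1))
  have hI := ((integrable_mul_inv_one_add_norm hf.meas.aestronglyMeasurable hf.finite
    (Nat.le_ceil |s|)).mul_prod (integrable_inv_one_add_norm (d := d) (n := d + 1) (by omega))).const_mul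
      (C₁ * C₂)
  refine hI.mono' ?_ (Filter.Eventually.of_forall fun p => ?_)
  · refine StronglyMeasurable.aestronglyMeasurable ?_
    have e1 : Continuous (fun p : E d × E d => (𝓕⁻ Φ) (p.1 - p.2)) :=
      (𝓕⁻ Φ).continuous.comp (by fun_prop)
    have e2 : Continuous (fun p : E d × E d => ech (latt l) (p.1 - p.2)) := by fun_prop
    have e3 : Continuous (fun p : E d × E d => Θ p.2) := Θ.continuous.comp (by fun_prop)
    exact (((hf.meas.comp_measurable measurable_fst).mul e1.stronglyMeasurable).mul
      e2.stronglyMeasurable).mul e3.stronglyMeasurable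
  · obtain ⟨ζ, ξ⟩ := p
    simp only [Function.uncurry_apply_pair, norm_mul, norm_ech, mul_one]
    have a1 := h₁ (ζ - ξ)
    have a2 := h₂ ξ
    have a3 : 1 + ‖ζ‖ ≤ (1 + ‖ζ - ξ‖) * (1 + ‖ξ‖) := by
      have : ‖ζ‖ ≤ ‖ζ - ξ‖ + ‖ξ‖ := by simpa using norm_add_le (ζ - ξ) ξ
      nlinarith [norm_nonneg (ζ - ξ), norm_nonneg ξ, mul_nonneg (norm_nonneg (ζ - ξ)) (norm_nonneg ξ)]
    have a4 : ‖(𝓕⁻ Φ) (ζ - ξ)‖ * ‖Θ ξ‖ * ((1 + ‖ζ‖) ^ (n + d + 1) * (1 + ‖ξ‖) ^ (d + 1)) ≤ C₁ * C₂ := by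
      calc _ ≤ ‖(𝓕⁻ Φ) (ζ - ξ)‖ * ‖Θ ξ‖ *
            (((1 + ‖ζ - ξ‖) * (1 + ‖ξ‖)) ^ (n + d + 1) * (1 + ‖ξ‖) ^ (d + 1)) := by gcongr
        _ = ((1 + ‖ζ - ξ‖) ^ (n + d + 1) * ‖(𝓕⁻ Φ) (ζ - ξ)‖) *
            ((1 + ‖ξ‖) ^ ((n + d + 1) + (d + 1)) * ‖Θ ξ‖) := by rw [mul_pow, pow_add _ (n + d + 1)]; ring
        _ ≤ C₁ * C₂ := by gcongr
    have a5 : ‖(𝓕⁻ Φ) (ζ - ξ)‖ * ‖Θ ξ‖ ≤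
        C₁ * C₂ * (((1 + ‖ζ‖) ^ (n + d + 1))⁻¹ * ((1 + ‖ξ‖) ^ (d + 1))⁻¹) := by
      rw [← mul_inv, ← div_eq_mul_inv, le_div_iff₀ (by positivity)]; exact a4
    calc _ = ‖h ζ‖ * (‖(𝓕⁻ Φ) (ζ - ξ)‖ * ‖Θ ξ‖) := by ring
      _ ≤ ‖h ζ‖ * (C₁ * C₂ * (((1 + ‖ζ‖) ^ (n + d + 1))⁻¹ * ((1 + ‖ξ‖) ^ (d + 1))⁻¹)) := by gcongr
      _ = _ := by ring

lemma stronglyMeasurable_lblock (Φ : 𝓢(E d, ℂ)) {h : E d → ℂ} (hm : StronglyMeasurable h)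
    (l : Fin d → ℤ) : StronglyMeasurable (lblock Φ h l) := by
  refine StronglyMeasurable.integral_prod_right ?_
  have e1 : Continuous (fun p : E d × E d => (𝓕⁻ Φ) (p.2 - p.1)) :=
    (𝓕⁻ Φ).continuous.comp (by fun_prop)
  have e2 : Continuous (fun p : E d × E d => ech (latt l) (p.2 - p.1)) := by fun_prop
  exact (hm.comp_measurable measurable_snd).mul (e1.mul e2).stronglyMeasurable

/-- For fixed `ξ`, the numbers `lblock Φ h l ξ` are, up to phases, coefficients of `h` against
integer modulations of a profile centred at `ξ`, so `bessel` with `n = 1` sums them over `l`.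
Writing `𝓕⁻ Φ` as a Schwartz function `ρ` times `(1 + ‖·‖²)^{-M}` leaves decay in `ζ - ξ` next to
`h`. That decay pays for moving the weight from `ξ` to `ζ` by Peetre's inequality and for the
integral in `ξ`. -/
lemma tsum_wnorm_lblock_lt_top (s : ℝ) (Φ : 𝓢(E d, ℂ)) {h : E d → ℂ} (hm : StronglyMeasurable h)
    (hfin : wnorm s h < ∞) : ∑' l, wnorm s (lblock Φ h l) < ∞ := by
  set n := ⌈|s|⌉₊ with hn
  set M := n + d + 1 with hM
  set ρ : 𝓢(E d, ℂ) := SchwartzMap.smulLeftCLM ℂ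
    (fun x : E d => (((1 + ‖x‖ ^ 2) ^ M : ℝ) : ℂ)) (𝓕⁻ Φ) with hρ
  have hρa : ∀ x, ρ x = (((1 + ‖x‖ ^ 2) ^ M : ℝ) : ℂ) * (𝓕⁻ Φ) x := fun x => by
    rw [hρ, SchwartzMap.smulLeftCLM_apply_apply (by fun_prop), smul_eq_mul]
  obtain ⟨C, hC⟩ := bessel ρ
  have hpt : ∀ ξ, ∑' l, ‖lblock Φ h l ξ‖ₑ ^ 2 ≤
      C * ∫⁻ ζ, ‖h ζ‖ₑ ^ 2 * ENNReal.ofReal (((1 + ‖ζ - ξ‖ ^ 2) ^ (2 * M))⁻¹) := by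
    intro ξ
    set G : E d → ℂ := fun ζ => h ζ * (((1 + ‖ζ - ξ‖ ^ 2) ^ M)⁻¹ : ℝ) with hG
    have hGm : AEStronglyMeasurable G := by
      refine hm.aestronglyMeasurable.mul (Measurable.aestronglyMeasurable ?_)
      fun_prop
    have := hC 1 le_rfl ξ G hGm
    simp only [Nat.cast_one, one_pow, mul_one, inv_one, one_smul] at this
    convert this using 4 with l ζ
    · have : lblock Φ h l ξ = ech (latt l) (-ξ) * ∫ ζ, G ζ * (ρ (ζ - ξ) * ech (latt l) ζ) := by
        rw [lblock, ← integral_const_mul]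
        refine integral_congr_ae (Filter.Eventually.of_forall fun ζ => ?_)
        simp only [hG, hρa, ech_sub_right]
        have hne : (((1 + ‖ζ - ξ‖ ^ 2) ^ M : ℝ) : ℂ) ≠ 0 := by
          exact_mod_cast (by positivity : ((1 + ‖ζ - ξ‖ ^ 2) ^ M : ℝ) ≠ 0)
        rw [Complex.ofReal_inv]
        field_simp
      rw [this, enorm_mul, ← ofReal_norm (ech _ _), norm_ech]; simp
    · rw [hG]
      simp only
      rw [enorm_mul, mul_pow, ← ofReal_norm ((_ : ℝ) : ℂ), Complex.norm_real,
        Real.norm_of_nonneg (by positivity), ← ENNReal.ofReal_pow (by positivity), inv_pow,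
        ← pow_mul, mul_comm M 2]
  have hmb : ∀ l, Measurable fun ξ => ENNReal.ofReal ((1 + ‖ξ‖ ^ 2) ^ s) * ‖lblock Φ h l ξ‖ₑ ^ 2 :=
    fun l => Measurable.mul (by fun_prop) ((stronglyMeasurable_lblock Φ hm l).measurable.enorm.pow_const 2)
  set I₀ : ℝ≥0∞ := ∫⁻ ξ : E d, ENNReal.ofReal (2 ^ n * ((1 + ‖ξ‖ ^ 2) ^ (d + 1))⁻¹) with hI₀
  have hI₀fin : I₀ < ∞ := by
    have : Integrable (fun ξ : E d => 2 ^ n * ((1 + ‖ξ‖ ^ 2) ^ (d + 1))⁻¹) := by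
      have := integrable_rpow_neg_one_add_norm_sq (E := E d) (μ := volume) (r := (2 * (d + 1) : ℝ))
        (by simp; linarith)
      refine (this.const_mul (2 ^ n)).congr (Filter.Eventually.of_forall fun x => ?_)
      simp only
      rw [show -(2 * ((d : ℝ) + 1)) / 2 = -((d + 1 : ℕ) : ℝ) by push_cast; ring,
        Real.rpow_neg (by positivity), Real.rpow_natCast]
    exact this.lintegral_lt_top
  calc ∑' l, wnorm s (lblock Φ h l)
      = ∫⁻ ξ, ∑' l, ENNReal.ofReal ((1 + ‖ξ‖ ^ 2) ^ s) * ‖lblock Φ h l ξ‖ₑ ^ 2 := by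
        rw [lintegral_tsum fun l => (hmb l).aemeasurable]; rfl
    _ = ∫⁻ ξ, ENNReal.ofReal ((1 + ‖ξ‖ ^ 2) ^ s) * ∑' l, ‖lblock Φ h l ξ‖ₑ ^ 2 := by
        simp_rw [ENNReal.tsum_mul_left]
    _ ≤ ∫⁻ ξ, ENNReal.ofReal ((1 + ‖ξ‖ ^ 2) ^ s) *
          (C * ∫⁻ ζ, ‖h ζ‖ₑ ^ 2 * ENNReal.ofReal (((1 + ‖ζ - ξ‖ ^ 2) ^ (2 * M))⁻¹)) := by
        gcongr with ξ; exact hpt ξ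
    _ = C * ∫⁻ ξ, ∫⁻ ζ, ENNReal.ofReal ((1 + ‖ξ‖ ^ 2) ^ s) *
          (‖h ζ‖ₑ ^ 2 * ENNReal.ofReal (((1 + ‖ζ - ξ‖ ^ 2) ^ (2 * M))⁻¹)) := by
        rw [← lintegral_const_mul' _ _ ENNReal.coe_ne_top]
        refine lintegral_congr fun ξ => ?_
        rw [lintegral_const_mul' _ _ ENNReal.ofReal_ne_top]; ring
    _ ≤ C * ∫⁻ ξ, ∫⁻ ζ, (ENNReal.ofReal ((1 + ‖ζ‖ ^ 2) ^ s) * ‖h ζ‖ₑ ^ 2) *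
          ENNReal.ofReal (2 ^ n * ((1 + ‖ζ - ξ‖ ^ 2) ^ (d + 1))⁻¹) := by
        gcongr C * ?_
        refine lintegral_mono fun ξ => lintegral_mono fun ζ => ?_
        rw [mul_left_comm, mul_comm (ENNReal.ofReal ((1 + ‖ζ‖ ^ 2) ^ s)), mul_assoc]
        gcongr ‖h ζ‖ₑ ^ 2 * ?_
        rw [← ENNReal.ofReal_mul (by positivity), ← ENNReal.ofReal_mul (by positivity)]
        refine ENNReal.ofReal_le_ofReal ?_
        have h1 := one_add_norm_sq_rpow_le s (Nat.le_ceil |s|) ξ ζ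
        rw [← hn] at h1
        set A := 1 + ‖ζ - ξ‖ ^ 2 with hA
        have hA1 : 1 ≤ A := by nlinarith [sq_nonneg ‖ζ - ξ‖]
        have h2 : A ^ n * (A ^ (2 * M))⁻¹ ≤ (A ^ (d + 1))⁻¹ := by
          rw [← div_eq_mul_inv, div_le_iff₀ (by positivity), ← div_eq_inv_mul,
            le_div_iff₀ (by positivity), ← pow_add]
          exact pow_le_pow_right₀ hA1 (by omega)
        calc _ ≤ (2 ^ n * (1 + ‖ζ‖ ^ 2) ^ s * A ^ n) * (A ^ (2 * M))⁻¹ := by gcongr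
          _ = (1 + ‖ζ‖ ^ 2) ^ s * (2 ^ n * (A ^ n * (A ^ (2 * M))⁻¹)) := by ring
          _ ≤ _ := by gcongr
    _ = C * ∫⁻ ζ, ∫⁻ ξ, (ENNReal.ofReal ((1 + ‖ζ‖ ^ 2) ^ s) * ‖h ζ‖ₑ ^ 2) *
          ENNReal.ofReal (2 ^ n * ((1 + ‖ζ - ξ‖ ^ 2) ^ (d + 1))⁻¹) := by
        rw [lintegral_lintegral_swap]
        refine Measurable.aemeasurable ?_
        have := hm.measurable
        simp only [Function.uncurry_def]
        fun_prop
    _ = C * ∫⁻ ζ, (ENNReal.ofReal ((1 + ‖ζ‖ ^ 2) ^ s) * ‖h ζ‖ₑ ^ 2) * I₀ := by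
        congr 1
        refine lintegral_congr fun ζ => ?_
        rw [lintegral_const_mul' _ _ (ENNReal.mul_ne_top ENNReal.ofReal_ne_top (by simp))]
        congr 1
        rw [hI₀]
        exact lintegral_sub_left_eq_self
          (fun x : E d => ENNReal.ofReal (2 ^ n * ((1 + ‖x‖ ^ 2) ^ (d + 1))⁻¹)) ζ
    _ = C * (wnorm s h * I₀) := by
        rw [lintegral_mul_const' _ _ hI₀fin.ne]; rfl
    _ < ∞ := ENNReal.mul_lt_top ENNReal.coe_lt_top (ENNReal.mul_lt_top hfin hI₀fin)

/-! ### Randomization in physical space -/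

lemma enorm_integral_mul_sq_le {α : Type*} [MeasurableSpace α] {ν : Measure α} {F G : α → ℂ}
    (hF : AEMeasurable F ν) (hG : AEMeasurable G ν) :
    ‖∫ x, F x * G x ∂ν‖ₑ ^ 2 ≤ (∫⁻ x, ‖F x‖ₑ ^ 2 ∂ν) * ∫⁻ x, ‖G x‖ₑ ^ 2 ∂ν := by
  have h1 : ‖∫ x, F x * G x ∂ν‖ₑ ≤ ∫⁻ x, ‖F x‖ₑ * ‖G x‖ₑ ∂ν := by
    refine (enorm_integral_le_lintegral_enorm _).trans (le_of_eq ?_)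
    simp_rw [enorm_mul]
  have h2 := ENNReal.lintegral_mul_le_Lp_mul_Lq ν Real.HolderConjugate.two_two hF.enorm hG.enorm
  have h3 := h1.trans h2
  calc _ ≤ ((∫⁻ x, ‖F x‖ₑ ^ (2 : ℝ) ∂ν) ^ (1 / (2 : ℝ)) *
        (∫⁻ x, ‖G x‖ₑ ^ (2 : ℝ) ∂ν) ^ (1 / (2 : ℝ))) ^ 2 := by gcongr
    _ = _ := by
      rw [mul_pow, ← ENNReal.rpow_natCast, ← ENNReal.rpow_natCast, ← ENNReal.rpow_mul,
        ← ENNReal.rpow_mul]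
      norm_num

lemma summable_of_orthogonal {ι H : Type*} [NormedAddCommGroup H] [InnerProductSpace ℂ H]
    [CompleteSpace H] {z : ι → H} (horth : ∀ i j, i ≠ j → inner ℂ (z i) (z j) = 0)
    (hsum : Summable fun i => ‖z i‖ ^ 2) : Summable z := by
  have hO : OrthogonalFamily ℂ (fun i => Submodule.span ℂ {z i})
      (fun i => (Submodule.span ℂ {z i}).subtypeₗᵢ) := by
    refine OrthogonalFamily.of_pairwise fun i j hij => ?_
    simp only [Function.onFun]
    rw [Submodule.isOrtho_span]
    rintro u rfl v rfl
    exact horth i j hij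
  exact (hO.summable_iff_norm_sq_summable
    (fun i => ⟨z i, Submodule.mem_span_singleton_self _⟩)).mpr hsum

lemma sq_enorm_Lp_two {α : Type*} [MeasurableSpace α] {ν : Measure α} (f : Lp ℂ 2 ν) :
    ‖f‖ₑ ^ 2 = ∫⁻ x, ‖f x‖ₑ ^ 2 ∂ν := by
  rw [Lp.enorm_def, eLpNorm_eq_lintegral_rpow_enorm_toReal (by norm_num) (by norm_num),
    ← ENNReal.rpow_natCast, ← ENNReal.rpow_mul]
  simp

lemma memLp_two_of_lintegral {α : Type*} [MeasurableSpace α] {ν : Measure α} {F : α → ℂ}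
    (hF : AEStronglyMeasurable F ν) (h : ∫⁻ x, ‖F x‖ₑ ^ 2 ∂ν < ∞) : MemLp F 2 ν := by
  refine ⟨hF, ?_⟩
  rw [eLpNorm_lt_top_iff_lintegral_rpow_enorm_lt_top (by norm_num) (by norm_num)]
  simpa using h

lemma coeFn_sum_toLp {ι α : Type*} [MeasurableSpace α] {ν : Measure α} {Z : ι → α → ℂ}
    (hZ : ∀ i, MemLp (Z i) 2 ν) (J : Finset ι) :
    ((∑ i ∈ J, (hZ i).toLp (Z i) : Lp ℂ 2 ν) : α → ℂ) =ᵐ[ν] fun x => ∑ i ∈ J, Z i x := by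
  classical
  induction J using Finset.induction_on with
  | empty =>
    filter_upwards [Lp.coeFn_zero ℂ 2 ν] with x hx
    simpa using hx
  | insert i J hi ih =>
    rw [Finset.sum_insert hi]
    filter_upwards [Lp.coeFn_add ((hZ i).toLp (Z i)) (∑ i ∈ J, (hZ i).toLp (Z i)),
      (hZ i).coeFn_toLp, ih] with x h1 h2 h3
    rw [h1, Pi.add_apply, h2, h3, Finset.sum_insert hi]

/-- An orthogonal series in `L²(μ ⊗ ν)` converges, along a sequence of finite partial sums, in
`L²(ν)` for `μ`-almost every parameter. -/
lemma exists_ae_limit_of_orthogonal {ι Ω α : Type*} [Countable ι] [MeasurableSpace Ω]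
    [MeasurableSpace α] {μ : Measure Ω} {ν : Measure α} [SFinite μ] [SFinite ν]
    {Z : ι → Ω × α → ℂ} (hZm : ∀ i, StronglyMeasurable (Z i))
    (hsum : ∑' i, ∫⁻ p, ‖Z i p‖ₑ ^ 2 ∂(μ.prod ν) < ∞)
    (horth : ∀ i j, i ≠ j → ∫ p, Z j p * (starRingEnd ℂ) (Z i p) ∂(μ.prod ν) = 0) :
    ∃ (S : Ω × α → ℂ) (u : ℕ → Finset ι), StronglyMeasurable S ∧
      Filter.Tendsto u Filter.atTop Filter.atTop ∧
      ∀ᵐ ω ∂μ, (∫⁻ x, ‖S (ω, x)‖ₑ ^ 2 ∂ν < ∞) ∧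
        Filter.Tendsto (fun n => ∫⁻ x, ‖∑ i ∈ u n, Z i (ω, x) - S (ω, x)‖ₑ ^ 2 ∂ν)
          Filter.atTop (nhds 0) := by
  have hZ : ∀ i, MemLp (Z i) 2 (μ.prod ν) := fun i =>
    memLp_two_of_lintegral (hZm i).aestronglyMeasurable ((ENNReal.le_tsum i).trans_lt hsum)
  set z : ι → Lp ℂ 2 (μ.prod ν) := fun i => (hZ i).toLp (Z i) with hz
  have hzc : ∀ i, z i =ᵐ[μ.prod ν] Z i := fun i => (hZ i).coeFn_toLp
  have hzn : ∀ i, ‖z i‖ₑ ^ 2 = ∫⁻ p, ‖Z i p‖ₑ ^ 2 ∂(μ.prod ν) := fun i => by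
    rw [sq_enorm_Lp_two]
    refine lintegral_congr_ae ?_
    filter_upwards [hzc i] with p hp
    rw [hp]
  have hzs : Summable z := by
    refine summable_of_orthogonal (fun i j hij => ?_) ?_
    · rw [L2.inner_def, ← horth i j hij]
      refine integral_congr_ae ?_
      filter_upwards [hzc i, hzc j] with p h1 h2
      rw [h1, h2]; simp
    · have h1 : ∑' i, ENNReal.ofReal (‖z i‖ ^ 2) ≠ ∞ := by
        simp_rw [ENNReal.ofReal_pow (norm_nonneg _), ofReal_norm, hzn]; exact hsum.ne
      have := ENNReal.summable_toReal h1
      refine this.congr fun i => ENNReal.toReal_ofReal (by positivity)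
  obtain ⟨zs, hzs⟩ := hzs
  obtain ⟨v, hv⟩ := Filter.exists_seq_tendsto (Filter.atTop : Filter (Finset ι))
  have hlim : Filter.Tendsto (fun n => ‖∑ i ∈ v n, z i - zs‖ₑ ^ 2) Filter.atTop (nhds 0) := by
    have h1 : Filter.Tendsto (fun n => ∑ i ∈ v n, z i) Filter.atTop (nhds zs) := hzs.comp hv
    have h2 := (continuous_enorm.tendsto (0 : Lp ℂ 2 (μ.prod ν))).comp
      (tendsto_sub_nhds_zero_iff.mpr h1)
    have h3 := ((ENNReal.continuous_pow 2).tendsto _).comp h2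
    simpa [Function.comp_def] using h3
  -- Errors at most `2^{-n}` are summable, so by Tonelli the slice errors are summable for almost
  -- every parameter and tend to zero there.
  obtain ⟨ns, hns, hns'⟩ := Filter.extraction_forall_of_eventually
    (P := fun j n => ‖∑ i ∈ v n, z i - zs‖ₑ ^ 2 ≤ (2⁻¹ : ℝ≥0∞) ^ j) (fun j =>
      hlim.eventually_le_const (ENNReal.pow_pos (by norm_num) j))
  set S : Ω × α → ℂ := ⇑zs with hS
  have hSm : StronglyMeasurable S := Lp.stronglyMeasurable zs
  set u := v ∘ ns with hu
  have hDm : ∀ n, StronglyMeasurable fun p : Ω × α => ∑ i ∈ u n, Z i p - S p := fun n =>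
    (Finset.stronglyMeasurable_fun_sum _ fun i _ => hZm i).sub hSm
  have hDn : ∀ n, ∫⁻ p, ‖∑ i ∈ u n, Z i p - S p‖ₑ ^ 2 ∂(μ.prod ν) ≤ (2⁻¹ : ℝ≥0∞) ^ n := by
    intro n
    refine le_trans (le_of_eq ?_) (hns' n)
    rw [sq_enorm_Lp_two]
    refine lintegral_congr_ae ?_
    filter_upwards [Lp.coeFn_sub (∑ i ∈ u n, z i) zs, coeFn_sum_toLp hZ (u n)] with p h1 h2
    rw [← h2, hS]
    simp only [hu, Function.comp] at h1 ⊢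
    rw [h1, Pi.sub_apply]
  refine ⟨S, u, hSm, hv.comp hns.tendsto_atTop, ?_⟩
  have hmeasS : Measurable fun ω => ∫⁻ x, ‖S (ω, x)‖ₑ ^ 2 ∂ν :=
    Measurable.lintegral_prod_right' (f := fun p => ‖S p‖ₑ ^ 2) (hSm.measurable.enorm.pow_const 2)
  have hmeasD : ∀ n, Measurable fun ω => ∫⁻ x, ‖∑ i ∈ u n, Z i (ω, x) - S (ω, x)‖ₑ ^ 2 ∂ν := fun n =>
    Measurable.lintegral_prod_right' (f := fun p => ‖∑ i ∈ u n, Z i p - S p‖ₑ ^ 2)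
      ((hDm n).measurable.enorm.pow_const 2)
  have hfinS : ∫⁻ ω, ∫⁻ x, ‖S (ω, x)‖ₑ ^ 2 ∂ν ∂μ ≠ ∞ := by
    rw [← lintegral_prod (fun p => ‖S p‖ₑ ^ 2) (hSm.measurable.enorm.pow_const 2).aemeasurable, hS,
      ← sq_enorm_Lp_two]
    exact ENNReal.pow_ne_top (by simp)
  have hfinD : ∫⁻ ω, ∑' n, ∫⁻ x, ‖∑ i ∈ u n, Z i (ω, x) - S (ω, x)‖ₑ ^ 2 ∂ν ∂μ ≠ ∞ := by
    rw [lintegral_tsum fun n => (hmeasD n).aemeasurable]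
    refine ne_top_of_le_ne_top ?_ (ENNReal.tsum_le_tsum (g := fun n => (2⁻¹ : ℝ≥0∞) ^ n) fun n => ?_)
    · rw [ENNReal.tsum_geometric]; norm_num
    · rw [← lintegral_prod (fun p => ‖∑ i ∈ u n, Z i p - S p‖ₑ ^ 2)
        ((hDm n).measurable.enorm.pow_const 2).aemeasurable]
      exact hDn n
  filter_upwards [ae_lt_top hmeasS hfinS, ae_lt_top (Measurable.tsum hmeasD) hfinD]
    with ω h1 h2
  exact ⟨h1, ENNReal.tendsto_atTop_zero_of_tsum_ne_top h2.ne⟩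

/-! ### Decay of a distribution tested on translated cut-offs, and growth of the coefficients. -/

lemma exists_seminorm_translate_le (Φ Ψ : 𝓢(E d, ℂ)) (k n M : ℕ) : ∃ C : ℝ, 0 ≤ C ∧
    ∀ l : Fin d → ℤ, SchwartzMap.seminorm ℂ k n
      (SchwartzMap.smulLeftCLM ℂ (fun x => Φ (x - latt l)) Ψ) ≤ C * ((1 + ‖latt l‖) ^ M)⁻¹ := by
  have hdec : ∀ (Φ : 𝓢(E d, ℂ)) (M i : ℕ), ∃ C : ℝ, 0 ≤ C ∧
      ∀ x, (1 + ‖x‖) ^ M * ‖iteratedFDeriv ℝ i Φ x‖ ≤ C := fun Φ M i =>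
    ⟨_, by positivity, fun x => SchwartzMap.one_add_le_sup_seminorm_apply (𝕜 := ℝ) (m := (M, i))
      le_rfl le_rfl Φ x⟩
  choose A hA0 hA using hdec Φ M
  choose B hB0 hB using hdec Ψ (k + M)
  set C := ∑ i ∈ Finset.range (n + 1), (n.choose i : ℝ) * A i * B (n - i) with hC
  have hC0 : 0 ≤ C := Finset.sum_nonneg fun i _ => by
    have := hA0 i; have := hB0 (n - i); positivity
  refine ⟨C, hC0, fun l => SchwartzMap.seminorm_le_bound ℂ k n _ (by positivity) fun x => ?_⟩
  have hcoe : ⇑(SchwartzMap.smulLeftCLM ℂ (fun x => Φ (x - latt l)) Ψ) =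
      fun y => Φ (y - latt l) * Ψ y := by
    ext y
    have : (fun x => Φ (x - latt l)) = SchwartzMap.compSubConstCLM ℂ (latt l) Φ := by
      ext x; simp
    rw [SchwartzMap.smulLeftCLM_apply_apply (by rw [this]; exact SchwartzMap.hasTemperateGrowth _)]
    rfl
  rw [hcoe, ← div_eq_mul_inv, le_div_iff₀ (by positivity)]
  have hsm : ContDiff ℝ n (fun y => Φ (y - latt l)) :=
    (Φ.smooth n).comp (contDiff_id.sub contDiff_const)
  have h1 := norm_iteratedFDeriv_mul_le (𝕜 := ℝ) hsm (Ψ.smooth n) x le_rfl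
  have h3 : 1 + ‖latt l‖ ≤ (1 + ‖x - latt l‖) * (1 + ‖x‖) := by
    have : ‖latt l‖ ≤ ‖x - latt l‖ + ‖x‖ := by
      rw [norm_sub_rev]; simpa using norm_add_le (latt l - x) x
    nlinarith [norm_nonneg (x - latt l), norm_nonneg x,
      mul_nonneg (norm_nonneg (x - latt l)) (norm_nonneg x)]
  calc ‖x‖ ^ k * ‖iteratedFDeriv ℝ n (fun y => Φ (y - latt l) * Ψ y) x‖ * (1 + ‖latt l‖) ^ M
      ≤ (1 + ‖x‖) ^ k * (∑ i ∈ Finset.range (n + 1), (n.choose i : ℝ) *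
          ‖iteratedFDeriv ℝ i (fun y => Φ (y - latt l)) x‖ * ‖iteratedFDeriv ℝ (n - i) Ψ x‖) *
          ((1 + ‖x - latt l‖) * (1 + ‖x‖)) ^ M := by
        gcongr
        linarith [norm_nonneg x]
    _ = ∑ i ∈ Finset.range (n + 1), (n.choose i : ℝ) *
          ((1 + ‖x - latt l‖) ^ M * ‖iteratedFDeriv ℝ i Φ (x - latt l)‖) *
          ((1 + ‖x‖) ^ (k + M) * ‖iteratedFDeriv ℝ (n - i) Ψ x‖) := by
        rw [Finset.mul_sum, Finset.sum_mul]
        refine Finset.sum_congr rfl fun i _ => ?_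
        rw [iteratedFDeriv_comp_sub, mul_pow, pow_add]; ring
    _ ≤ C := by
        refine Finset.sum_le_sum fun i _ => ?_
        have := hA0 i
        gcongr
        · exact hA i _
        · exact hB _ x

/-- A tempered distribution is controlled by finitely many Schwartz seminorms. Those of `Φ(· - l) Ψ`
decay faster than any power of `l`, because one factor is concentrated near `l` and the other near
the origin. -/
lemma exists_translate_decay (T : 𝓢'(E d, ℂ)) (Φ Ψ : 𝓢(E d, ℂ)) (M : ℕ) : ∃ C : ℝ, 0 ≤ C ∧
    ∀ l : Fin d → ℤ, ‖T (SchwartzMap.smulLeftCLM ℂ (fun x => Φ (x - latt l)) Ψ)‖ ≤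
      C * ((1 + ‖latt l‖) ^ M)⁻¹ := by
  set q : Seminorm ℂ 𝓢(E d, ℂ) := (normSeminorm ℂ ℂ).comp (T : 𝓢(E d, ℂ) →L[ℂ] ℂ).toLinearMap with hq
  have hqc : Continuous q := continuous_norm.comp (T : 𝓢(E d, ℂ) →L[ℂ] ℂ).continuous
  obtain ⟨s, C, _, hC⟩ := Seminorm.bound_of_continuous (schwartz_withSeminorms ℂ (E d) ℂ) q hqc
  choose A hA0 hA using fun p : ℕ × ℕ => exists_seminorm_translate_le Φ Ψ p.1 p.2 M
  have hS0 : 0 ≤ ∑ p ∈ s, A p := Finset.sum_nonneg fun p _ => hA0 p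
  refine ⟨C * ∑ p ∈ s, A p, by positivity, fun l => ?_⟩
  refine (hC (SchwartzMap.smulLeftCLM ℂ (fun x => Φ (x - latt l)) Ψ)).trans ?_
  rw [smul_apply, mul_assoc, NNReal.smul_def, smul_eq_mul]
  gcongr
  refine Seminorm.finset_sup_apply_le (by positivity) fun p hp => (hA p l).trans ?_
  gcongr
  exact Finset.single_le_sum (fun p _ => hA0 p) hp

section Randomization

variable {Ω : Type*} [MeasurableSpace Ω] {μ : Measure Ω} [IsProbabilityMeasure μ]

/-- The sum of `(1 + ‖l‖)^{-2d} |Y_l|` has finite expectation, hence is almost surely finite and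
bounds each of its terms. Such crude growth suffices: it meets rapid decay in the distributional
series and a very fine mesh in the grid comparison. -/
lemma IsRandomizer.ae_growth {Y : (Fin d → ℤ) → Ω → ℝ} (hY : IsRandomizer Y μ) :
    ∀ᵐ ω ∂μ, ∃ C : ℝ, 0 ≤ C ∧ ∀ l, |Y l ω| ≤ C * (1 + ‖latt l‖) ^ (2 * d) := by
  obtain ⟨B, hB⟩ := hY.exists_lintegral_pow_le 1
  have hm : ∀ l, Measurable fun ω => ENNReal.ofReal (((1 + ‖latt l‖) ^ (2 * d))⁻¹) * ‖Y l ω‖ₑ :=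
    fun l => (hY.measurable l).enorm.const_mul _
  have h1 : ∫⁻ ω, ∑' l, ENNReal.ofReal (((1 + ‖latt l‖) ^ (2 * d))⁻¹) * ‖Y l ω‖ₑ ∂μ ≠ ∞ := by
    rw [lintegral_tsum fun l => (hm l).aemeasurable]
    refine ne_top_of_le_ne_top ?_ (ENNReal.tsum_le_tsum
      (g := fun l : Fin d → ℤ => ENNReal.ofReal (((1 + ‖latt l‖) ^ (2 * d))⁻¹) * B) fun l => ?_)
    · rw [ENNReal.tsum_mul_right]
      exact ENNReal.mul_ne_top (summable_latt d).tsum_ofReal_ne_top ENNReal.coe_ne_top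
    · rw [lintegral_const_mul' _ _ ENNReal.ofReal_ne_top]
      gcongr
      simpa using hB l
  filter_upwards [ae_lt_top (Measurable.tsum hm) h1] with ω hω
  refine ⟨(∑' l, ENNReal.ofReal (((1 + ‖latt l‖) ^ (2 * d))⁻¹) * ‖Y l ω‖ₑ).toReal,
    ENNReal.toReal_nonneg, fun l => ?_⟩
  have h2 := ENNReal.le_tsum (f := fun l => ENNReal.ofReal (((1 + ‖latt l‖) ^ (2 * d))⁻¹) * ‖Y l ω‖ₑ) l
  have h3 := ENNReal.toReal_mono hω.ne h2
  simp only [ENNReal.toReal_mul, toReal_enorm, Real.norm_eq_abs] at h3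
  rw [ENNReal.toReal_ofReal (by positivity), inv_mul_le_iff₀ (by positivity), mul_comm] at h3
  exact h3

/-- The randomized distribution `∑ Y_l φ_l f` has almost surely a Fourier transform in the same
weighted `L²` space as `f`. -/
lemma IsRandomizer.exists_randomized_side {Y : (Fin d → ℤ) → Ω → ℝ} (hY : IsRandomizer Y μ)
    {s : ℝ} {f : 𝓢'(E d, ℂ)} {h : E d → ℂ} (hf : IsFourierSide s f h) (Φ : 𝓢(E d, ℂ)) :
    ∃ S : Ω × E d → ℂ, StronglyMeasurable S ∧ ∀ᵐ ω ∂μ, wnorm s (fun ξ => S (ω, ξ)) < ∞ ∧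
      ∀ Θ : 𝓢(E d, ℂ), HasSum (fun l : Fin d → ℤ => (Y l ω : ℂ) *
        f (SchwartzMap.smulLeftCLM ℂ (fun x => Φ (x - latt l)) (𝓕 Θ))) (∫ ξ, S (ω, ξ) * Θ ξ) := by
  set w : ℝ → E d → ℂ := fun t ξ => (((1 + ‖ξ‖ ^ 2) ^ (t / 2) : ℝ) : ℂ) with hw
  have hwm : ∀ t, StronglyMeasurable (w t) := fun t => Measurable.stronglyMeasurable (by fun_prop)
  have hw1 : ∀ ξ, w s ξ * w (-s) ξ = 1 := fun ξ => by
    simp only [hw]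
    rw [← Complex.ofReal_mul, ← Real.rpow_add (by positivity)]
    ring_nf; simp
  have hwe : ∀ t ξ, ‖w t ξ‖ₑ ^ 2 = ENNReal.ofReal ((1 + ‖ξ‖ ^ 2) ^ t) := fun t ξ => by
    simp only [hw]
    rw [← ofReal_norm, Complex.norm_real, Real.norm_of_nonneg (by positivity),
      ← ENNReal.ofReal_pow (by positivity), ← Real.rpow_mul_natCast (by positivity)]
    congr 2; push_cast; ring
  set b := lblock Φ h with hb
  have hbm : ∀ l, StronglyMeasurable (b l) := fun l => stronglyMeasurable_lblock Φ hf.meas l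
  -- The factor `w s` turns the weighted norm into the plain `L²` norm, so that the series lives in
  -- `L²(μ ⊗ volume)`; it is undone at the end by `w (-s)`.
  set Z : (Fin d → ℤ) → Ω × E d → ℂ := fun l p => (Y l p.1 : ℂ) * (w s p.2 * b l p.2) with hZ
  have hYm : ∀ l, Measurable fun ω => (Y l ω : ℂ) := fun l =>
    Complex.measurable_ofReal.comp (hY.measurable l)
  have hcm : ∀ l, StronglyMeasurable fun ξ => w s ξ * b l ξ := fun l => (hwm s).mul (hbm l)
  have hZm : ∀ l, StronglyMeasurable (Z l) := fun l =>
    ((hYm l).stronglyMeasurable.comp_measurable measurable_fst).mul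
      ((hcm l).comp_measurable measurable_snd)
  have hcw : ∀ l, ∫⁻ ξ, ‖w s ξ * b l ξ‖ₑ ^ 2 = wnorm s (b l) := fun l => by
    refine lintegral_congr fun ξ => ?_
    rw [enorm_mul, mul_pow, hwe]
  obtain ⟨B, hB⟩ := hY.exists_lintegral_pow_le 2
  have hZsum : ∑' l, ∫⁻ p, ‖Z l p‖ₑ ^ 2 ∂(μ.prod volume) < ∞ := by
    have h1 : ∀ l, ∫⁻ p, ‖Z l p‖ₑ ^ 2 ∂(μ.prod volume) ≤ B * wnorm s (b l) := by
      intro l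
      simp_rw [hZ, enorm_mul (Complex.ofReal _), mul_pow]
      rw [lintegral_prod_mul (f := fun ω => ‖(Y l ω : ℂ)‖ₑ ^ 2) (g := fun ξ => ‖w s ξ * b l ξ‖ₑ ^ 2)
        ((hYm l).enorm.pow_const 2).aemeasurable ((hcm l).measurable.enorm.pow_const 2).aemeasurable,
        hcw]
      gcongr
      refine le_trans (le_of_eq (lintegral_congr fun ω => ?_)) (hB l)
      rw [← ofReal_norm, Complex.norm_real, ofReal_norm]
    refine (ENNReal.tsum_le_tsum h1).trans_lt ?_
    rw [ENNReal.tsum_mul_left]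
    exact ENNReal.mul_lt_top ENNReal.coe_lt_top (tsum_wnorm_lblock_lt_top s Φ hf.meas hf.finite)
  have hZorth : ∀ i j, i ≠ j → ∫ p, Z j p * (starRingEnd ℂ) (Z i p) ∂(μ.prod volume) = 0 := by
    intro i j hij
    have h1 : ∀ p : Ω × E d, Z j p * (starRingEnd ℂ) (Z i p) = ((Y i p.1 * Y j p.1 : ℝ) : ℂ) *
        ((w s p.2 * b j p.2) * (starRingEnd ℂ) (w s p.2 * b i p.2)) := fun p => by
      simp only [hZ, map_mul, Complex.conj_ofReal, Complex.ofReal_mul]; ring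
    simp_rw [h1]
    rw [integral_prod_mul (fun ω => ((Y i ω * Y j ω : ℝ) : ℂ))
      (fun ξ => (w s ξ * b j ξ) * (starRingEnd ℂ) (w s ξ * b i ξ)), integral_complex_ofReal,
      (hY.indep.indepFun hij).integral_fun_mul_eq_mul_integral
        (hY.measurable i).aestronglyMeasurable (hY.measurable j).aestronglyMeasurable,
      hY.mean_zero i]
    simp
  obtain ⟨S₀, u, hS₀m, hu, hae⟩ := exists_ae_limit_of_orthogonal hZm hZsum hZorth
  refine ⟨fun p => w (-s) p.2 * S₀ p, ((hwm (-s)).comp_measurable measurable_snd).mul hS₀m, ?_⟩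
  filter_upwards [hae, hY.ae_growth] with ω ⟨hfin, hlim⟩ ⟨C, hC0, hC⟩
  have hSω : StronglyMeasurable fun ξ => S₀ (ω, ξ) := hS₀m.comp_measurable measurable_prodMk_left
  refine ⟨?_, fun Θ => ?_⟩
  · refine lt_of_eq_of_lt (lintegral_congr fun ξ => ?_) hfin
    rw [enorm_mul, mul_pow, ← hwe, ← mul_assoc, ← mul_pow, ← enorm_mul, hw1]
    simp
  -- The `L²` limit exists only along the finite sets `u n`, while `HasSum` is unconditional.
  -- Polynomial growth of `Y_l` against rapid decay of the pairings gives absolute convergence, and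
  -- then the two limits must coincide. The exceptional set does not depend on `Θ`.
  have hsummable : Summable fun l : Fin d → ℤ => (Y l ω : ℂ) *
      f (SchwartzMap.smulLeftCLM ℂ (fun x => Φ (x - latt l)) (𝓕 Θ)) := by
    obtain ⟨C', hC'0, hC'⟩ := exists_translate_decay f Φ (𝓕 Θ) (2 * d + 2 * d)
    refine Summable.of_norm_bounded ((summable_latt d).mul_left (C * C')) fun l => ?_
    rw [norm_mul, Complex.norm_real, Real.norm_eq_abs]
    calc _ ≤ (C * (1 + ‖latt l‖) ^ (2 * d)) * (C' * ((1 + ‖latt l‖) ^ (2 * d + 2 * d))⁻¹) := by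
          gcongr
          · exact hC l
          · exact hC' l
      _ = _ := by
          have : (1 + ‖latt l‖) ≠ 0 := by positivity
          rw [pow_add]; field_simp
  set Θ' : 𝓢(E d, ℂ) := SchwartzMap.smulLeftCLM ℂ (w (-s)) Θ with hΘ'
  have hΘa : ∀ ξ, Θ' ξ = w (-s) ξ * Θ ξ := fun ξ => by
    rw [hΘ', SchwartzMap.smulLeftCLM_apply_apply (by simp only [hw]; fun_prop), smul_eq_mul]
  have hΘL : MemLp Θ' 2 (volume : Measure (E d)) := Θ'.memLp 2 volume
  have hΘfin : ∫⁻ ξ, ‖Θ' ξ‖ₑ ^ 2 < ∞ := by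
    have := hΘL.2
    rw [eLpNorm_lt_top_iff_lintegral_rpow_enorm_lt_top (by norm_num) (by norm_num)] at this
    simpa using this
  have hcL : ∀ l, MemLp (fun ξ => w s ξ * b l ξ) 2 := fun l =>
    memLp_two_of_lintegral (hcm l).aestronglyMeasurable (by
      rw [hcw]
      exact (ENNReal.le_tsum l).trans_lt (tsum_wnorm_lblock_lt_top s Φ hf.meas hf.finite))
  have hSL : MemLp (fun ξ => S₀ (ω, ξ)) 2 := memLp_two_of_lintegral hSω.aestronglyMeasurable hfin
  have hterm : ∀ l, (Y l ω : ℂ) * f (SchwartzMap.smulLeftCLM ℂ (fun x => Φ (x - latt l)) (𝓕 Θ)) =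
      ∫ ξ, Z l (ω, ξ) * Θ' ξ := by
    intro l
    rw [hf.apply_mul_fourier, ← integral_const_mul]
    refine integral_congr_ae (Filter.Eventually.of_forall fun ξ => ?_)
    simp only [hZ, hΘa]
    linear_combination (-(Y l ω : ℂ) * b l ξ * Θ ξ) * hw1 ξ
  have h_int : ∀ l, Integrable fun ξ => Z l (ω, ξ) * Θ' ξ := fun l =>
    ((hcL l).const_mul (Y l ω : ℂ)).integrable_mul hΘL
  have hintS : Integrable fun ξ => S₀ (ω, ξ) * Θ' ξ := hSL.integrable_mul hΘL
  have hkey : Filter.Tendsto (fun n => ∑ l ∈ u n, (Y l ω : ℂ) *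
      f (SchwartzMap.smulLeftCLM ℂ (fun x => Φ (x - latt l)) (𝓕 Θ))) Filter.atTop
      (nhds (∫ ξ, S₀ (ω, ξ) * Θ' ξ)) := by
    rw [tendsto_iff_edist_tendsto_0]
    have h1 : ∀ n, edist (∑ l ∈ u n, (Y l ω : ℂ) *
        f (SchwartzMap.smulLeftCLM ℂ (fun x => Φ (x - latt l)) (𝓕 Θ))) (∫ ξ, S₀ (ω, ξ) * Θ' ξ) ^ 2 ≤
        (∫⁻ ξ, ‖∑ l ∈ u n, Z l (ω, ξ) - S₀ (ω, ξ)‖ₑ ^ 2) * ∫⁻ ξ, ‖Θ' ξ‖ₑ ^ 2 := by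
      intro n
      simp_rw [hterm]
      rw [edist_eq_enorm_sub, ← integral_finsetSum _ fun l _ => h_int l, ← integral_sub
        (integrable_finsetSum _ fun l _ => h_int l) hintS]
      refine le_trans (le_of_eq ?_) (enorm_integral_mul_sq_le
        (F := fun ξ => ∑ l ∈ u n, Z l (ω, ξ) - S₀ (ω, ξ)) ?_ Θ'.continuous.aemeasurable)
      · congr 3; ext ξ; rw [sub_mul, Finset.sum_mul]
      · refine AEMeasurable.sub (Finset.aemeasurable_fun_sum _ fun l _ => ?_) hSω.measurable.aemeasurable
        exact ((hZm l).comp_measurable measurable_prodMk_left).measurable.aemeasurable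
    have h2 : Filter.Tendsto (fun n => (∫⁻ ξ, ‖∑ l ∈ u n, Z l (ω, ξ) - S₀ (ω, ξ)‖ₑ ^ 2) *
        ∫⁻ ξ, ‖Θ' ξ‖ₑ ^ 2) Filter.atTop (nhds 0) := by
      have := ENNReal.Tendsto.mul_const hlim (Or.inr hΘfin.ne)
      simpa using this
    have h3 := tendsto_of_tendsto_of_tendsto_of_le_of_le tendsto_const_nhds h2
      (fun n => zero_le) h1
    have h4 := ((ENNReal.continuous_rpow_const (y := (1 / 2 : ℝ))).tendsto 0).comp h3
    simp only [Function.comp_def] at h4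
    rw [ENNReal.zero_rpow_of_pos (by norm_num)] at h4
    refine h4.congr fun n => ?_
    rw [← ENNReal.rpow_natCast, ← ENNReal.rpow_mul]; norm_num
  have hlimit : ∫ ξ, w (-s) ξ * S₀ (ω, ξ) * Θ ξ = ∫ ξ, S₀ (ω, ξ) * Θ' ξ := by
    refine integral_congr_ae (Filter.Eventually.of_forall fun ξ => ?_)
    simp only [hΘa]; ring
  rw [hlimit, ← tendsto_nhds_unique (hsummable.hasSum.comp hu) hkey]
  exact hsummable.hasSum

end Randomization

/-! ### The kernel of the half-wave propagator on a unit frequency cube -/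

/-- Derivatives of a slice are full derivatives composed with the inclusion of `V` into `P × V`,
which has norm at most one; the full derivatives are continuous, hence bounded on the compact set `S
× B`. -/
theorem exists_norm_iteratedFDeriv_slice_le {P V F : Type*} [NormedAddCommGroup P]
    [NormedSpace ℝ P] [NormedAddCommGroup V] [NormedSpace ℝ V] [NormedAddCommGroup F]
    [NormedSpace ℝ F] {Ψ : P × V → F} {U : Set (P × V)} (hU : IsOpen U)
    (hΨ : ContDiffOn ℝ ((⊤ : ℕ∞) : WithTop ℕ∞) Ψ U) {S : Set P} (hS : IsCompact S) {B : Set V}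
    (hB : IsCompact B) (hSU : S ×ˢ Set.univ ⊆ U) (n : ℕ) :
    ∃ C : ℝ, ∀ p ∈ S, ∀ η ∈ B, ‖iteratedFDeriv ℝ n (fun η => Ψ (p, η)) η‖ ≤ C := by
  have hcont : ContinuousOn (iteratedFDerivWithin ℝ n Ψ U) (S ×ˢ B) :=
    (hΨ.continuousOn_iteratedFDerivWithin (by exact_mod_cast le_top) hU.uniqueDiffOn).mono
      ((Set.prod_mono_right (Set.subset_univ B)).trans hSU)
  obtain ⟨C, hC⟩ := (hS.prod hB).exists_bound_of_continuousOn hcont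
  refine ⟨C, fun p hp η hη => ?_⟩
  have hmem : ∀ η : V, (p, η) ∈ U := fun η => hSU ⟨hp, Set.mem_univ _⟩
  set f : P × V → F := fun q => Ψ ((p, 0) + q) with hf
  set s : Set (P × V) := (fun q => (p, 0) + q) ⁻¹' U with hs
  have hso : IsOpen s := hU.preimage (by fun_prop)
  have hfs : ContDiffOn ℝ ((⊤ : ℕ∞) : WithTop ℕ∞) f s :=
    hΨ.comp (by fun_prop) fun q hq => hq
  have hpre : (ContinuousLinearMap.inr ℝ P V) ⁻¹' s = Set.univ := by
    ext η; simpa [hs] using hmem η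
  have key := (ContinuousLinearMap.inr ℝ P V).iteratedFDerivWithin_comp_right hfs
    hso.uniqueDiffOn (by rw [hpre]; exact uniqueDiffOn_univ) (x := η)
    (by have := hmem η; simpa [hs] using this) (i := n) (by exact_mod_cast le_top)
  have hcomp : f ∘ (ContinuousLinearMap.inr ℝ P V) = fun η => Ψ (p, η) := by
    ext η; simp [hf]
  rw [hpre, iteratedFDerivWithin_univ, hcomp] at key
  rw [key]
  refine (ContinuousMultilinearMap.norm_compContinuousLinearMap_le _ _).trans ?_
  have h1 : ∏ _i : Fin n, ‖ContinuousLinearMap.inr ℝ P V‖ ≤ 1 :=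
    Finset.prod_le_one (fun _ _ => norm_nonneg _) fun _ _ =>
      ContinuousLinearMap.norm_inr_le_one ℝ P V
  refine (mul_le_of_le_one_right (norm_nonneg _) h1).trans ?_
  rw [iteratedFDerivWithin_of_isOpen n hso
    (by have := hmem η; simpa [hs] using this), hf, iteratedFDeriv_comp_add_left]
  rw [← iteratedFDerivWithin_of_isOpen n hU (by have := hmem η; simpa using this)]
  simpa using hC (p, η) ⟨hp, hη⟩

/-- Powers of `w` become derivatives in `η`. Their `L¹` norms are bounded uniformly over `S`, since
all slices vanish outside a common ball. -/
theorem exists_fourier_decay_of_compact_family {P : Type*} [NormedAddCommGroup P]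
    [NormedSpace ℝ P] {Ψ : P × E d → ℂ} {U : Set (P × E d)} (hU : IsOpen U)
    (hΨ : ContDiffOn ℝ ((⊤ : ℕ∞) : WithTop ℕ∞) Ψ U) {S : Set P} (hS : IsCompact S) {r : ℝ}
    (hSU : S ×ˢ Set.univ ⊆ U) (hr : ∀ p, ∀ η : E d, r < ‖η‖ → Ψ (p, η) = 0) (M : ℕ) :
    ∃ C : ℝ, 0 ≤ C ∧ ∀ p ∈ S, ∀ w : E d,
      (1 + ‖w‖) ^ M * ‖𝓕 (fun η => Ψ (p, η)) w‖ ≤ C := by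
  have hB := isCompact_closedBall (0 : E d) (r + 1)
  choose D hD using exists_norm_iteratedFDeriv_slice_le hU hΨ hS hB hSU
  set vol : ℝ := volume.real (Metric.closedBall (0 : E d) (r + 1))
  have hsm : ∀ p ∈ S, ContDiff ℝ ((⊤ : ℕ∞) : WithTop ℕ∞) fun η => Ψ (p, η) := by
    intro p hp
    rw [← contDiffOn_univ]
    exact hΨ.comp (by fun_prop) fun η _ => hSU ⟨hp, Set.mem_univ _⟩
  have hz : ∀ p, ∀ n : ℕ, ∀ η ∉ Metric.closedBall (0 : E d) (r + 1),
      iteratedFDeriv ℝ n (fun η => Ψ (p, η)) η = 0 := by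
    intro p n η hη
    have hev : (fun η => Ψ (p, η)) =ᶠ[nhds η] fun _ => 0 := by
      have : {η : E d | r < ‖η‖} ∈ nhds η := by
        refine (isOpen_lt continuous_const continuous_norm).mem_nhds ?_
        simp only [Metric.mem_closedBall, dist_zero_right, not_le] at hη
        simp only [Set.mem_ofPred_eq]; linarith
      filter_upwards [this] with y hy using hr p y hy
    rw [(hev.iteratedFDeriv ℝ n).eq_of_nhds]
    simp
  have h_int : ∀ p ∈ S, ∀ k n : ℕ,
      Integrable fun v : E d => ‖v‖ ^ k * ‖iteratedFDeriv ℝ n (fun η => Ψ (p, η)) v‖ := by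
    intro p hp k n
    refine Continuous.integrable_of_hasCompactSupport ?_ ?_
    · have := (hsm p hp).continuous_iteratedFDeriv (m := n) (by exact_mod_cast le_top)
      fun_prop
    · refine HasCompactSupport.intro hB fun x hx => ?_
      rw [hz p n x hx]; simp
  have hle : ∀ p ∈ S, ∀ n : ℕ, ∫ v : E d, ‖iteratedFDeriv ℝ n (fun η => Ψ (p, η)) v‖ ≤
      D n * vol := by
    intro p hp n
    rw [← setIntegral_eq_integral_of_forall_compl_eq_zero
      (s := Metric.closedBall (0 : E d) (r + 1)) (fun x hx => by rw [hz p n x hx]; simp)]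
    refine (le_abs_self _).trans ?_
    rw [← Real.norm_eq_abs]
    refine norm_setIntegral_le_of_norm_le_const hB.measure_lt_top fun x hx => ?_
    rw [norm_norm]
    exact hD n p hp x hx
  have hD0 : ∀ n, ∀ p ∈ S, 0 ≤ D n * vol := fun n p hp =>
    le_trans (integral_nonneg fun _ => norm_nonneg _) (hle p hp n)
  refine ⟨∑ j ∈ Finset.range (M + 1), (M.choose j : ℝ) *
    (2 ^ j * |∑ i ∈ Finset.range (j + 1), D i * vol|), by positivity, fun p hp w => ?_⟩
  rw [add_comm 1, add_pow, Finset.sum_mul]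
  refine Finset.sum_le_sum fun j _ => ?_
  have := Real.pow_mul_norm_iteratedFDeriv_fourier_le (K := ⊤) (N := ⊤) (hsm p hp)
    (fun k n _ _ => h_int p hp k n) (k := 0) (n := j) le_top le_top w
  rw [norm_iteratedFDeriv_zero] at this
  simp only [one_pow, mul_one]
  have h2 : ‖w‖ ^ j * ‖𝓕 (fun η => Ψ (p, η)) w‖ ≤
      2 ^ j * |∑ i ∈ Finset.range (j + 1), D i * vol| := by
    refine this.trans ?_
    simp only [pow_zero, one_mul, CharP.cast_eq_zero, mul_zero, zero_add]
    gcongr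
    refine le_trans ?_ (le_abs_self _)
    rw [Finset.range_one, Finset.sum_product]
    simp only [Finset.sum_singleton, pow_zero, one_mul]
    exact Finset.sum_le_sum fun i _ => hle p hp i
  calc ‖w‖ ^ j * (M.choose j : ℝ) * ‖𝓕 (fun η => Ψ (p, η)) w‖
      = (M.choose j : ℝ) * (‖w‖ ^ j * ‖𝓕 (fun η => Ψ (p, η)) w‖) := by ring
    _ ≤ _ := by gcongr

/-- The group velocity `∇⟨ξ⟩` at the lattice point `k`. -/
def vel (k : Fin d → ℤ) : E d := (jb (latt k))⁻¹ • latt k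

/-- The rescaled second order remainder of the phase `τ⟨·⟩` in its Taylor expansion. -/
def wavePhase (q : (ℝ × ℝ × E d) × E d) : ℝ :=
  q.1.1 * (‖q.2‖ ^ 2 / (√(q.1.2.1 ^ 2 + ‖q.1.2.2 + q.1.2.1 • q.2‖ ^ 2) +
      √(q.1.2.1 ^ 2 + ‖q.1.2.2‖ ^ 2)) -
    inner ℝ q.1.2.2 q.2 * (2 * inner ℝ q.1.2.2 q.2 + q.1.2.1 * ‖q.2‖ ^ 2) /
      (√(q.1.2.1 ^ 2 + ‖q.1.2.2‖ ^ 2) *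
        (√(q.1.2.1 ^ 2 + ‖q.1.2.2 + q.1.2.1 • q.2‖ ^ 2) +
          √(q.1.2.1 ^ 2 + ‖q.1.2.2‖ ^ 2)) ^ 2))

theorem jb_pos (ξ : E d) : 0 < jb ξ := Real.sqrt_pos.2 (by positivity)

theorem jb_sq (ξ : E d) : jb ξ ^ 2 = 1 + ‖ξ‖ ^ 2 := Real.sq_sqrt (by positivity)

theorem contDiff_jb : ContDiff ℝ ((⊤ : ℕ∞) : WithTop ℕ∞) (jb : E d → ℝ) := by
  unfold jb
  exact (contDiff_const.add (contDiff_norm_sq ℝ)).sqrt fun x => by positivity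

@[fun_prop]
theorem continuous_jb : Continuous (jb : E d → ℝ) := contDiff_jb.continuous

/-- Rationalizing the difference of square roots twice removes every division by `1/N`. The
resulting expression in `(τ/N, 1/N, k/N)` therefore still makes sense at `1/N = 0`, the limit of
high frequency. -/
theorem wavePhase_rescaled {n : ℝ} (hn : 0 < n) (τ : ℝ) (k : Fin d → ℤ) (η : E d) :
    wavePhase ((τ / n, n⁻¹, n⁻¹ • latt k), η) =
      τ * (jb (latt k + η) - jb (latt k) - inner ℝ (vel k) η) := by
  have hR : √((n⁻¹) ^ 2 + ‖n⁻¹ • latt k‖ ^ 2) = jb (latt k) / n := by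
    rw [Real.sqrt_eq_iff_mul_self_eq (by positivity) (div_nonneg (jb_pos _).le hn.le),
      ← sq, div_pow, jb_sq, norm_smul, Real.norm_eq_abs, abs_of_pos (inv_pos.2 hn)]
    field_simp
  have hR1 : √((n⁻¹) ^ 2 + ‖n⁻¹ • latt k + n⁻¹ • η‖ ^ 2) = jb (latt k + η) / n := by
    rw [Real.sqrt_eq_iff_mul_self_eq (by positivity) (div_nonneg (jb_pos _).le hn.le),
      ← sq, div_pow, jb_sq, ← smul_add, norm_smul, Real.norm_eq_abs, abs_of_pos (inv_pos.2 hn)]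
    field_simp
  simp only [wavePhase, hR, hR1, vel, real_inner_smul_left]
  have hA := jb_pos (latt k)
  have hB := jb_pos (latt k + η)
  have he : ‖η‖ ^ 2 = jb (latt k + η) ^ 2 - jb (latt k) ^ 2 - 2 * inner ℝ (latt k) η := by
    rw [jb_sq, jb_sq, norm_add_sq_real]; ring
  rw [he]
  have hAB : jb (latt k + η) + jb (latt k) ≠ 0 := by positivity
  field_simp
  ring

theorem norm_le_card_mul {x : E d} {c : ℝ} (hc : 0 ≤ c) (hx : ∀ i, |x i| ≤ c) : ‖x‖ ≤ d * c := by
  rw [EuclideanSpace.norm_eq]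
  refine Real.sqrt_le_iff.2 ⟨by positivity, ?_⟩
  calc ∑ i, ‖x i‖ ^ 2 ≤ ∑ _i : Fin d, c ^ 2 :=
        Finset.sum_le_sum fun i _ => by
          rw [Real.norm_eq_abs]; exact pow_le_pow_left₀ (abs_nonneg _) (hx i) 2
    _ = d * c ^ 2 := by simp
    _ ≤ (d * c) ^ 2 := by
        rw [mul_pow]
        gcongr
        exact_mod_cast Nat.le_self_pow two_ne_zero d

theorem abs_coord_le_norm (x : E d) (i : Fin d) : |x i| ≤ ‖x‖ := by
  simpa using PiLp.norm_apply_le x i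

theorem mem_shell {N : ℕ} {k : Fin d → ℤ} :
    k ∈ shell d N ↔ (∀ i, |k i| ≤ 2 * N) ∧ (N = 1 ∨ ∃ i, (N : ℤ) < |k i|) := by
  classical
  simp only [shell, Finset.mem_filter, Finset.mem_Icc, Pi.le_def, abs_le, forall_and]

theorem norm_latt_le_of_mem_shell {N : ℕ} {k : Fin d → ℤ} (hk : k ∈ shell d N) :
    ‖latt k‖ ≤ d * (2 * N) :=
  norm_le_card_mul (by positivity) fun i => by
    have := (mem_shell.1 hk).1 i
    simp only [latt]
    exact_mod_cast this

theorem le_norm_latt_of_mem_shell {N : ℕ} (hN : N ≠ 1) {k : Fin d → ℤ} (hk : k ∈ shell d N) :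
    N + 1 ≤ ‖latt k‖ := by
  obtain ⟨i, hi⟩ := (mem_shell.1 hk).2.resolve_left hN
  refine le_trans ?_ (abs_coord_le_norm (latt k) i)
  simp only [latt]
  exact_mod_cast hi

/-- The set of rescaled parameters `(τ / N, 1 / N, k / N)`. -/
def phaseParams (d : ℕ) : Set (ℝ × ℝ × E d) :=
  (Set.Icc (-1) 1 ×ˢ (Set.Icc 0 1 ×ˢ Metric.closedBall 0 (2 * d))) ∩
    {p | 1 ≤ p.2.1 ^ 2 + ‖p.2.2‖ ^ 2}

theorem isCompact_phaseParams : IsCompact (phaseParams d) :=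
  (isCompact_Icc.prod (isCompact_Icc.prod (isCompact_closedBall _ _))).inter_right
    (isClosed_le (by fun_prop) (by fun_prop))

/-- The lower bound by one, which keeps the square roots in `wavePhase` away from zero, comes from
`1/N = 1` when `N = 1` and from `|k|_∞ > N` otherwise. -/
theorem rescaled_mem_phaseParams {N : ℕ} (hN : 1 ≤ N) {k : Fin d → ℤ} (hk : k ∈ shell d N)
    {τ : ℝ} (hτ : |τ| ≤ N) :
    (τ / (N : ℝ), (N : ℝ)⁻¹, (N : ℝ)⁻¹ • latt k) ∈ phaseParams d := by
  have hN1 : (1 : ℝ) ≤ N := by exact_mod_cast hN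
  have hN0 : (0 : ℝ) < N := by linarith
  have hnorm : ‖(N : ℝ)⁻¹ • latt k‖ = ‖latt k‖ / N := by
    rw [norm_smul, Real.norm_eq_abs, abs_of_pos (inv_pos.2 hN0)]; field_simp
  refine ⟨⟨?_, ⟨by positivity, inv_le_one_of_one_le₀ hN1⟩, ?_⟩, ?_⟩
  · rw [Set.mem_Icc, ← abs_le, abs_div, abs_of_pos hN0]
    exact (div_le_one hN0).2 hτ
  · rw [mem_closedBall_zero_iff, hnorm, div_le_iff₀ hN0]
    have := norm_latt_le_of_mem_shell hk
    linarith
  · change 1 ≤ ((N : ℝ)⁻¹) ^ 2 + ‖(N : ℝ)⁻¹ • latt k‖ ^ 2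
    rcases eq_or_ne N 1 with h | h
    · subst h; simp
    · rw [hnorm]
      have h1 : 1 ≤ ‖latt k‖ / N := by
        rw [le_div_iff₀ hN0]
        linarith [le_norm_latt_of_mem_shell h hk]
      nlinarith [sq_nonneg ((N : ℝ)⁻¹)]

/-- The parameter set is compact and the phase is smooth near all of its slices: if the second
parameter `h` vanishes, the shift `h • η` disappears from the square root, and if not, `h²` alone
keeps it positive. Compactness is the source of uniformity in `N`, `k` and `τ`. -/
theorem exists_wavePhase_fourier_decay {χ : E d → ℝ}
    (hχ : ContDiff ℝ ((⊤ : ℕ∞) : WithTop ℕ∞) χ) {r : ℝ} (hr : ∀ η, r < ‖η‖ → χ η = 0) (M : ℕ) :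
    ∃ C : ℝ, 0 ≤ C ∧ ∀ p ∈ phaseParams d, ∀ w : E d, (1 + ‖w‖) ^ M *
      ‖𝓕 (fun η => Complex.exp (wavePhase (p, η) * Complex.I) * (χ η : ℂ)) w‖ ≤ C := by
  set U : Set ((ℝ × ℝ × E d) × E d) := {q | 0 < q.1.2.1 ^ 2 + ‖q.1.2.2‖ ^ 2} ∩
    {q | 0 < q.1.2.1 ^ 2 + ‖q.1.2.2 + q.1.2.1 • q.2‖ ^ 2} with hUdef
  have hU : IsOpen U := (isOpen_lt (by fun_prop) (by fun_prop)).inter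
    (isOpen_lt (by fun_prop) (by fun_prop))
  refine exists_fourier_decay_of_compact_family (U := U)
    (Ψ := fun q => Complex.exp (wavePhase q * Complex.I) * (χ q.2 : ℂ))
    hU ?_ isCompact_phaseParams (r := r) ?_ ?_ M
  · have hph : ContDiffOn ℝ ((⊤ : ℕ∞) : WithTop ℕ∞) (wavePhase (d := d)) U := by
      intro q hq
      refine ContDiffAt.contDiffWithinAt ?_
      have h1 : (0 : ℝ) < q.1.2.1 ^ 2 + ‖q.1.2.2‖ ^ 2 := hq.1
      have h2 : (0 : ℝ) < q.1.2.1 ^ 2 + ‖q.1.2.2 + q.1.2.1 • q.2‖ ^ 2 := hq.2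
      have hR : ContDiffAt ℝ ((⊤ : ℕ∞) : WithTop ℕ∞) (fun q : (ℝ × ℝ × E d) × E d =>
          √(q.1.2.1 ^ 2 + ‖q.1.2.2‖ ^ 2)) q :=
        ContDiffAt.sqrt (ContDiffAt.add (by fun_prop)
          (ContDiffAt.norm_sq ℝ (by fun_prop))) h1.ne'
      have hR1 : ContDiffAt ℝ ((⊤ : ℕ∞) : WithTop ℕ∞) (fun q : (ℝ × ℝ × E d) × E d =>
          √(q.1.2.1 ^ 2 + ‖q.1.2.2 + q.1.2.1 • q.2‖ ^ 2)) q :=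
        ContDiffAt.sqrt (ContDiffAt.add (by fun_prop)
          (ContDiffAt.norm_sq ℝ (by fun_prop))) h2.ne'
      have hn : ContDiffAt ℝ ((⊤ : ℕ∞) : WithTop ℕ∞) (fun q : (ℝ × ℝ × E d) × E d =>
          ‖q.2‖ ^ 2) q := ContDiffAt.norm_sq ℝ (by fun_prop)
      have hi : ContDiffAt ℝ ((⊤ : ℕ∞) : WithTop ℕ∞) (fun q : (ℝ × ℝ × E d) × E d =>
          inner ℝ q.1.2.2 q.2) q := ContDiffAt.inner ℝ (by fun_prop) (by fun_prop)
      have hRp := Real.sqrt_pos.2 h1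
      have hR1p := Real.sqrt_pos.2 h2
      unfold wavePhase
      refine ContDiffAt.mul (by fun_prop) (ContDiffAt.sub (hn.div (hR1.add hR) ?_)
        (ContDiffAt.div (hi.mul ((contDiffAt_const.mul hi).add (ContDiffAt.mul (by fun_prop) hn)))
          (hR.mul ((hR1.add hR).pow 2)) ?_))
      · positivity
      · positivity
    have hc : ContDiffOn ℝ ((⊤ : ℕ∞) : WithTop ℕ∞) (fun q => ((wavePhase (d := d) q : ℝ) : ℂ)) U :=
      Complex.ofRealCLM.contDiff.comp_contDiffOn hph
    refine ContDiffOn.mul (ContDiffOn.cexp (hc.mul contDiffOn_const)) ?_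
    exact (Complex.ofRealCLM.contDiff.comp (hχ.comp contDiff_snd)).contDiffOn
  · rintro ⟨p, η⟩ ⟨hp, -⟩
    have h1 : 1 ≤ p.2.1 ^ 2 + ‖p.2.2‖ ^ 2 := hp.2
    refine ⟨?_, ?_⟩
    · change 0 < p.2.1 ^ 2 + ‖p.2.2‖ ^ 2
      linarith
    · change 0 < p.2.1 ^ 2 + ‖p.2.2 + p.2.1 • η‖ ^ 2
      rcases eq_or_ne p.2.1 0 with h | h
      · simp only [h, zero_smul, add_zero] at h1 ⊢; linarith
      · positivity
  · intro p η hη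
    simp [hr η hη]

/-- Near `k` the phase `τ⟨ξ⟩` consists of an affine part, which translates by `-τ • vel k` up to a
constant phase, and a second order remainder. For `|τ| ≤ N` this remainder is bounded with all its
derivatives. The propagator cut off around `k` thus has a bump at `-τ • vel k` as its kernel, with
no dispersion. -/
theorem exists_kernel (d M : ℕ) : ∃ C : ℝ, 0 ≤ C ∧ ∀ N : ℕ, 1 ≤ N → ∀ k ∈ shell d N,
    ∀ τ : ℝ, |τ| ≤ N → ∃ κ : 𝓢(E d, ℂ),
      (∀ z, ‖κ z‖ ≤ C * ((1 + ‖z + τ • vel k‖) ^ M)⁻¹) ∧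
      ∀ G : E d → ℂ, Integrable G →
        (∀ ξ, (∃ i, 1 < |((2 * Real.pi) • ξ - latt k) i|) → G ξ = 0) → ∀ x,
        ∫ ξ, G ξ * (Complex.exp (τ * jb ((2 * Real.pi) • ξ) * Complex.I) * ech x ξ) =
          ∫ y, κ (x - y) * ∫ ξ, G ξ * ech y ξ := by
  -- The cube `|·|_∞ ≤ 1` carrying the packet lies in the ball of radius `d`, where this bump equals
  -- one.
  set χ : ContDiffBump (0 : E d) := ⟨d + 1, d + 2, by positivity, by linarith⟩ with hχdef
  have hχs : ContDiff ℝ ((⊤ : ℕ∞) : WithTop ℕ∞) (χ : E d → ℝ) := χ.contDiff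
  have hχ0 : ∀ η : E d, (d + 2 : ℝ) < ‖η‖ → χ η = 0 := fun η hη =>
    χ.zero_of_le_dist (by rw [dist_zero_right]; exact hη.le)
  have hχ1 : ∀ η : E d, ‖η‖ ≤ d + 1 → χ η = 1 := fun η hη =>
    χ.one_of_mem_closedBall (by rw [mem_closedBall_zero_iff]; exact hη)
  obtain ⟨C, hC0, hC⟩ := exists_wavePhase_fourier_decay hχs hχ0 M
  have h2pi : (0 : ℝ) < 2 * Real.pi := by positivity
  refine ⟨(2 * Real.pi) ^ M * C, by positivity, fun N hN k hk τ hτ => ?_⟩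
  have hp := rescaled_mem_phaseParams hN hk hτ
  have hN0 : (0 : ℝ) < N := by exact_mod_cast hN
  set m : E d → ℂ := fun ξ => Complex.exp (τ * jb ((2 * Real.pi) • ξ) * Complex.I) *
    (χ ((2 * Real.pi) • ξ - latt k) : ℂ) with hm
  have hms : ContDiff ℝ ((⊤ : ℕ∞) : WithTop ℕ∞) m := by
    refine ContDiff.mul (ContDiff.cexp ((contDiff_const.mul ?_).mul contDiff_const)) ?_
    · exact Complex.ofRealCLM.contDiff.comp (contDiff_jb.comp (by fun_prop))
    · exact Complex.ofRealCLM.contDiff.comp (hχs.comp (by fun_prop))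
  have hmc : HasCompactSupport m := by
    refine HasCompactSupport.intro
      (isCompact_closedBall (0 : E d) ((d + 2 + ‖latt k‖) / (2 * Real.pi))) fun ξ hξ => ?_
    rw [mem_closedBall_zero_iff, not_le, div_lt_iff₀ h2pi] at hξ
    have h1 : (d + 2 : ℝ) < ‖(2 * Real.pi) • ξ - latt k‖ := by
      have := norm_sub_norm_le ((2 * Real.pi) • ξ) (latt k)
      rw [norm_smul, Real.norm_eq_abs, abs_of_pos h2pi] at this
      linarith
    simp [hm, hχ0 _ h1]
  set mS : 𝓢(E d, ℂ) := hmc.toSchwartzMap hms with hmS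
  have hmSa : ∀ ξ, mS ξ = m ξ := fun ξ => rfl
  refine ⟨𝓕⁻ mS, fun z => ?_, fun G hG hGs x => ?_⟩
  · set Ψ : E d → ℂ := fun η => Complex.exp
      (wavePhase ((τ / (N : ℝ), (N : ℝ)⁻¹, (N : ℝ)⁻¹ • latt k), η) * Complex.I) * (χ η : ℂ)
      with hΨ
    set w : E d := -((2 * Real.pi)⁻¹ • (z + τ • vel k)) with hw
    have hval : ‖(𝓕⁻ mS : 𝓢(E d, ℂ)) z‖ = ((2 * Real.pi) ^ d)⁻¹ * ‖𝓕 Ψ w‖ := by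
      rw [SchwartzMap.fourierInv_coe, fourierInv_eq_ech, fourier_eq_ech]
      set c : ℂ := Complex.exp ((τ * jb (latt k) + inner ℝ z (latt k) : ℝ) * Complex.I)
      have hpt : ∀ ξ, ech z ξ * mS ξ =
          (fun η => c * (ech w (-η) * Ψ η)) ((2 * Real.pi) • ξ - latt k) := by
        intro ξ
        set η := (2 * Real.pi) • ξ - latt k with hη
        have hξ : (2 * Real.pi) • ξ = latt k + η := by rw [hη]; abel
        have hξ' : ξ = (2 * Real.pi)⁻¹ • (latt k + η) := by
          rw [← hξ, smul_smul, inv_mul_cancel₀ h2pi.ne', one_smul]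
        rw [hmSa, hm]
        simp only [hΨ, hξ, wavePhase_rescaled hN0, ech]
        rw [add_sub_cancel_left, ← mul_assoc, ← mul_assoc, ← mul_assoc, ← Complex.exp_add,
          ← Complex.exp_add, ← Complex.exp_add]
        congr 2
        rw [hξ', hw]
        simp only [inner_neg_left, inner_neg_right, inner_add_left, inner_add_right,
          real_inner_smul_left, real_inner_smul_right]
        have hpi : (Real.pi : ℂ) ≠ 0 := by exact_mod_cast Real.pi_ne_zero
        push_cast
        field_simp
        ring
      simp_rw [hpt]
      have hsub := Measure.integral_comp_smul (volume : Measure (E d))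
        (fun ξ => (fun η => c * (ech w (-η) * Ψ η)) (ξ - latt k)) (2 * Real.pi)
      rw [hsub, integral_sub_right_eq_self (fun η => c * (ech w (-η) * Ψ η)), integral_const_mul,
        norm_smul, norm_mul, Complex.norm_exp_ofReal_mul_I, one_mul]
      simp [abs_of_pos h2pi, abs_of_pos Real.pi_pos]
    rw [hval]
    have hdec := hC _ hp w
    have h3 : (1 + ‖z + τ • vel k‖) ^ M ≤ (2 * Real.pi) ^ M * (1 + ‖w‖) ^ M := by
      rw [← mul_pow]
      refine pow_le_pow_left₀ (by positivity) ?_ M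
      have : ‖z + τ • vel k‖ = 2 * Real.pi * ‖w‖ := by
        rw [hw, norm_neg, norm_smul, Real.norm_eq_abs, abs_of_pos (inv_pos.2 h2pi)]
        field_simp
      rw [this]
      nlinarith [Real.pi_gt_three]
    have h4 : ((2 * Real.pi) ^ d)⁻¹ ≤ 1 :=
      inv_le_one_of_one_le₀ (one_le_pow₀ (by nlinarith [Real.pi_gt_three]))
    rw [← div_eq_mul_inv, le_div_iff₀ (by positivity)]
    calc ((2 * Real.pi) ^ d)⁻¹ * ‖𝓕 Ψ w‖ * (1 + ‖z + τ • vel k‖) ^ M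
        ≤ 1 * ‖𝓕 Ψ w‖ * ((2 * Real.pi) ^ M * (1 + ‖w‖) ^ M) := by gcongr
      _ = (2 * Real.pi) ^ M * ((1 + ‖w‖) ^ M * ‖𝓕 Ψ w‖) := by ring
      _ ≤ _ := by gcongr
  · have hGm : ∀ ξ, G ξ * (Complex.exp (τ * jb ((2 * Real.pi) • ξ) * Complex.I) * ech x ξ) =
        G ξ * (m ξ * ech x ξ) := by
      intro ξ
      by_cases h : ∃ i, 1 < |((2 * Real.pi) • ξ - latt k) i|
      · rw [hGs ξ h]; simp
      · push Not at h
        have := norm_le_card_mul zero_le_one h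
        rw [hm]
        simp only
        rw [hχ1 _ (by linarith)]
        simp
    simp_rw [hGm]
    set κ : 𝓢(E d, ℂ) := 𝓕⁻ mS with hκ
    have hκm : ∀ ξ, ∫ y, κ (x - y) * ech y ξ = m ξ * ech x ξ := by
      intro ξ
      have h1 : 𝓕 κ = mS := by rw [hκ, FourierTransform.fourier_fourierInv_eq]
      have h2 : (𝓕 κ : 𝓢(E d, ℂ)) ξ = ∫ z, ech ξ (-z) * κ z := by
        rw [SchwartzMap.fourier_coe, fourier_eq_ech]
      rw [← hmSa, ← h1, h2, ← integral_sub_left_eq_self _ _ x, mul_comm, ← integral_const_mul]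
      refine integral_congr_ae (.of_forall fun z => ?_)
      simp only
      rw [← mul_assoc, ech_comm x ξ, ← ech_add_right, mul_comm, sub_sub_cancel, ech_comm (x - z) ξ,
        sub_eq_add_neg]
    have h_int : Integrable (fun q : E d × E d => κ (x - q.1) * (G q.2 * ech q.1 q.2))
        (volume.prod volume) := by
      have h1 : Integrable (fun y => κ (x - y)) :=
        (κ.integrable (μ := volume)).comp_sub_left x
      refine (h1.mul_prod hG).mono ?_ (.of_forall fun q => by simp)
      exact (h1.aestronglyMeasurable.comp_fst).mul
        ((hG.aestronglyMeasurable.comp_snd).mul (by fun_prop))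
    calc ∫ ξ, G ξ * (m ξ * ech x ξ) = ∫ ξ, ∫ y, κ (x - y) * (G ξ * ech y ξ) := by
          refine integral_congr_ae (.of_forall fun ξ => ?_)
          simp only
          rw [← hκm, ← integral_const_mul]
          refine integral_congr_ae (.of_forall fun z => ?_)
          simp only; ring
      _ = ∫ y, ∫ ξ, κ (x - y) * (G ξ * ech y ξ) := (integral_integral_swap h_int).symm
      _ = _ := by simp_rw [integral_const_mul]

/-! ### Wave packets with frequency in a unit cube -/

/-- The part of the amplitude `B` with (rescaled) frequency near the lattice point `k`. -/
def cut (φ : E d → ℝ) (B : E d → ℂ) (k : Fin d → ℤ) (ξ : E d) : ℂ :=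
  B ξ * (φ ((2 * Real.pi) • ξ - latt k) : ℂ)

/-- The wave packet `e^{i t ⟨∇⟩} P_k b`, where `b` has the Fourier transform `B`. -/
def piece (φ : E d → ℝ) (B : E d → ℂ) (k : Fin d → ℤ) (t : ℝ) (x : E d) : ℂ :=
  ∫ ξ, cut φ B k ξ * (Complex.exp (t * jb ((2 * Real.pi) • ξ) * Complex.I) * ech x ξ)

/-- `‖P_k b‖_{L²}²`. -/
def cutSq (φ : E d → ℝ) (B : E d → ℂ) (k : Fin d → ℤ) : ℝ≥0∞ := ∫⁻ ξ, ‖cut φ B k ξ‖ₑ ^ 2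

theorem lintegral_mul_sq_le {α : Type*} [MeasurableSpace α] {ν : Measure α} {F G : α → ℝ≥0∞}
    (hF : AEMeasurable F ν) (hG : AEMeasurable G ν) :
    (∫⁻ x, F x * G x ∂ν) ^ 2 ≤ (∫⁻ x, F x ^ 2 ∂ν) * ∫⁻ x, G x ^ 2 ∂ν := by
  have h2 := ENNReal.lintegral_mul_le_Lp_mul_Lq ν Real.HolderConjugate.two_two hF hG
  calc _ ≤ ((∫⁻ x, F x ^ (2 : ℝ) ∂ν) ^ (1 / (2 : ℝ)) *
        (∫⁻ x, G x ^ (2 : ℝ) ∂ν) ^ (1 / (2 : ℝ))) ^ 2 := by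
        gcongr; exact h2
    _ = _ := by
        rw [mul_pow, ← ENNReal.rpow_natCast, ← ENNReal.rpow_natCast, ← ENNReal.rpow_mul,
          ← ENNReal.rpow_mul]
        norm_num

theorem lintegral_mul_sq_le_weighted {α : Type*} [MeasurableSpace α] {ν : Measure α}
    {w G : α → ℝ≥0∞} (hw : AEMeasurable w ν) (hG : AEMeasurable G ν) :
    (∫⁻ x, w x * G x ∂ν) ^ 2 ≤ (∫⁻ x, w x ∂ν) * ∫⁻ x, w x * G x ^ 2 ∂ν := by
  have h := lintegral_mul_sq_le (F := fun x => w x ^ (1 / 2 : ℝ))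
    (G := fun x => w x ^ (1 / 2 : ℝ) * G x) (hw.pow_const _) ((hw.pow_const _).mul hG)
  have hs : ∀ a : ℝ≥0∞, (a ^ (1 / 2 : ℝ)) ^ 2 = a := fun a => by
    rw [← ENNReal.rpow_natCast, ← ENNReal.rpow_mul]; norm_num
  simp_rw [← mul_assoc, ← sq, mul_pow, hs] at h
  exact h

/-- A ball containing the support of the frequency packet at `k`. -/
def freqBall (k : Fin d → ℤ) : Set (E d) :=
  Metric.closedBall ((2 * Real.pi)⁻¹ • latt k) d

theorem mem_freqBall {k : Fin d → ℤ} {ξ : E d}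
    (h : ¬ ∃ i, 1 < |((2 * Real.pi) • ξ - latt k) i|) : ξ ∈ freqBall k := by
  push Not at h
  have h1 := norm_le_card_mul zero_le_one h
  have h2pi : (0 : ℝ) < 2 * Real.pi := by positivity
  rw [freqBall, mem_closedBall_iff_norm]
  have h3 : ξ - (2 * Real.pi)⁻¹ • latt k = (2 * Real.pi)⁻¹ • ((2 * Real.pi) • ξ - latt k) := by
    rw [smul_sub, smul_smul, inv_mul_cancel₀ h2pi.ne', one_smul]
  rw [h3, norm_smul, Real.norm_eq_abs, abs_of_pos (inv_pos.2 h2pi)]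
  have h4 : (2 * Real.pi)⁻¹ ≤ 1 := inv_le_one_of_one_le₀ (by nlinarith [Real.pi_gt_three])
  calc (2 * Real.pi)⁻¹ * ‖(2 * Real.pi) • ξ - latt k‖ ≤ 1 * (d * 1) := by gcongr
    _ = d := by ring

theorem volume_freqBall (k : Fin d → ℤ) :
    volume (freqBall k) = volume (Metric.closedBall (0 : E d) d) := by
  rw [freqBall, Measure.addHaar_closedBall_center]

/-- Bernstein's inequality for a unit frequency block: Cauchy–Schwarz on a support whose volume does
not depend on `k`. -/
theorem lintegral_sq_le_of_freqBall {k : Fin d → ℤ} {G : E d → ℝ≥0∞} (hG : AEMeasurable G)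
    (hs : ∀ ξ, (∃ i, 1 < |((2 * Real.pi) • ξ - latt k) i|) → G ξ = 0) :
    (∫⁻ ξ, G ξ) ^ 2 ≤ volume (Metric.closedBall (0 : E d) d) * ∫⁻ ξ, G ξ ^ 2 := by
  have h1 : ∫⁻ ξ, G ξ = ∫⁻ ξ, (freqBall k).indicator 1 ξ * G ξ := by
    refine lintegral_congr fun ξ => ?_
    by_cases h : ∃ i, 1 < |((2 * Real.pi) • ξ - latt k) i|
    · simp [hs ξ h]
    · simp [mem_freqBall h]
  have hm : MeasurableSet (freqBall k) := Metric.isClosed_closedBall.measurableSet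
  rw [h1]
  refine (lintegral_mul_sq_le ((measurable_one.indicator hm).aemeasurable) hG).trans ?_
  gcongr
  rw [← volume_freqBall k, ← lintegral_indicator_one hm]
  refine lintegral_mono fun ξ => ?_
  by_cases h : ξ ∈ freqBall k <;> simp [h]

section Packets

variable {φ : E d → ℝ} {B : E d → ℂ} {k : Fin d → ℤ}

theorem cut_eq_zero (hφ : IsUnitCutoff d φ) {ξ : E d}
    (h : ∃ i, 1 < |((2 * Real.pi) • ξ - latt k) i|) : cut φ B k ξ = 0 := by
  simp [cut, hφ.eq_zero _ h]

theorem stronglyMeasurable_cut (hφ : IsUnitCutoff d φ) (hB : StronglyMeasurable B) :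
    StronglyMeasurable (cut φ B k) := by
  have := hφ.smooth.continuous
  exact hB.mul (Continuous.stronglyMeasurable (by fun_prop))

theorem integrable_cut (hφ : IsUnitCutoff d φ) (hB : StronglyMeasurable B)
    (hfin : cutSq φ B k < ∞) : Integrable (cut φ B k) := by
  have hm := stronglyMeasurable_cut (k := k) hφ hB
  refine ⟨hm.aestronglyMeasurable, ?_⟩
  have h := lintegral_sq_le_of_freqBall (k := k) hm.measurable.enorm.aemeasurable
    fun ξ hξ => by simp [cut_eq_zero hφ hξ]
  have h2 : (∫⁻ ξ, ‖cut φ B k ξ‖ₑ) ^ 2 < ∞ := h.trans_lt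
    (ENNReal.mul_lt_top (isCompact_closedBall _ _).measure_lt_top hfin)
  rw [HasFiniteIntegral]
  by_contra hc
  simp only [not_lt, top_le_iff] at hc
  simp [hc] at h2

theorem norm_cexp_real_mul_real_mul_I (a b : ℝ) :
    ‖Complex.exp (a * b * Complex.I)‖ = 1 := by
  rw [← Complex.ofReal_mul, Complex.norm_exp_ofReal_mul_I]

theorem enorm_cexp_real_mul_real_mul_I (a b : ℝ) :
    ‖Complex.exp (a * b * Complex.I)‖ₑ = 1 := by
  rw [← ofReal_norm, norm_cexp_real_mul_real_mul_I, ENNReal.ofReal_one]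

theorem enorm_ech (x ξ : E d) : ‖ech x ξ‖ₑ = 1 := by
  rw [← ofReal_norm, norm_ech, ENNReal.ofReal_one]

theorem enorm_piece_sq_le (hφ : IsUnitCutoff d φ) (hB : StronglyMeasurable B) (t : ℝ) (x : E d) :
    ‖piece φ B k t x‖ₑ ^ 2 ≤ volume (Metric.closedBall (0 : E d) d) * cutSq φ B k := by
  have hm := stronglyMeasurable_cut (k := k) hφ hB
  refine le_trans ?_ (lintegral_sq_le_of_freqBall (k := k) hm.measurable.enorm.aemeasurable
    fun ξ hξ => by simp [cut_eq_zero hφ hξ])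
  gcongr
  refine (enorm_integral_le_lintegral_enorm _).trans (le_of_eq ?_)
  simp [enorm_mul, enorm_cexp_real_mul_real_mul_I, enorm_ech]

theorem continuous_piece (hφ : IsUnitCutoff d φ) (hB : StronglyMeasurable B)
    (hfin : cutSq φ B k < ∞) : Continuous fun p : ℝ × E d => piece φ B k p.1 p.2 := by
  have hi := integrable_cut hφ hB hfin
  unfold piece
  refine continuous_of_dominated (bound := fun ξ => ‖cut φ B k ξ‖) (fun p => ?_)
    (fun p => .of_forall fun ξ => ?_) hi.norm (.of_forall fun ξ => ?_)
  · exact hi.aestronglyMeasurable.mul (Continuous.aestronglyMeasurable (by fun_prop))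
  · simp [norm_cexp_real_mul_real_mul_I]
  · fun_prop

theorem norm_freq_le {N : ℕ} (hN : 1 ≤ N) (hk : k ∈ shell d N) {ξ : E d}
    (h : ¬ ∃ i, 1 < |((2 * Real.pi) • ξ - latt k) i|) :
    2 * Real.pi * ‖ξ‖ ≤ 3 * d * N := by
  push Not at h
  have h1 := norm_le_card_mul zero_le_one h
  have h2 := norm_latt_le_of_mem_shell hk
  have h3 : ‖(2 * Real.pi) • ξ‖ ≤ ‖(2 * Real.pi) • ξ - latt k‖ + ‖latt k‖ := by
    simpa using norm_add_le ((2 * Real.pi) • ξ - latt k) (latt k)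
  rw [norm_smul, Real.norm_eq_abs, abs_of_pos (by positivity)] at h3
  have hN1 : (1 : ℝ) ≤ N := by exact_mod_cast hN
  nlinarith [Nat.cast_nonneg (α := ℝ) d]

theorem le_norm_freq {N : ℕ} (hN : N ≠ 1) (hk : k ∈ shell d N) {ξ : E d}
    (h : ¬ ∃ i, 1 < |((2 * Real.pi) • ξ - latt k) i|) :
    N ≤ 2 * Real.pi * ‖ξ‖ := by
  push Not at h
  obtain ⟨i, hi⟩ := (mem_shell.1 hk).2.resolve_left hN
  have h1 := h i
  have h2 : |((2 * Real.pi) • ξ) i| ≤ 2 * Real.pi * ‖ξ‖ := by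
    refine (abs_coord_le_norm _ i).trans (le_of_eq ?_)
    rw [norm_smul, Real.norm_eq_abs, abs_of_pos (by positivity)]
  have h3 : (N + 1 : ℝ) ≤ |(latt k) i| := by
    simp only [latt]; exact_mod_cast hi
  have h4 : |(latt k) i| ≤ |((2 * Real.pi) • ξ) i| + |((2 * Real.pi) • ξ - latt k) i| := by
    have := abs_sub (((2 * Real.pi) • ξ) i) (((2 * Real.pi) • ξ - latt k) i)
    simpa using this
  linarith

/-- Frequencies in the shell have size comparable to `N`. -/
theorem exists_rpow_le_weight (d : ℕ) (s : ℝ) : ∃ C : ℝ≥0, ∀ N : ℕ, 1 ≤ N → ∀ k ∈ shell d N,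
    ∀ ξ : E d, (¬ ∃ i, 1 < |((2 * Real.pi) • ξ - latt k) i|) →
      (N : ℝ≥0∞) ^ (2 * s) ≤ C * ENNReal.ofReal ((1 + ‖ξ‖ ^ 2) ^ s) := by
  set b : ℝ := (2 * Real.pi) ^ 2 + (1 + 9 * d ^ 2) with hb
  have hpi := Real.pi_gt_three
  have hb1 : 1 ≤ b := by
    have : (0 : ℝ) ≤ (2 * Real.pi) ^ 2 + 9 * d ^ 2 := by positivity
    linarith
  refine ⟨Real.toNNReal (b ^ |s|), fun N hN k hk ξ h => ?_⟩
  have hN1 : (1 : ℝ) ≤ N := by exact_mod_cast hN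
  have hN0 : (0 : ℝ) < N := by linarith
  have hup : 1 + ‖ξ‖ ^ 2 ≤ b * (N : ℝ) ^ 2 := by
    have h1 := norm_freq_le hN hk h
    have h2 : ‖ξ‖ ≤ 3 * d * N := by nlinarith [norm_nonneg ξ]
    have h3 : ‖ξ‖ ^ 2 ≤ (3 * d * N) ^ 2 := pow_le_pow_left₀ (norm_nonneg _) h2 2
    have h4 : (1 : ℝ) ≤ N ^ 2 := one_le_pow₀ hN1
    have h5 : (0 : ℝ) ≤ (2 * Real.pi) ^ 2 * (N : ℝ) ^ 2 := by positivity
    rw [hb]; nlinarith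
  have hlo : (N : ℝ) ^ 2 ≤ b * (1 + ‖ξ‖ ^ 2) := by
    rcases eq_or_ne N 1 with h1 | h1
    · subst h1
      have : 1 ≤ 1 + ‖ξ‖ ^ 2 := by nlinarith [sq_nonneg ‖ξ‖]
      simp only [Nat.cast_one, one_pow]
      nlinarith
    · have h2 := le_norm_freq h1 hk h
      have h3 : (N : ℝ) ^ 2 ≤ (2 * Real.pi * ‖ξ‖) ^ 2 := pow_le_pow_left₀ hN0.le h2 2
      have h5 : (0 : ℝ) ≤ (1 + 9 * d ^ 2) * (1 + ‖ξ‖ ^ 2) := by positivity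
      have h6 : (0 : ℝ) ≤ (2 * Real.pi) ^ 2 := by positivity
      rw [hb]; nlinarith
  have hb0 : 0 < b := by linarith
  have hreal : (N : ℝ) ^ (2 * s) ≤ b ^ |s| * (1 + ‖ξ‖ ^ 2) ^ s := by
    rw [Real.rpow_mul hN0.le, Real.rpow_two]
    rcases le_total 0 s with hs | hs
    · rw [abs_of_nonneg hs, ← Real.mul_rpow hb0.le (by positivity)]
      exact Real.rpow_le_rpow (by positivity) hlo hs
    · have h1 := Real.rpow_le_rpow_of_nonpos (by positivity) hup hs
      rw [Real.mul_rpow hb0.le (by positivity)] at h1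
      rw [abs_of_nonpos hs]
      calc ((N : ℝ) ^ 2) ^ s = b ^ (-s) * (b ^ s * ((N : ℝ) ^ 2) ^ s) := by
            rw [← mul_assoc, ← Real.rpow_add hb0]; simp
        _ ≤ _ := by gcongr
  have hc : ((Real.toNNReal (b ^ |s|) : ℝ≥0) : ℝ≥0∞) = ENNReal.ofReal (b ^ |s|) := rfl
  rw [hc, ← ENNReal.ofReal_mul (by positivity), ← ENNReal.ofReal_natCast N,
    ENNReal.ofReal_rpow_of_pos hN0]
  exact ENNReal.ofReal_le_ofReal hreal

theorem sum_cutoff_sq_le (hφ : IsUnitCutoff d φ) (J : Finset (Fin d → ℤ)) (ξ : E d) :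
    ∑ k ∈ J, φ (ξ - latt k) ^ 2 ≤ 1 := by
  calc ∑ k ∈ J, φ (ξ - latt k) ^ 2 ≤ ∑ k ∈ J, φ (ξ - latt k) :=
        Finset.sum_le_sum fun k _ => by
          nlinarith [hφ.nonneg (ξ - latt k), hφ.le_one (ξ - latt k)]
    _ ≤ 1 := sum_le_hasSum J (fun k _ => hφ.nonneg _) (hφ.sum_translates ξ)

/-- Since `0 ≤ φ ≤ 1` and the translates sum to one, also `∑ φ_k² ≤ 1`; on the shell the Sobolev
weight is comparable to `N^{2s}`. -/
theorem exists_sum_cutSq_le (d : ℕ) (s : ℝ) : ∃ C : ℝ≥0, ∀ φ : E d → ℝ, IsUnitCutoff d φ →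
    ∀ B : E d → ℂ, StronglyMeasurable B → ∀ N : ℕ, 1 ≤ N →
      (N : ℝ≥0∞) ^ (2 * s) * ∑ k ∈ shell d N, cutSq φ B k ≤ C * wnorm s B := by
  obtain ⟨C, hC⟩ := exists_rpow_le_weight d s
  refine ⟨C, fun φ hφ B hB N hN => ?_⟩
  have hm : ∀ k, Measurable fun ξ => ‖cut φ B k ξ‖ₑ ^ 2 := fun k =>
    (stronglyMeasurable_cut hφ hB).measurable.enorm.pow_const 2
  unfold cutSq wnorm
  rw [← lintegral_finsetSum _ fun k _ => hm k, ← lintegral_const_mul' _ _ ENNReal.coe_ne_top,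
    ← lintegral_const_mul _ (Finset.measurable_sum _ fun k _ => hm k)]
  refine lintegral_mono fun ξ => ?_
  rw [Finset.mul_sum]
  calc ∑ k ∈ shell d N, (N : ℝ≥0∞) ^ (2 * s) * ‖cut φ B k ξ‖ₑ ^ 2
      ≤ ∑ k ∈ shell d N, (C * ENNReal.ofReal ((1 + ‖ξ‖ ^ 2) ^ s) * ‖B ξ‖ₑ ^ 2) *
          ENNReal.ofReal (φ ((2 * Real.pi) • ξ - latt k) ^ 2) := by
        refine Finset.sum_le_sum fun k hk => ?_
        by_cases h : ∃ i, 1 < |((2 * Real.pi) • ξ - latt k) i|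
        · simp [cut_eq_zero hφ h]
        · have h1 := hC N hN k hk ξ h
          have h2 : ‖cut φ B k ξ‖ₑ ^ 2 = ‖B ξ‖ₑ ^ 2 *
              ENNReal.ofReal (φ ((2 * Real.pi) • ξ - latt k) ^ 2) := by
            rw [cut, enorm_mul, mul_pow, ← ofReal_norm (_ : ℂ), ← ofReal_norm (_ : ℂ),
              Complex.norm_real, Real.norm_eq_abs, abs_of_nonneg (hφ.nonneg _),
              ENNReal.ofReal_pow (hφ.nonneg _)]
          rw [h2, ← mul_assoc]
          gcongr
    _ = (C * ENNReal.ofReal ((1 + ‖ξ‖ ^ 2) ^ s) * ‖B ξ‖ₑ ^ 2) *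
          ENNReal.ofReal (∑ k ∈ shell d N, φ ((2 * Real.pi) • ξ - latt k) ^ 2) := by
        rw [← Finset.mul_sum, ENNReal.ofReal_sum_of_nonneg fun k _ => by positivity]
    _ ≤ (C * ENNReal.ofReal ((1 + ‖ξ‖ ^ 2) ^ s) * ‖B ξ‖ₑ ^ 2) * ENNReal.ofReal 1 := by
        gcongr
        exact sum_cutoff_sq_le hφ _ _
    _ = _ := by rw [ENNReal.ofReal_one, mul_one, mul_assoc]

end Packets

/-- A bump equal to one on the frequency support can be inserted for free, so `bessel` applies with
one fixed profile translated to `k`. -/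
theorem exists_bessel_packet (d : ℕ) : ∃ C : ℝ≥0, ∀ n : ℕ, 1 ≤ n → ∀ (k : Fin d → ℤ)
    (G : E d → ℂ), AEStronglyMeasurable G →
    (∀ ξ, (∃ i, 1 < |((2 * Real.pi) • ξ - latt k) i|) → G ξ = 0) →
    ∑' z : Fin d → ℤ, ‖∫ ζ, G ζ * ech ((n : ℝ)⁻¹ • latt z) ζ‖ₑ ^ 2 ≤
      C * n ^ (2 * d) * ∫⁻ ζ, ‖G ζ‖ₑ ^ 2 := by
  set χ : ContDiffBump (0 : E d) := ⟨d + 1, d + 2, by positivity, by linarith⟩ with hχdef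
  have hχc : HasCompactSupport fun ξ : E d => (χ ξ : ℂ) :=
    χ.hasCompactSupport.comp_left Complex.ofReal_zero
  have hχs : ContDiff ℝ ((⊤ : ℕ∞) : WithTop ℕ∞) fun ξ : E d => (χ ξ : ℂ) :=
    Complex.ofRealCLM.contDiff.comp χ.contDiff
  obtain ⟨C, hC⟩ := bessel (hχc.toSchwartzMap hχs)
  refine ⟨C, fun n hn k G hG hs => ?_⟩
  refine le_trans (le_of_eq (tsum_congr fun z => ?_)) (hC n hn ((2 * Real.pi)⁻¹ • latt k) G hG)
  congr 2
  refine integral_congr_ae (.of_forall fun ζ => ?_)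
  by_cases h : ∃ i, 1 < |((2 * Real.pi) • ζ - latt k) i|
  · simp [hs ζ h]
  · have h1 := mem_freqBall h
    rw [freqBall, mem_closedBall_iff_norm] at h1
    have h2 : χ (ζ - (2 * Real.pi)⁻¹ • latt k) = 1 :=
      χ.one_of_mem_closedBall (by rw [mem_closedBall_zero_iff]; change _ ≤ (d + 1 : ℝ); linarith)
    have h3 : (hχc.toSchwartzMap hχs) (ζ - (2 * Real.pi)⁻¹ • latt k) = 1 := by
      change ((χ (ζ - (2 * Real.pi)⁻¹ • latt k) : ℝ) : ℂ) = 1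
      rw [h2]; simp
    simp only [h3, one_mul]

/-- Every point is a lattice translate of a point of the unit cube; overlaps on the faces only
increase the right side. -/
theorem lintegral_le_lintegral_cube_tsum {g : E d → ℝ≥0∞} (hg : Measurable g) :
    ∫⁻ y, g y ≤ ∫⁻ y in {x : E d | ∀ i, 0 ≤ x i ∧ x i ≤ 1}, ∑' z : Fin d → ℤ, g (y + latt z) := by
  set Q : Set (E d) := {x : E d | ∀ i, 0 ≤ x i ∧ x i ≤ 1} with hQ
  have hQm : MeasurableSet Q := by
    have : Q = ⋂ i, {x : E d | 0 ≤ x i ∧ x i ≤ 1} := by ext; simp [hQ]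
    rw [this]
    refine MeasurableSet.iInter fun i => ?_
    have hi : Measurable fun x : E d => x i := by fun_prop
    exact (measurableSet_le measurable_const hi).inter (measurableSet_le hi measurable_const)
  have h1m : Measurable (Q.indicator (1 : E d → ℝ≥0∞)) := measurable_one.indicator hQm
  have hind : ∀ z : Fin d → ℤ, Measurable fun y : E d => Q.indicator 1 (y - latt z) * g y :=
    fun z => (h1m.comp (measurable_id.sub_const (latt z))).mul hg
  calc ∫⁻ y, g y ≤ ∫⁻ y, ∑' z : Fin d → ℤ, Q.indicator 1 (y - latt z) * g y := by
        refine lintegral_mono fun y => ?_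
        refine le_trans ?_ (ENNReal.le_tsum fun i => ⌊y i⌋)
        have : y - latt (fun i => ⌊y i⌋) ∈ Q := fun i => by
          simp only [latt, PiLp.sub_apply]
          exact ⟨sub_nonneg.2 (Int.floor_le _), by linarith [Int.lt_floor_add_one (y i)]⟩
        simp [this]
    _ = ∑' z : Fin d → ℤ, ∫⁻ y, Q.indicator 1 (y - latt z) * g y :=
        lintegral_tsum fun z => (hind z).aemeasurable
    _ = ∑' z : Fin d → ℤ, ∫⁻ y, Q.indicator 1 y * g (y + latt z) := by
        refine tsum_congr fun z => ?_
        rw [← lintegral_add_right_eq_self _ (latt z)]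
        simp
    _ = ∫⁻ y, ∑' z : Fin d → ℤ, Q.indicator 1 y * g (y + latt z) :=
        (lintegral_tsum fun z => (h1m.mul (hg.comp (measurable_id.add_const _))).aemeasurable).symm
    _ = _ := by
        rw [← lintegral_indicator hQm]
        refine lintegral_congr fun y => ?_
        by_cases hy : y ∈ Q <;> simp [hy]

/-- A Plancherel bound obtained from sampling: the values on `y + ℤ^d` are lattice samples for the
amplitude modulated by `ech y`, so the Bessel bound holds uniformly in `y` and is integrated over
the unit cube. -/
theorem exists_lintegral_packet_le (d : ℕ) : ∃ C : ℝ≥0, ∀ (k : Fin d → ℤ)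
    (G : E d → ℂ), Integrable G →
    (∀ ξ, (∃ i, 1 < |((2 * Real.pi) • ξ - latt k) i|) → G ξ = 0) →
    ∫⁻ y, ‖∫ ζ, G ζ * ech y ζ‖ₑ ^ 2 ≤ C * ∫⁻ ζ, ‖G ζ‖ₑ ^ 2 := by
  obtain ⟨C, hC⟩ := exists_bessel_packet d
  set Q : Set (E d) := {x : E d | ∀ i, 0 ≤ x i ∧ x i ≤ 1} with hQ
  have hQf : volume Q < ∞ := by
    refine lt_of_le_of_lt (measure_mono (t := Metric.closedBall 0 (d * 1)) fun x hx => ?_)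
      (isCompact_closedBall (0 : E d) _).measure_lt_top
    rw [mem_closedBall_zero_iff]
    exact norm_le_card_mul zero_le_one fun i => abs_le.2 ⟨by linarith [(hx i).1], (hx i).2⟩
  refine ⟨C * (volume Q).toNNReal, fun k G hG hs => ?_⟩
  have hcont : Continuous fun y => ∫ ζ, G ζ * ech y ζ := by
    refine continuous_of_dominated (bound := fun ξ => ‖G ξ‖) (fun p => ?_)
      (fun p => .of_forall fun ξ => by simp) hG.norm (.of_forall fun ξ => by fun_prop)
    exact hG.aestronglyMeasurable.mul (Continuous.aestronglyMeasurable (by fun_prop))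
  refine (lintegral_le_lintegral_cube_tsum (hcont.enorm.measurable.pow_const 2)).trans ?_
  calc _ ≤ ∫⁻ _ in Q, C * ∫⁻ ζ, ‖G ζ‖ₑ ^ 2 := by
        refine lintegral_mono fun y => ?_
        have h := hC 1 le_rfl k (fun ζ => G ζ * ech y ζ) (hG.aestronglyMeasurable.mul
          (Continuous.aestronglyMeasurable (by fun_prop))) fun ξ hξ => by simp [hs ξ hξ]
        simp only [Nat.cast_one, inv_one, one_smul, one_pow, mul_one, enorm_mul, enorm_ech] at h
        refine le_trans (le_of_eq (tsum_congr fun z => ?_)) h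
        simp_rw [mul_assoc, ← ech_add_left]
    _ = _ := by
        rw [setLIntegral_const]
        push_cast
        rw [ENNReal.coe_toNNReal hQf.ne]
        ring

section Packets

variable {φ : E d → ℝ} {B : E d → ℂ} {k : Fin d → ℤ}

theorem piece_eq_packet (φ : E d → ℝ) (B : E d → ℂ) (k : Fin d → ℤ) (t : ℝ) (x : E d) :
    piece φ B k t x = ∫ ξ, (cut φ B k ξ *
      Complex.exp (t * jb ((2 * Real.pi) • ξ) * Complex.I)) * ech x ξ := by
  simp_rw [piece, mul_assoc]

theorem enorm_packet (φ : E d → ℝ) (B : E d → ℂ) (k : Fin d → ℤ) (t : ℝ) (ξ : E d) :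
    ‖cut φ B k ξ * Complex.exp (t * jb ((2 * Real.pi) • ξ) * Complex.I)‖ₑ = ‖cut φ B k ξ‖ₑ := by
  rw [enorm_mul, enorm_cexp_real_mul_real_mul_I, mul_one]

theorem integrable_packet (hφ : IsUnitCutoff d φ) (hB : StronglyMeasurable B)
    (hfin : cutSq φ B k < ∞) (t : ℝ) : Integrable fun ξ => cut φ B k ξ *
      Complex.exp (t * jb ((2 * Real.pi) • ξ) * Complex.I) := by
  have hi := integrable_cut hφ hB hfin
  refine hi.mono (hi.aestronglyMeasurable.mul (Continuous.aestronglyMeasurable (by fun_prop)))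
    (.of_forall fun ξ => ?_)
  rw [norm_mul, norm_cexp_real_mul_real_mul_I, mul_one]

theorem exists_tsum_piece_le (d : ℕ) : ∃ C : ℝ≥0, ∀ φ : E d → ℝ, IsUnitCutoff d φ →
    ∀ B : E d → ℂ, StronglyMeasurable B → ∀ (k : Fin d → ℤ) (t : ℝ) (n : ℕ), 1 ≤ n →
      ∑' z : Fin d → ℤ, ‖piece φ B k t ((n : ℝ)⁻¹ • latt z)‖ₑ ^ 2 ≤
        C * n ^ (2 * d) * cutSq φ B k := by
  obtain ⟨C, hC⟩ := exists_bessel_packet d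
  refine ⟨C, fun φ hφ B hB k t n hn => ?_⟩
  have := hC n hn k (fun ξ => cut φ B k ξ *
    Complex.exp (t * jb ((2 * Real.pi) • ξ) * Complex.I))
    ((stronglyMeasurable_cut hφ hB).aestronglyMeasurable.mul
      (Continuous.aestronglyMeasurable (by fun_prop))) fun ξ hξ => by simp [cut_eq_zero hφ hξ]
  simpa only [cutSq, enorm_packet, ← piece_eq_packet] using this

theorem exists_lintegral_piece_le (d : ℕ) : ∃ C : ℝ≥0, ∀ φ : E d → ℝ, IsUnitCutoff d φ →
    ∀ B : E d → ℂ, StronglyMeasurable B → ∀ (k : Fin d → ℤ), cutSq φ B k < ∞ → ∀ t : ℝ,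
      ∫⁻ x, ‖piece φ B k t x‖ₑ ^ 2 ≤ C * cutSq φ B k := by
  obtain ⟨C, hC⟩ := exists_lintegral_packet_le d
  refine ⟨C, fun φ hφ B hB k hfin t => ?_⟩
  have := hC k _ (integrable_packet hφ hB hfin t) fun ξ hξ => by simp [cut_eq_zero hφ hξ]
  simpa only [cutSq, enorm_packet, ← piece_eq_packet] using this

theorem lintegral_inv_one_add_norm_comp (M : ℕ) (a : E d) :
    ∫⁻ y : E d, ENNReal.ofReal (((1 + ‖a - y‖) ^ M)⁻¹) =
      ∫⁻ y : E d, ENNReal.ofReal (((1 + ‖y‖) ^ M)⁻¹) :=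
  lintegral_sub_left_eq_self (fun z : E d => ENNReal.ofReal (((1 + ‖z‖) ^ M)⁻¹)) a

theorem enorm_convolution_sq_le {C : ℝ} (hC0 : 0 ≤ C) {M : ℕ} {κ h : E d → ℂ} {a : E d}
    (hκ : ∀ z, ‖κ z‖ ≤ C * ((1 + ‖z + a‖) ^ M)⁻¹) (hh : Continuous h) (x : E d) :
    ‖∫ y, κ (x - y) * h y‖ₑ ^ 2 ≤ ENNReal.ofReal C ^ 2 *
      ((∫⁻ y : E d, ENNReal.ofReal (((1 + ‖y‖) ^ M)⁻¹)) *
        ∫⁻ y, ENNReal.ofReal (((1 + ‖x - y + a‖) ^ M)⁻¹) * ‖h y‖ₑ ^ 2) := by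
  have hwc : Measurable fun y : E d => ENNReal.ofReal (((1 + ‖x - y + a‖) ^ M)⁻¹) := by
    have : Continuous fun y : E d => ((1 + ‖x - y + a‖) ^ M)⁻¹ :=
      Continuous.inv₀ (by fun_prop) fun y => by positivity
    exact this.measurable.ennreal_ofReal
  have h1 : ‖∫ y, κ (x - y) * h y‖ₑ ≤
      ENNReal.ofReal C * ∫⁻ y, ENNReal.ofReal (((1 + ‖x - y + a‖) ^ M)⁻¹) * ‖h y‖ₑ := by
    rw [← lintegral_const_mul' _ _ ENNReal.ofReal_ne_top]
    refine (enorm_integral_le_lintegral_enorm _).trans (lintegral_mono fun y => ?_)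
    rw [enorm_mul, ← mul_assoc]
    gcongr
    rw [← ofReal_norm, ← ENNReal.ofReal_mul hC0]
    exact ENNReal.ofReal_le_ofReal (hκ _)
  have h2 := lintegral_inv_one_add_norm_comp M (x + a)
  simp_rw [add_sub_right_comm] at h2
  calc _ ≤ (ENNReal.ofReal C * ∫⁻ y, ENNReal.ofReal (((1 + ‖x - y + a‖) ^ M)⁻¹) * ‖h y‖ₑ) ^ 2 := by
        gcongr
    _ ≤ _ := by
        rw [mul_pow, ← h2]
        gcongr
        exact lintegral_mul_sq_le_weighted hwc.aemeasurable hh.enorm.measurable.aemeasurable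

theorem continuous_piece_right (hφ : IsUnitCutoff d φ) (hB : StronglyMeasurable B)
    (hfin : cutSq φ B k < ∞) (t : ℝ) : Continuous (piece φ B k t) :=
  (continuous_piece hφ hB hfin).comp (f := fun y => (t, y)) (by fun_prop)

/-- Cauchy–Schwarz with respect to the kernel weight keeps that weight to the first power. The
packet's square at `x` is thus dominated by an average of its initial square around `y = x + τ • vel
k`. -/
theorem exists_propagation {M : ℕ} (hM : d < M) : ∃ C : ℝ≥0, ∀ φ : E d → ℝ, IsUnitCutoff d φ →
    ∀ B : E d → ℂ, StronglyMeasurable B → ∀ N : ℕ, 1 ≤ N → ∀ k ∈ shell d N, cutSq φ B k < ∞ →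
    ∀ t₀ τ : ℝ, |τ| ≤ N → ∀ x : E d,
      ‖piece φ B k (t₀ + τ) x‖ₑ ^ 2 ≤ C * ∫⁻ y,
        ENNReal.ofReal (((1 + ‖x - y + τ • vel k‖) ^ M)⁻¹) * ‖piece φ B k t₀ y‖ₑ ^ 2 := by
  obtain ⟨C, hC0, hC⟩ := exists_kernel d M
  have hI := (integrable_inv_one_add_norm (d := d) hM).lintegral_lt_top
  refine ⟨C.toNNReal ^ 2 * (∫⁻ x : E d, ENNReal.ofReal (((1 + ‖x‖) ^ M)⁻¹)).toNNReal,
    fun φ hφ B hB N hN k hk hfin t₀ τ hτ x => ?_⟩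
  obtain ⟨κ, hκ, hconv⟩ := hC N hN k hk τ hτ
  have hrep : piece φ B k (t₀ + τ) x = ∫ y, κ (x - y) * piece φ B k t₀ y := by
    simp_rw [piece_eq_packet φ B k t₀]
    rw [← hconv _ (integrable_packet hφ hB hfin t₀)
      (fun ξ hξ => by simp [cut_eq_zero hφ hξ]) x, piece]
    refine integral_congr_ae (.of_forall fun ξ => ?_)
    simp only
    rw [mul_assoc (cut φ B k ξ), ← mul_assoc (Complex.exp _) (Complex.exp _), ← Complex.exp_add,
      Complex.ofReal_add, add_mul, add_mul]
  rw [hrep]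
  refine (enorm_convolution_sq_le hC0 hκ (continuous_piece_right hφ hB hfin t₀) x).trans (le_of_eq ?_)
  rw [ENNReal.coe_mul, ENNReal.coe_pow, ENNReal.coe_toNNReal hI.ne, mul_assoc, ENNReal.ofReal]

theorem norm_phase_sub_le {N : ℕ} (hN : 1 ≤ N) (hk : k ∈ shell d N) {ξ : E d}
    (h : ¬ ∃ i, 1 < |((2 * Real.pi) • ξ - latt k) i|) (t t' : ℝ) (x x' : E d) :
    ‖Complex.exp (t * jb ((2 * Real.pi) • ξ) * Complex.I) * ech x ξ -
      Complex.exp (t' * jb ((2 * Real.pi) • ξ) * Complex.I) * ech x' ξ‖ ≤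
      (3 * d + 1) * N * (|t - t'| + ‖x - x'‖) := by
  have hN1 : (1 : ℝ) ≤ N := by exact_mod_cast hN
  set a : ℝ := t * jb ((2 * Real.pi) • ξ) + 2 * Real.pi * inner ℝ x ξ with ha
  set b : ℝ := t' * jb ((2 * Real.pi) • ξ) + 2 * Real.pi * inner ℝ x' ξ with hb
  have e1 : Complex.exp (t * jb ((2 * Real.pi) • ξ) * Complex.I) * ech x ξ =
      Complex.exp (b * Complex.I) * Complex.exp (Complex.I * (a - b : ℝ)) := by
    rw [ech, ← Complex.exp_add, ← Complex.exp_add]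
    congr 1
    rw [ha]; push_cast; ring
  have e2 : Complex.exp (t' * jb ((2 * Real.pi) • ξ) * Complex.I) * ech x' ξ =
      Complex.exp (b * Complex.I) := by
    rw [ech, ← Complex.exp_add]
    congr 1
    rw [hb]; push_cast; ring
  rw [e1, e2, ← mul_sub_one, norm_mul, Complex.norm_exp_ofReal_mul_I, one_mul]
  refine (Real.norm_exp_I_mul_ofReal_sub_one_le).trans ?_
  have h1 := norm_freq_le hN hk h
  have h2 : jb ((2 * Real.pi) • ξ) ≤ (3 * d + 1) * N := by
    rw [jb, norm_smul, Real.norm_eq_abs, abs_of_pos (by positivity : 0 < 2 * Real.pi)]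
    refine Real.sqrt_le_iff.2 ⟨by positivity, ?_⟩
    have h3 : (2 * Real.pi * ‖ξ‖) ^ 2 ≤ (3 * d * N) ^ 2 := pow_le_pow_left₀ (by positivity) h1 2
    have h4 : (1 : ℝ) ≤ N ^ 2 := one_le_pow₀ hN1
    have h5 : (0 : ℝ) ≤ d * N ^ 2 := by positivity
    nlinarith
  have h4 : |inner ℝ (x - x') ξ| ≤ ‖x - x'‖ * ‖ξ‖ := abs_real_inner_le_norm _ _
  have h5 : a - b = (t - t') * jb ((2 * Real.pi) • ξ) + 2 * Real.pi * inner ℝ (x - x') ξ := by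
    rw [ha, hb, inner_sub_left]; ring
  rw [h5, Real.norm_eq_abs]
  calc |(t - t') * jb ((2 * Real.pi) • ξ) + 2 * Real.pi * inner ℝ (x - x') ξ|
      ≤ |t - t'| * jb ((2 * Real.pi) • ξ) + 2 * Real.pi * |inner ℝ (x - x') ξ| := by
        refine (abs_add_le _ _).trans (le_of_eq ?_)
        rw [abs_mul, abs_mul, abs_of_pos (jb_pos _), abs_of_pos (by positivity : 0 < 2 * Real.pi)]
    _ ≤ |t - t'| * ((3 * d + 1) * N) + 2 * Real.pi * (‖x - x'‖ * ‖ξ‖) := by gcongr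
    _ = |t - t'| * ((3 * d + 1) * N) + ‖x - x'‖ * (2 * Real.pi * ‖ξ‖) := by ring
    _ ≤ |t - t'| * ((3 * d + 1) * N) + ‖x - x'‖ * ((3 * d + 1) * N) := by
        have h6 : 2 * Real.pi * ‖ξ‖ ≤ (3 * d + 1) * N := by linarith
        linarith [mul_le_mul_of_nonneg_left h6 (norm_nonneg (x - x'))]
    _ = _ := by ring

theorem enorm_piece_sub_sq_le (hφ : IsUnitCutoff d φ) (hB : StronglyMeasurable B)
    (hfin : cutSq φ B k < ∞) {N : ℕ} (hN : 1 ≤ N) (hk : k ∈ shell d N) (t t' : ℝ) (x x' : E d) :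
    ‖piece φ B k t x - piece φ B k t' x'‖ₑ ^ 2 ≤
      ENNReal.ofReal ((3 * d + 1) * N * (|t - t'| + ‖x - x'‖)) ^ 2 *
        (volume (Metric.closedBall (0 : E d) d) * cutSq φ B k) := by
  have hi := integrable_cut hφ hB hfin
  have hm := stronglyMeasurable_cut (k := k) hφ hB
  have h_int : ∀ (t : ℝ) (x : E d), Integrable fun ξ => cut φ B k ξ *
      (Complex.exp (t * jb ((2 * Real.pi) • ξ) * Complex.I) * ech x ξ) := fun t x => by
    refine hi.mono (hi.aestronglyMeasurable.mul (Continuous.aestronglyMeasurable (by fun_prop)))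
      (.of_forall fun ξ => ?_)
    rw [norm_mul, norm_mul, norm_cexp_real_mul_real_mul_I, norm_ech, mul_one, mul_one]
  have h1 : ‖piece φ B k t x - piece φ B k t' x'‖ₑ ≤
      ENNReal.ofReal ((3 * d + 1) * N * (|t - t'| + ‖x - x'‖)) * ∫⁻ ξ, ‖cut φ B k ξ‖ₑ := by
    rw [piece, piece, ← integral_sub (h_int t x) (h_int t' x'),
      ← lintegral_const_mul' _ _ ENNReal.ofReal_ne_top]
    refine (enorm_integral_le_lintegral_enorm _).trans (lintegral_mono fun ξ => ?_)
    rw [← mul_sub, enorm_mul, mul_comm]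
    by_cases h : ∃ i, 1 < |((2 * Real.pi) • ξ - latt k) i|
    · simp [cut_eq_zero hφ h]
    · gcongr
      rw [← ofReal_norm]
      exact ENNReal.ofReal_le_ofReal (norm_phase_sub_le hN hk h t t' x x')
  calc _ ≤ (ENNReal.ofReal ((3 * d + 1) * N * (|t - t'| + ‖x - x'‖)) *
        ∫⁻ ξ, ‖cut φ B k ξ‖ₑ) ^ 2 := by gcongr
    _ ≤ _ := by
        rw [mul_pow]
        gcongr
        exact lintegral_sq_le_of_freqBall (k := k) hm.measurable.enorm.aemeasurable
          fun ξ hξ => by simp [cut_eq_zero hφ hξ]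

end Packets

/-! ### Comparison of a wave on a fine grid and off the grid -/

/-- The unnormalized half-wave `∑_{k ∈ K_N} a_k e^{i t ⟨∇⟩} P_k b`. -/
def shellSum (φ : E d → ℝ) (B : E d → ℂ) (a : (Fin d → ℤ) → ℝ) (N : ℕ) (t : ℝ) (x : E d) : ℂ :=
  ∑ k ∈ shell d N, (a k : ℂ) * piece φ B k t x

/-- The square function `∑_{k ∈ K_N} |e^{i t ⟨∇⟩} P_k b|²`. -/
def sqFun (φ : E d → ℝ) (B : E d → ℂ) (N : ℕ) (t : ℝ) (x : E d) : ℝ≥0∞ :=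
  ∑ k ∈ shell d N, ‖piece φ B k t x‖ₑ ^ 2

theorem enorm_sum_mul_sq_le {ι : Type*} (J : Finset ι) (a b : ι → ℂ) :
    ‖∑ k ∈ J, a k * b k‖ₑ ^ 2 ≤ (∑ k ∈ J, ‖a k‖ₑ ^ 2) * ∑ k ∈ J, ‖b k‖ₑ ^ 2 := by
  have h : ‖∑ k ∈ J, a k * b k‖₊ ^ 2 ≤ (∑ k ∈ J, ‖a k‖₊ ^ 2) * ∑ k ∈ J, ‖b k‖₊ ^ 2 := by
    refine le_trans ?_ (Finset.sum_mul_sq_le_sq_mul_sq J (fun k => ‖a k‖₊) fun k => ‖b k‖₊)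
    gcongr
    refine (nnnorm_sum_le _ _).trans (le_of_eq ?_)
    simp_rw [nnnorm_mul]
  simp only [enorm_eq_nnnorm]
  exact_mod_cast h

theorem enorm_add_sq_le (a b : ℂ) : ‖a + b‖ₑ ^ 2 ≤ 2 * (‖a‖ₑ ^ 2 + ‖b‖ₑ ^ 2) := by
  have h : ‖a + b‖₊ ^ 2 ≤ 2 * (‖a‖₊ ^ 2 + ‖b‖₊ ^ 2) :=
    (pow_le_pow_left₀ zero_le (nnnorm_add_le a b) 2).trans add_sq_le
  simp only [enorm_eq_nnnorm]
  exact_mod_cast h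

theorem card_shell_le {N : ℕ} (hN : 1 ≤ N) : ((shell d N).card : ℝ) ≤ 5 ^ d * (N : ℝ) ^ d := by
  have h1 : (shell d N).card ≤ (4 * N + 1) ^ d := by
    refine (Finset.card_filter_le _ _).trans (le_of_eq ?_)
    rw [Pi.card_Icc]
    simp only [Int.card_Icc, Finset.prod_const, Finset.card_univ, Fintype.card_fin]
    congr 1
    omega
  have h2 : (4 * N + 1) ^ d ≤ (5 * N) ^ d := Nat.pow_le_pow_left (by omega) d
  rw [← mul_pow]
  exact_mod_cast h1.trans h2

theorem rpow_two_mul_mul_eq_one {N : ℕ} (hN : 1 ≤ N) (s : ℝ) :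
    (N : ℝ≥0∞) ^ (2 * s) * ((N : ℝ≥0∞) * (N : ℝ≥0∞) ^ (-1 - 2 * s)) = 1 := by
  have h0 : (N : ℝ≥0∞) ≠ 0 := by exact_mod_cast (by omega : N ≠ 0)
  have ht : (N : ℝ≥0∞) ≠ ∞ := ENNReal.natCast_ne_top N
  nth_rewrite 2 [← ENNReal.rpow_one (N : ℝ≥0∞)]
  rw [← ENNReal.rpow_add _ _ h0 ht, ← ENNReal.rpow_add _ _ h0 ht]
  ring_nf
  simp

theorem sum_cutSq_le_of_le {φ : E d → ℝ} {B : E d → ℂ} {s : ℝ} {N : ℕ} (hN : 1 ≤ N) {K : ℝ≥0∞}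
    (h : (N : ℝ≥0∞) ^ (2 * s) * ∑ k ∈ shell d N, cutSq φ B k ≤ K) :
    ∑ k ∈ shell d N, cutSq φ B k ≤ K * ((N : ℝ≥0∞) * (N : ℝ≥0∞) ^ (-1 - 2 * s)) := by
  calc ∑ k ∈ shell d N, cutSq φ B k
      = ((N : ℝ≥0∞) ^ (2 * s) * ∑ k ∈ shell d N, cutSq φ B k) *
          ((N : ℝ≥0∞) * (N : ℝ≥0∞) ^ (-1 - 2 * s)) := by
        rw [mul_right_comm, rpow_two_mul_mul_eq_one hN, one_mul]
    _ ≤ _ := by gcongr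

section Packets

variable {φ : E d → ℝ} {B : E d → ℂ} {s : ℝ}

theorem cutSq_lt_top (hφ : IsUnitCutoff d φ) (hB : StronglyMeasurable B) (hA : wnorm s B < ∞)
    {N : ℕ} (hN : 1 ≤ N) {k : Fin d → ℤ} (hk : k ∈ shell d N) : cutSq φ B k < ∞ := by
  obtain ⟨C, hC⟩ := exists_sum_cutSq_le d s
  have h1 := sum_cutSq_le_of_le hN (hC φ hφ B hB N hN)
  refine lt_of_le_of_lt (Finset.single_le_sum (fun _ _ => zero_le) hk) (h1.trans_lt ?_)
  have h0 : (N : ℝ≥0∞) ≠ 0 := by exact_mod_cast (by omega : N ≠ 0)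
  have ht : (N : ℝ≥0∞) ≠ ∞ := ENNReal.natCast_ne_top N
  exact ENNReal.mul_lt_top (ENNReal.mul_lt_top ENNReal.coe_lt_top hA) (ENNReal.mul_lt_top
    ht.lt_top (ENNReal.rpow_ne_top_of_ne_zero h0 ht).lt_top)

/-- There are `O(N^d)` lattice points in the shell, and each squared coefficient is `O(N^{4d})`. -/
theorem exists_sum_sq_coeff_le {a : (Fin d → ℤ) → ℝ} {C : ℝ} (hC : 0 ≤ C)
    (ha : ∀ k, |a k| ≤ C * (1 + ‖latt k‖) ^ (2 * d)) : ∃ K : ℝ, 0 ≤ K ∧ ∀ N : ℕ, 1 ≤ N →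
      ∑ k ∈ shell d N, ‖(a k : ℂ)‖ₑ ^ 2 ≤ ENNReal.ofReal (K * (N : ℝ) ^ (5 * d)) := by
  refine ⟨5 ^ d * (C * (1 + 2 * d) ^ (2 * d)) ^ 2, by positivity, fun N hN => ?_⟩
  have hN1 : (1 : ℝ) ≤ N := by exact_mod_cast hN
  have h1 : ∀ k ∈ shell d N, ‖(a k : ℂ)‖ₑ ^ 2 ≤
      ENNReal.ofReal ((C * ((1 + 2 * d) * N) ^ (2 * d)) ^ 2) := by
    intro k hk
    rw [← ofReal_norm, Complex.norm_real, Real.norm_eq_abs, ← ENNReal.ofReal_pow (abs_nonneg _)]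
    refine ENNReal.ofReal_le_ofReal (pow_le_pow_left₀ (abs_nonneg _) ((ha k).trans ?_) 2)
    gcongr
    have := norm_latt_le_of_mem_shell hk
    nlinarith
  calc _ ≤ ∑ _k ∈ shell d N, ENNReal.ofReal ((C * ((1 + 2 * d) * N) ^ (2 * d)) ^ 2) :=
        Finset.sum_le_sum h1
    _ = ENNReal.ofReal ((shell d N).card * (C * ((1 + 2 * d) * N) ^ (2 * d)) ^ 2) := by
        rw [Finset.sum_const, nsmul_eq_mul, ENNReal.ofReal_mul (by positivity),
          ENNReal.ofReal_natCast]
    _ ≤ ENNReal.ofReal ((5 ^ d * (N : ℝ) ^ d) * (C * ((1 + 2 * d) * N) ^ (2 * d)) ^ 2) := by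
        refine ENNReal.ofReal_le_ofReal ?_
        gcongr
        exact card_shell_le hN
    _ = _ := by congr 1; rw [mul_pow (1 + 2 * (d : ℝ))]; ring

/-- Packets are Lipschitz with constant `O(N)`, so a displacement of order `N^{-(3d+2)}` contributes
`N^{-(6d+2)}` after squaring. This beats the coefficients, of size `N^{5d}`, with at least one
factor `N` to spare, which lowers the total packet mass `N^{-2s}` to `N^{-1-2s}`. -/
theorem exists_grid_comparison (hφ : IsUnitCutoff d φ) (hB : StronglyMeasurable B)
    (hA : wnorm s B < ∞) {a : (Fin d → ℤ) → ℝ} {Ca : ℝ} (hCa : 0 ≤ Ca)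
    (ha : ∀ k, |a k| ≤ Ca * (1 + ‖latt k‖) ^ (2 * d)) : ∃ K : ℝ≥0, ∀ N : ℕ, 1 ≤ N →
      ∀ (t t' : ℝ) (x x' : E d), |t - t'| ≤ ((N : ℝ) ^ (3 * d + 2))⁻¹ →
      ‖x - x'‖ ≤ d * ((N : ℝ) ^ (3 * d + 2))⁻¹ →
      ‖shellSum φ B a N t x - shellSum φ B a N t' x'‖ₑ ^ 2 ≤ K * (N : ℝ≥0∞) ^ (-1 - 2 * s) ∧
      sqFun φ B N t' x' ≤ 2 * sqFun φ B N t x + K * (N : ℝ≥0∞) ^ (-1 - 2 * s) := by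
  obtain ⟨C, hC⟩ := exists_sum_cutSq_le d s
  obtain ⟨K₁, hK₁, hsum⟩ := exists_sum_sq_coeff_le hCa ha
  set vol := volume (Metric.closedBall (0 : E d) d) with hvol
  have hvf : vol < ∞ := (isCompact_closedBall _ _).measure_lt_top
  set q₀ : ℝ := (3 * d + 1) * (d + 1) with hq₀
  have hq₀0 : 0 ≤ q₀ := by positivity
  set K₂ : ℝ≥0∞ := ENNReal.ofReal (q₀ ^ 2) * vol * (C * wnorm s B) with hK₂
  have hK₂f : K₂ < ∞ := ENNReal.mul_lt_top (ENNReal.mul_lt_top ENNReal.ofReal_lt_top hvf)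
    (ENNReal.mul_lt_top ENNReal.coe_lt_top hA)
  set K : ℝ≥0∞ := (ENNReal.ofReal K₁ + 2) * K₂ with hK
  have hKf : K < ∞ := ENNReal.mul_lt_top (by simp) hK₂f
  refine ⟨K.toNNReal, fun N hN t t' x x' ht hx => ?_⟩
  rw [ENNReal.coe_toNNReal hKf.ne]
  have hN1 : (1 : ℝ) ≤ N := by exact_mod_cast hN
  have hN0 : (0 : ℝ) < N := by linarith
  set e := (N : ℝ≥0∞) ^ (-1 - 2 * s) with he
  have hcut := sum_cutSq_le_of_le hN (hC φ hφ B hB N hN)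
  set r : ℝ := q₀ * ((N : ℝ) ^ (3 * d + 1))⁻¹ with hr
  have hle : (3 * d + 1) * N * (|t - t'| + ‖x - x'‖) ≤ r := by
    calc (3 * d + 1) * N * (|t - t'| + ‖x - x'‖)
        ≤ (3 * d + 1) * N * (((N : ℝ) ^ (3 * d + 2))⁻¹ + d * ((N : ℝ) ^ (3 * d + 2))⁻¹) := by
          gcongr
      _ = r := by rw [hr, hq₀]; field_simp; ring
  have hdiff : ∑ k ∈ shell d N, ‖piece φ B k t x - piece φ B k t' x'‖ₑ ^ 2 ≤
      ENNReal.ofReal r ^ 2 * (vol * (C * wnorm s B * (N * e))) := by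
    calc _ ≤ ∑ k ∈ shell d N, ENNReal.ofReal r ^ 2 * (vol * cutSq φ B k) := by
          refine Finset.sum_le_sum fun k hk => ?_
          refine (enorm_piece_sub_sq_le hφ hB (cutSq_lt_top hφ hB hA hN hk) hN hk t t' x x').trans ?_
          gcongr
      _ ≤ _ := by
          rw [← Finset.mul_sum, ← Finset.mul_sum]
          gcongr
  have hscale : ∀ M : ℝ, 0 ≤ M → M ≤ (N : ℝ) ^ (5 * d) →
      ENNReal.ofReal M * (ENNReal.ofReal r ^ 2 * (vol * (C * wnorm s B * (N * e)))) ≤ K₂ * e := by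
    intro M hM0 hM
    have h1 : M * r ^ 2 * N ≤ q₀ ^ 2 := by
      calc M * r ^ 2 * N ≤ (N : ℝ) ^ (5 * d) * r ^ 2 * N := by gcongr
        _ = q₀ ^ 2 * ((N : ℝ) ^ (5 * d + 1) * ((N : ℝ) ^ (6 * d + 2))⁻¹) := by
            rw [hr, mul_pow, inv_pow, ← pow_mul]; ring_nf
        _ ≤ q₀ ^ 2 * 1 := by
            gcongr
            rw [← div_eq_mul_inv, div_le_one (by positivity)]
            exact pow_le_pow_right₀ hN1 (by omega)
        _ = q₀ ^ 2 := mul_one _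
    have h2 : ENNReal.ofReal (M * r ^ 2 * N) = ENNReal.ofReal M * ENNReal.ofReal r ^ 2 * N := by
      rw [ENNReal.ofReal_mul (by positivity), ENNReal.ofReal_mul hM0,
        ENNReal.ofReal_pow (by positivity), ENNReal.ofReal_natCast]
    calc _ = ENNReal.ofReal (M * r ^ 2 * N) * vol * (C * wnorm s B) * e := by
          rw [h2]; ring
      _ ≤ _ := by rw [hK₂]; gcongr
  constructor
  · have h1 : shellSum φ B a N t x - shellSum φ B a N t' x' =
        ∑ k ∈ shell d N, (a k : ℂ) * (piece φ B k t x - piece φ B k t' x') := by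
      simp [shellSum, mul_sub]
    rw [h1]
    calc _ ≤ ENNReal.ofReal (K₁ * (N : ℝ) ^ (5 * d)) *
          (ENNReal.ofReal r ^ 2 * (vol * (C * wnorm s B * (N * e)))) :=
          (enorm_sum_mul_sq_le _ _ _).trans (mul_le_mul' (hsum N hN) hdiff)
      _ ≤ ENNReal.ofReal K₁ * (K₂ * e) := by
          rw [ENNReal.ofReal_mul hK₁, mul_assoc]
          exact mul_le_mul' le_rfl (hscale _ (by positivity) le_rfl)
      _ ≤ K * e := by
          rw [hK, ← mul_assoc]
          gcongr
          exact le_self_add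
  · calc sqFun φ B N t' x' ≤ ∑ k ∈ shell d N, 2 * (‖piece φ B k t x‖ₑ ^ 2 +
          ‖piece φ B k t x - piece φ B k t' x'‖ₑ ^ 2) := by
          refine Finset.sum_le_sum fun k _ => ?_
          have := enorm_add_sq_le (piece φ B k t x) (piece φ B k t' x' - piece φ B k t x)
          rwa [add_sub_cancel, enorm_sub_rev] at this
      _ = 2 * sqFun φ B N t x + 2 * ∑ k ∈ shell d N,
            ‖piece φ B k t x - piece φ B k t' x'‖ₑ ^ 2 := by
          rw [← Finset.mul_sum, Finset.sum_add_distrib, mul_add, sqFun]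
      _ ≤ 2 * sqFun φ B N t x + 2 * (K₂ * e) := by
          gcongr
          refine hdiff.trans ?_
          have := hscale 1 zero_le_one (one_le_pow₀ hN1)
          rwa [ENNReal.ofReal_one, one_mul] at this
      _ ≤ _ := by
          rw [hK, ← mul_assoc]
          gcongr
          exact le_add_self

end Packets

/-! ### Pointwise bound of a random wave by its square function -/

/-- A normalized moment of the wave at the point `(t, x)`. -/
def normalizedMoment (φ : E d → ℝ) (B : E d → ℂ) (a : (Fin d → ℤ) → ℝ) (s : ℝ) (m N : ℕ) (t : ℝ)
    (x : E d) : ℝ≥0∞ :=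
  ‖shellSum φ B a N t x‖ₑ ^ (2 * (m + 1)) *
    ((sqFun φ B N t x + (wnorm s B + 1) * (N : ℝ≥0∞) ^ (-1 - 2 * s)) ^ m)⁻¹

/-- The sum of the normalized moments over all dyadic `N` and the points of a fine space-time
grid. -/
def gridMoment (φ : E d → ℝ) (B : E d → ℂ) (a : (Fin d → ℤ) → ℝ) (s : ℝ) (m T : ℕ) : ℝ≥0∞ :=
  ∑' j : ℕ, ∑ i ∈ Finset.Icc (-(2 * (2 ^ j) ^ T * (2 ^ j) ^ (3 * d + 2) : ℤ))
      (2 * (2 ^ j) ^ T * (2 ^ j) ^ (3 * d + 2) : ℤ),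
    ((2 ^ j : ℕ) : ℝ≥0∞) ^ (2 * s) *
      (((2 ^ j : ℕ) : ℝ≥0∞) ^ (T + (3 * d + 2) * (2 * d + 1) + 1))⁻¹ *
      ∑' z : Fin d → ℤ, normalizedMoment φ B a s m (2 ^ j)
        ((i : ℝ) / (((2 ^ j) ^ (3 * d + 2) : ℕ) : ℝ))
        (((((2 ^ j) ^ (3 * d + 2) : ℕ) : ℝ))⁻¹ • latt z)

section Measurability

variable {Ω : Type*} [MeasurableSpace Ω] {S : Ω × E d → ℂ} {φ : E d → ℝ}

theorem measurable_piece_param (hφ : IsUnitCutoff d φ) (hS : StronglyMeasurable S)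
    (k : Fin d → ℤ) (t : ℝ) (x : E d) :
    Measurable fun ω => piece φ (fun ξ => S (ω, ξ)) k t x := by
  have hc := hφ.smooth.continuous
  have h : StronglyMeasurable fun p : Ω × E d => cut φ (fun ξ => S (p.1, ξ)) k p.2 *
      (Complex.exp (t * jb ((2 * Real.pi) • p.2) * Complex.I) * ech x p.2) := by
    have h1 : StronglyMeasurable fun ξ : E d => (φ ((2 * Real.pi) • ξ - latt k) : ℂ) *
        (Complex.exp (t * jb ((2 * Real.pi) • ξ) * Complex.I) * ech x ξ) :=
      Continuous.stronglyMeasurable (by fun_prop)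
    have h2 := hS.mul (h1.comp_measurable (measurable_snd (α := Ω)))
    have h3 : (fun p : Ω × E d => cut φ (fun ξ => S (p.1, ξ)) k p.2 *
        (Complex.exp (t * jb ((2 * Real.pi) • p.2) * Complex.I) * ech x p.2)) = S * ((fun ξ : E d =>
          (φ ((2 * Real.pi) • ξ - latt k) : ℂ) *
          (Complex.exp (t * jb ((2 * Real.pi) • ξ) * Complex.I) * ech x ξ)) ∘ Prod.snd) := by
      ext p; simp [cut, mul_assoc]
    rw [h3]
    exact h2
  exact (h.integral_prod_right (ν := volume)).measurable

theorem measurable_wnorm_param (hS : StronglyMeasurable S) (s : ℝ) :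
    Measurable fun ω => wnorm s fun ξ => S (ω, ξ) := by
  unfold wnorm
  refine Measurable.lintegral_prod_right' (f := fun p : Ω × E d =>
    ENNReal.ofReal ((1 + ‖p.2‖ ^ 2) ^ s) * ‖S p‖ₑ ^ 2) ?_
  exact (by fun_prop : Measurable fun p : Ω × E d => ENNReal.ofReal ((1 + ‖p.2‖ ^ 2) ^ s)).mul
    (hS.measurable.enorm.pow_const 2)

variable {Ω' : Type*} [MeasurableSpace Ω'] {X : (Fin d → ℤ) → Ω' → ℝ}

theorem measurable_gridMoment (hφ : IsUnitCutoff d φ) (hS : StronglyMeasurable S)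
    (hX : ∀ k, Measurable (X k)) (s : ℝ) (m T : ℕ) :
    Measurable fun ω : Ω' × Ω =>
      gridMoment φ (fun ξ => S (ω.2, ξ)) (fun k => X k ω.1) s m T := by
  have hp : ∀ k t x, Measurable fun ω : Ω' × Ω => piece φ (fun ξ => S (ω.2, ξ)) k t x :=
    fun k t x => (measurable_piece_param hφ hS k t x).comp measurable_snd
  have hx : ∀ k, Measurable fun ω : Ω' × Ω => (X k ω.1 : ℂ) := fun k =>
    Complex.measurable_ofReal.comp ((hX k).comp measurable_fst)
  have hw : Measurable fun ω : Ω' × Ω => wnorm s fun ξ => S (ω.2, ξ) :=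
    (measurable_wnorm_param hS s).comp measurable_snd
  unfold gridMoment normalizedMoment shellSum sqFun
  refine Measurable.tsum fun j => Finset.measurable_sum _ fun i _ =>
    Measurable.const_mul (Measurable.tsum fun z => ?_) _
  refine Measurable.mul (Measurable.pow_const (Measurable.enorm
    (Finset.measurable_sum _ fun k _ => (hx k).mul (hp k _ _))) _) ?_
  exact (((Finset.measurable_sum _ fun k _ => ((hp k _ _).enorm.pow_const 2)).add
    ((hw.add_const 1).mul_const _)).pow_const m).inv

end Measurability

section Moments

variable {Ω : Type*} [MeasurableSpace Ω] {μ : Measure Ω} [IsProbabilityMeasure μ]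
  {X : (Fin d → ℤ) → Ω → ℝ} {φ : E d → ℝ}

/-- With `V` the square function, the moment of order `2(m + 1)` is at most `D V^{m+1}`; dividing by
the `m`-th power of something larger than `V` leaves a bound linear in `V`. Only a linear bound can
be summed over infinitely many grid points. -/
theorem IsRandomizer.exists_normalizedMoment_le (hX : IsRandomizer X μ) (m : ℕ) :
    ∃ D : ℝ≥0, ∀ (φ : E d → ℝ) (B : E d → ℂ) (s : ℝ) (N : ℕ) (t : ℝ) (x : E d),
      ∫⁻ ω, normalizedMoment φ B (fun k => X k ω) s m N t x ∂μ ≤ D * sqFun φ B N t x := by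
  obtain ⟨D, hD⟩ := hX.exists_lintegral_sum_pow_le (m := m + 1) (by omega)
  refine ⟨D, fun φ B s N t x => ?_⟩
  unfold normalizedMoment
  set W := sqFun φ B N t x + (wnorm s B + 1) * (N : ℝ≥0∞) ^ (-1 - 2 * s)
  have hm : Measurable fun ω => ‖shellSum φ B (fun k => X k ω) N t x‖ₑ ^ (2 * (m + 1)) := by
    refine (Measurable.enorm (Finset.measurable_sum _ fun k _ => Measurable.mul_const ?_ _)).pow_const _
    exact Complex.measurable_ofReal.comp (hX.measurable k)
  rw [lintegral_mul_const _ hm]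
  calc _ ≤ D * sqFun φ B N t x ^ (m + 1) * (W ^ m)⁻¹ := by
        gcongr
        exact hD (shell d N) fun k => piece φ B k t x
    _ = D * sqFun φ B N t x * (sqFun φ B N t x ^ m / W ^ m) := by
        rw [pow_succ, div_eq_mul_inv]; ring
    _ ≤ D * sqFun φ B N t x * 1 := by
        gcongr
        refine ENNReal.div_le_of_le_mul ?_
        rw [one_mul]
        gcongr
        exact le_self_add
    _ = _ := mul_one _

/-- Put `n = N^{3d+2}`, the inverse mesh. There are at most `5 N^T n` times, and sampling in space
costs `n^{2d}`, together `N^{T + (3d+2)(2d+1)}`. The weight in `gridMoment` cancels this and leaves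
one more factor `1/N = 2^{-j}`, so that the dyadic sum converges; `N^{2s}` offsets the size of the
packet masses. -/
theorem IsRandomizer.exists_gridMoment_le (hX : IsRandomizer X μ) (s : ℝ) (m T : ℕ) :
    ∃ K : ℝ≥0, ∀ φ : E d → ℝ, IsUnitCutoff d φ → ∀ B : E d → ℂ, StronglyMeasurable B →
      ∫⁻ ω, gridMoment φ B (fun k => X k ω) s m T ∂μ ≤ K * wnorm s B := by
  obtain ⟨D, hD⟩ := hX.exists_normalizedMoment_le m
  obtain ⟨C, hC⟩ := exists_tsum_piece_le d
  obtain ⟨C', hC'⟩ := exists_sum_cutSq_le d s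
  refine ⟨10 * D * C * C', fun φ hφ B hB => ?_⟩
  have hm : ∀ N t x, Measurable fun ω => normalizedMoment φ B (fun k => X k ω) s m N t x := by
    intro N t x
    refine Measurable.mul_const ((Measurable.enorm (Finset.measurable_sum _ fun k _ =>
      Measurable.mul_const ?_ _)).pow_const _) _
    exact Complex.measurable_ofReal.comp (hX.measurable k)
  have hsq : ∀ (N n : ℕ) (t : ℝ), 1 ≤ n →
      ∑' z : Fin d → ℤ, ∫⁻ ω, normalizedMoment φ B (fun k => X k ω) s m N t
        ((n : ℝ)⁻¹ • latt z) ∂μ ≤ D * (C * n ^ (2 * d) * ∑ k ∈ shell d N, cutSq φ B k) := by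
    intro N n t hn
    calc _ ≤ ∑' z : Fin d → ℤ, D * sqFun φ B N t ((n : ℝ)⁻¹ • latt z) :=
          ENNReal.tsum_le_tsum fun z => hD φ B s N t _
      _ = D * ∑ k ∈ shell d N, ∑' z : Fin d → ℤ, ‖piece φ B k t ((n : ℝ)⁻¹ • latt z)‖ₑ ^ 2 := by
          rw [ENNReal.tsum_mul_left]
          unfold sqFun
          rw [Summable.tsum_finsetSum fun _ _ => ENNReal.summable]
      _ ≤ _ := by
          rw [Finset.mul_sum (a := (C : ℝ≥0∞) * n ^ (2 * d))]
          gcongr with k _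
          exact hC φ hφ B hB k t n hn
  unfold gridMoment
  rw [lintegral_tsum fun j => (Finset.measurable_sum _ fun i _ => Measurable.const_mul
    (Measurable.tsum fun z => hm _ _ _) _).aemeasurable]
  calc _ ≤ ∑' j : ℕ, (5 * D * C * C' * wnorm s B) * (2⁻¹ : ℝ≥0∞) ^ j := by
        refine ENNReal.tsum_le_tsum fun j => ?_
        set N : ℕ := 2 ^ j with hN
        have hN1 : 1 ≤ N := Nat.one_le_two_pow
        set n : ℕ := N ^ (3 * d + 2) with hn
        have hn1 : 1 ≤ n := Nat.one_le_pow _ _ hN1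
        have h0 : (N : ℝ≥0∞) ≠ 0 := by exact_mod_cast (by omega : N ≠ 0)
        have ht : (N : ℝ≥0∞) ≠ ∞ := ENNReal.natCast_ne_top N
        rw [lintegral_finsetSum _ fun i _ => Measurable.const_mul
          (Measurable.tsum fun z => hm _ _ _) _]
        set L : ℕ := T + (3 * d + 2) * (2 * d + 1) + 1 with hL
        calc _ ≤ ∑ _i ∈ Finset.Icc (-(2 * (2 ^ j) ^ T * (2 ^ j) ^ (3 * d + 2) : ℤ))
                (2 * (2 ^ j) ^ T * (2 ^ j) ^ (3 * d + 2) : ℤ),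
              (N : ℝ≥0∞) ^ (2 * s) * ((N : ℝ≥0∞) ^ L)⁻¹ *
                (D * (C * n ^ (2 * d) * ∑ k ∈ shell d N, cutSq φ B k)) := by
              refine Finset.sum_le_sum fun i _ => ?_
              rw [lintegral_const_mul _ (Measurable.tsum fun z => hm _ _ _),
                lintegral_tsum fun z => (hm _ _ _).aemeasurable]
              gcongr
              exact hsq N n _ hn1
          _ = ((Finset.Icc (-(2 * (2 ^ j) ^ T * (2 ^ j) ^ (3 * d + 2) : ℤ))
                (2 * (2 ^ j) ^ T * (2 ^ j) ^ (3 * d + 2) : ℤ)).card : ℝ≥0∞) *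
              (D * C * n ^ (2 * d) * ((N : ℝ≥0∞) ^ L)⁻¹ *
                ((N : ℝ≥0∞) ^ (2 * s) * ∑ k ∈ shell d N, cutSq φ B k)) := by
              rw [Finset.sum_const, nsmul_eq_mul]; ring
          _ ≤ ((5 * N ^ T * n : ℕ) : ℝ≥0∞) * (D * C * n ^ (2 * d) * ((N : ℝ≥0∞) ^ L)⁻¹ *
                (C' * wnorm s B)) := by
              refine mul_le_mul' (Nat.cast_le.2 ?_) (mul_le_mul' le_rfl (hC' φ hφ B hB N hN1))
              · rw [Int.card_Icc]
                have hz : (2 * (2 ^ j) ^ T * (2 ^ j) ^ (3 * d + 2) : ℤ) =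
                    ((2 * N ^ T * n : ℕ) : ℤ) := by rw [hn, hN]; push_cast; ring
                have h1 : 1 ≤ N ^ T * n := Nat.one_le_iff_ne_zero.2 (by positivity)
                rw [hz]
                have : 2 * N ^ T * n = 2 * (N ^ T * n) := by ring
                have : 5 * N ^ T * n = 5 * (N ^ T * n) := by ring
                omega
          _ = (5 * D * C * C' * wnorm s B) *
                ((N : ℝ≥0∞) ^ (T + (3 * d + 2) * (2 * d + 1)) * ((N : ℝ≥0∞) ^ L)⁻¹) := by
              rw [hn]; push_cast; rw [← pow_mul]; ring
          _ = _ := by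
              congr 1
              have hp0 : (N : ℝ≥0∞) ^ (T + (3 * d + 2) * (2 * d + 1)) ≠ 0 := pow_ne_zero _ h0
              have hpt : (N : ℝ≥0∞) ^ (T + (3 * d + 2) * (2 * d + 1)) ≠ ∞ := ENNReal.pow_ne_top ht
              rw [hL, pow_succ, ENNReal.mul_inv (Or.inl hp0) (Or.inl hpt), ← mul_assoc,
                ENNReal.mul_inv_cancel hp0 hpt, one_mul, hN, ← ENNReal.inv_pow]
              push_cast
              rfl
    _ = _ := by
        rw [ENNReal.tsum_mul_left, ENNReal.tsum_geometric, ENNReal.one_sub_inv_two, inv_inv]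
        push_cast
        ring

end Moments

/-! ### From moments on the grid to an almost sure bound at every point. -/

section Pointwise

variable {φ : E d → ℝ} {B : E d → ℂ} {s : ℝ}

theorem sqFun_lt_top (φ : E d → ℝ) (B : E d → ℂ) (N : ℕ) (t : ℝ) (x : E d) :
    sqFun φ B N t x < ∞ :=
  ENNReal.sum_lt_top.2 fun _ _ => ENNReal.pow_lt_top enorm_lt_top

/-- Let `W` be the normalizing factor. The hypothesis bounds `|∑ a_k v_k|^{2(m+1)}` by `Q N^{L-2s}
W^m`, and `N^{-2s} ≤ N W` because `W` contains the floor `N^{-1-2s}`. Taking the root of order `m +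
1` turns the loss `N^{L+1}` into `N^{(L+1)/(m+1)}`. -/
theorem enorm_shellSum_sq_le_of_moment (hA : wnorm s B < ∞) {a : (Fin d → ℤ) → ℝ} {m N L : ℕ}
    (hN : 1 ≤ N) {t : ℝ} {x : E d} {Q : ℝ≥0∞}
    (hQ : (N : ℝ≥0∞) ^ (2 * s) * ((N : ℝ≥0∞) ^ L)⁻¹ * normalizedMoment φ B a s m N t x ≤ Q) :
    ‖shellSum φ B a N t x‖ₑ ^ 2 ≤ Q ^ ((m + 1 : ℝ)⁻¹) * (N : ℝ≥0∞) ^ ((L + 1) / (m + 1) : ℝ) *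
      (sqFun φ B N t x + (wnorm s B + 1) * (N : ℝ≥0∞) ^ (-1 - 2 * s)) := by
  have h0 : (N : ℝ≥0∞) ≠ 0 := by exact_mod_cast (by omega : N ≠ 0)
  have ht : (N : ℝ≥0∞) ≠ ∞ := ENNReal.natCast_ne_top N
  unfold normalizedMoment at hQ
  set e := (N : ℝ≥0∞) ^ (-1 - 2 * s) with he
  have he0 : e ≠ 0 := by simp [he, ENNReal.rpow_eq_zero_iff, h0, ht]
  have het : e ≠ ∞ := ENNReal.rpow_ne_top_of_ne_zero h0 ht
  set W := sqFun φ B N t x + (wnorm s B + 1) * e with hW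
  have heW : e ≤ W := by
    calc e = 1 * e := (one_mul e).symm
      _ ≤ (wnorm s B + 1) * e := by gcongr; exact le_add_self
      _ ≤ W := le_add_self
  have hW0 : W ≠ 0 := fun h => he0 (le_antisymm (h ▸ heW) zero_le)
  have hWt : W ≠ ∞ := (ENNReal.add_lt_top.2 ⟨sqFun_lt_top _ _ _ _ _,
    ENNReal.mul_lt_top (ENNReal.add_lt_top.2 ⟨hA, ENNReal.one_lt_top⟩) het.lt_top⟩).ne
  set f := ‖shellSum φ B a N t x‖ₑ
  have hP := rpow_two_mul_mul_eq_one hN s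
  set P := (N : ℝ≥0∞) ^ (2 * s)
  have hL : ((N : ℝ≥0∞) ^ L)⁻¹ * (N : ℝ≥0∞) ^ L = 1 :=
    ENNReal.inv_mul_cancel (pow_ne_zero _ h0) (ENNReal.pow_ne_top ht)
  have hWm : (W ^ m)⁻¹ * W ^ m = 1 :=
    ENNReal.inv_mul_cancel (pow_ne_zero _ hW0) (ENNReal.pow_ne_top hWt)
  have h1 : f ^ (2 * (m + 1)) ≤ Q * (N : ℝ≥0∞) ^ (L + 1) * W ^ (m + 1) := by
    calc f ^ (2 * (m + 1)) = (P * ((N : ℝ≥0∞) ^ L)⁻¹ * (f ^ (2 * (m + 1)) * (W ^ m)⁻¹)) *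
          ((N * e) * (N : ℝ≥0∞) ^ L * W ^ m) := by
          calc f ^ (2 * (m + 1)) = f ^ (2 * (m + 1)) * (P * (N * e)) *
                (((N : ℝ≥0∞) ^ L)⁻¹ * (N : ℝ≥0∞) ^ L) * ((W ^ m)⁻¹ * W ^ m) := by
                rw [hP, hL, hWm]; simp
            _ = _ := by ring
      _ ≤ Q * ((N * W) * (N : ℝ≥0∞) ^ L * W ^ m) := by gcongr
      _ = _ := by ring
  have hm : (0 : ℝ) < m + 1 := by positivity
  have h2 := ENNReal.rpow_le_rpow h1 (inv_nonneg.2 hm.le)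
  have e1 : (f ^ (2 * (m + 1))) ^ ((m + 1 : ℝ)⁻¹) = f ^ 2 := by
    rw [← ENNReal.rpow_natCast, ← ENNReal.rpow_mul, ← ENNReal.rpow_natCast f 2]
    congr 1
    push_cast
    field_simp
  have e2 : (W ^ (m + 1)) ^ ((m + 1 : ℝ)⁻¹) = W := by
    rw [← ENNReal.rpow_natCast, ← ENNReal.rpow_mul]
    push_cast
    rw [mul_inv_cancel₀ hm.ne', ENNReal.rpow_one]
  have e3 : ((N : ℝ≥0∞) ^ (L + 1)) ^ ((m + 1 : ℝ)⁻¹) = (N : ℝ≥0∞) ^ ((L + 1) / (m + 1) : ℝ) := by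
    rw [← ENNReal.rpow_natCast, ← ENNReal.rpow_mul, div_eq_mul_inv]
    push_cast
    rfl
  rwa [ENNReal.mul_rpow_of_nonneg _ _ (inv_nonneg.2 hm.le),
    ENNReal.mul_rpow_of_nonneg _ _ (inv_nonneg.2 hm.le), e1, e2, e3] at h2

theorem exists_grid_point (n : ℕ) (hn : 1 ≤ n) {R : ℕ} {t : ℝ} (ht : |t| ≤ R) (x : E d) :
    ∃ i ∈ Finset.Icc (-(R * n : ℤ)) (R * n), ∃ z : Fin d → ℤ,
      |t - i / (n : ℝ)| ≤ (n : ℝ)⁻¹ ∧ ‖x - (n : ℝ)⁻¹ • latt z‖ ≤ d * (n : ℝ)⁻¹ := by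
  have hn0 : (0 : ℝ) < n := by exact_mod_cast hn
  have key : ∀ y : ℝ, |y - (n : ℝ)⁻¹ * ⌊y * n⌋| ≤ (n : ℝ)⁻¹ := by
    intro y
    have h1 := Int.floor_le (y * n)
    have h2 := Int.lt_floor_add_one (y * n)
    have h3 : y - (n : ℝ)⁻¹ * ⌊y * n⌋ = (n : ℝ)⁻¹ * (y * n - ⌊y * n⌋) := by field_simp
    rw [h3, abs_of_nonneg (mul_nonneg (by positivity) (by linarith))]
    exact mul_le_of_le_one_right (by positivity) (by linarith)
  rw [abs_le] at ht
  refine ⟨⌊t * n⌋, ?_, fun i => ⌊x i * n⌋, ?_, ?_⟩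
  · rw [Finset.mem_Icc]
    constructor
    · rw [Int.le_floor]
      push_cast
      nlinarith
    · have : (⌊t * n⌋ : ℝ) ≤ R * n := (Int.floor_le _).trans (by nlinarith)
      exact_mod_cast this
  · rw [div_eq_inv_mul]; exact key t
  · refine norm_le_card_mul (by positivity) fun i => ?_
    simpa [latt] using key (x i)

end Pointwise

/-- The moment bound is used in `ω₁` for frozen `ω₂`, where the amplitude is deterministic; Fubini
then gives the statement on the product. -/
theorem IsRandomizer.ae_gridMoment_lt_top {Ω₁ Ω₂ : Type*} [MeasurableSpace Ω₁]
    [MeasurableSpace Ω₂] {μ₁ : Measure Ω₁} {μ₂ : Measure Ω₂} [IsProbabilityMeasure μ₁]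
    [IsProbabilityMeasure μ₂] {X : (Fin d → ℤ) → Ω₁ → ℝ} (hX : IsRandomizer X μ₁) {φ : E d → ℝ}
    (hφ : IsUnitCutoff d φ) {S : Ω₂ × E d → ℂ} (hS : StronglyMeasurable S) {s : ℝ}
    (hfin : ∀ᵐ ω ∂μ₂, wnorm s (fun ξ => S (ω, ξ)) < ∞) (m T : ℕ) :
    ∀ᵐ ω ∂(μ₁.prod μ₂),
      gridMoment φ (fun ξ => S (ω.2, ξ)) (fun k => X k ω.1) s m T < ∞ := by
  set Q : Ω₁ × Ω₂ → ℝ≥0∞ := fun ω =>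
    gridMoment φ (fun ξ => S (ω.2, ξ)) (fun k => X k ω.1) s m T with hQ
  have hmeas : Measurable Q := measurable_gridMoment hφ hS hX.measurable s m T
  have hset : MeasurableSet {ω : Ω₁ × Ω₂ | Q ω < ∞} := measurableSet_lt hmeas measurable_const
  obtain ⟨K, hK⟩ := hX.exists_gridMoment_le s m T
  change ∀ᵐ ω ∂(μ₁.prod μ₂), Q ω < ∞
  rw [Measure.ae_prod_iff_ae_ae hset]
  refine (Measure.ae_ae_comm (p := fun x y => Q (x, y) < ∞) hset).2 ?_
  filter_upwards [hfin] with ω₂ hω₂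
  have hm1 : Measurable fun ω₁ => Q (ω₁, ω₂) :=
    hmeas.comp (g := Q) (f := fun ω₁ => (ω₁, ω₂)) measurable_prodMk_right
  refine ae_lt_top hm1 (ne_of_lt ?_)
  exact (hK φ hφ _ (hS.comp_measurable measurable_prodMk_left)).trans_lt
    (ENNReal.mul_lt_top ENNReal.coe_lt_top hω₂)

/-- A nearby grid point satisfies the bound, as one term of a finite sum. The wave is compared from
the grid to the given point and the square function in the opposite direction, both with errors
`O(N^{-1-2s})`. -/
theorem exists_pointwise_bound_of_gridMoment {φ : E d → ℝ} (hφ : IsUnitCutoff d φ) {B : E d → ℂ}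
    (hB : StronglyMeasurable B) {s : ℝ} (hA : wnorm s B < ∞) {a : (Fin d → ℤ) → ℝ} {Ca : ℝ}
    (hCa : 0 ≤ Ca) (ha : ∀ k, |a k| ≤ Ca * (1 + ‖latt k‖) ^ (2 * d)) {m T : ℕ}
    (hQ : gridMoment φ B a s m T < ∞) {η : ℝ} (hη : 0 < η)
    (hmη : ((T + (3 * d + 2) * (2 * d + 1) + 1 : ℕ) + 1) / (m + 1) ≤ η) :
    ∃ C : ℝ≥0, ∀ N : ℕ, (∃ j : ℕ, N = 2 ^ j) → ∀ t : ℝ, |t| ≤ 2 * (N : ℝ) ^ T → ∀ x : E d,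
      ‖shellSum φ B a N t x‖ₑ ^ 2 ≤ C * (N : ℝ≥0∞) ^ η * (sqFun φ B N t x +
        (N : ℝ≥0∞) ^ (-1 - 2 * s)) := by
  obtain ⟨K, hK⟩ := exists_grid_comparison hφ hB hA hCa ha
  set L : ℕ := T + (3 * d + 2) * (2 * d + 1) + 1 with hL
  set Q := gridMoment φ B a s m T with hQdef
  set Q' := Q ^ ((m + 1 : ℝ)⁻¹) with hQ'
  have hQ't : Q' < ∞ := ENNReal.rpow_lt_top_of_nonneg (by positivity) hQ.ne
  set C : ℝ≥0∞ := 4 * Q' + 2 * Q' * (K + wnorm s B + 1) + 2 * K with hC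
  have hCt : C < ∞ := by
    simp only [hC, ENNReal.add_lt_top]
    refine ⟨⟨ENNReal.mul_lt_top (by simp) hQ't, ENNReal.mul_lt_top
      (ENNReal.mul_lt_top (by simp) hQ't) (by simp [hA])⟩, ENNReal.mul_lt_top (by simp) (by simp)⟩
  refine ⟨C.toNNReal, fun N hN t ht x => ?_⟩
  obtain ⟨j, hj⟩ := hN
  have hN1 : 1 ≤ N := by rw [hj]; exact Nat.one_le_two_pow
  have hN1' : (1 : ℝ≥0∞) ≤ N := by exact_mod_cast hN1
  rw [ENNReal.coe_toNNReal hCt.ne]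
  set n : ℕ := N ^ (3 * d + 2) with hn
  have hnR : (n : ℝ) = (N : ℝ) ^ (3 * d + 2) := by rw [hn]; push_cast; rfl
  obtain ⟨i, hi, z, hti, hxz⟩ := exists_grid_point (d := d) n (Nat.one_le_pow _ _ hN1)
    (R := 2 * N ^ T) (t := t) (by push_cast; exact ht) x
  set t' := (i : ℝ) / (n : ℝ) with ht'
  set x' := (n : ℝ)⁻¹ • latt z with hx'
  rw [hnR] at hti hxz
  obtain ⟨hF, hV⟩ := hK N hN1 t t' x x' hti hxz
  have hterm : (N : ℝ≥0∞) ^ (2 * s) * ((N : ℝ≥0∞) ^ L)⁻¹ *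
      normalizedMoment φ B a s m N t' x' ≤ Q := by
    have hi' : i ∈ Finset.Icc (-(2 * (2 ^ j) ^ T * (2 ^ j) ^ (3 * d + 2) : ℤ))
        (2 * (2 ^ j) ^ T * (2 ^ j) ^ (3 * d + 2) : ℤ) := by
      have : ((2 * N ^ T : ℕ) : ℤ) * (n : ℤ) = 2 * (2 ^ j) ^ T * (2 ^ j) ^ (3 * d + 2) := by
        rw [hn, hj]; push_cast; ring
      rwa [this] at hi
    rw [hQdef, gridMoment]
    refine le_trans ?_ (ENNReal.le_tsum j)
    refine le_trans ?_ (Finset.single_le_sum (fun _ _ => zero_le) hi')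
    subst hj
    exact mul_le_mul' le_rfl (ENNReal.le_tsum z)
  have hgrid := enorm_shellSum_sq_le_of_moment hA hN1 hterm
  set e := (N : ℝ≥0∞) ^ (-1 - 2 * s) with he
  have hpow : (N : ℝ≥0∞) ^ ((L + 1) / (m + 1) : ℝ) ≤ (N : ℝ≥0∞) ^ η :=
    ENNReal.rpow_le_rpow_of_exponent_le hN1' hmη
  have hpow1 : 1 ≤ (N : ℝ≥0∞) ^ η := ENNReal.one_le_rpow hN1' hη
  set ν := (N : ℝ≥0∞) ^ η with hν
  set V := sqFun φ B N t x with hVdef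
  have h1 : ‖shellSum φ B a N t' x'‖ₑ ^ 2 ≤
      Q' * ν * (2 * V + K * e + (wnorm s B + 1) * e) := by
    refine hgrid.trans ?_
    gcongr
  calc ‖shellSum φ B a N t x‖ₑ ^ 2
      ≤ 2 * (‖shellSum φ B a N t' x'‖ₑ ^ 2 +
          ‖shellSum φ B a N t x - shellSum φ B a N t' x'‖ₑ ^ 2) := by
        have := enorm_add_sq_le (shellSum φ B a N t' x')
          (shellSum φ B a N t x - shellSum φ B a N t' x')
        rwa [add_sub_cancel] at this
    _ ≤ 2 * (Q' * ν * (2 * V + K * e + (wnorm s B + 1) * e) + ν * (K * e)) := by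
        gcongr
        exact hF.trans (le_mul_of_one_le_left zero_le hpow1)
    _ = ν * (4 * Q' * V + (2 * Q' * (K + wnorm s B + 1) + 2 * K) * e) := by ring
    _ ≤ ν * (C * V + C * e) := by
        gcongr
        · rw [hC, add_assoc (4 * Q')]
          exact le_self_add (a := 4 * Q')
        · rw [hC, add_assoc (4 * Q')]
          exact le_add_self (b := 4 * Q')
    _ = C * ν * (V + e) := by ring

theorem IsRandomizer.ae_pointwise_bound {Ω₁ Ω₂ : Type*} [MeasurableSpace Ω₁] [MeasurableSpace Ω₂]
    {μ₁ : Measure Ω₁} {μ₂ : Measure Ω₂} [IsProbabilityMeasure μ₁] [IsProbabilityMeasure μ₂]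
    {X : (Fin d → ℤ) → Ω₁ → ℝ} (hX : IsRandomizer X μ₁) {φ : E d → ℝ} (hφ : IsUnitCutoff d φ)
    {S : Ω₂ × E d → ℂ} (hS : StronglyMeasurable S) {s : ℝ}
    (hfin : ∀ᵐ ω ∂μ₂, wnorm s (fun ξ => S (ω, ξ)) < ∞) (T : ℕ) {η : ℝ} (hη : 0 < η) :
    ∀ᵐ ω ∂(μ₁.prod μ₂), ∃ C : ℝ≥0, ∀ N : ℕ, (∃ j : ℕ, N = 2 ^ j) → ∀ t : ℝ,
      |t| ≤ 2 * (N : ℝ) ^ T → ∀ x : E d,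
        ‖shellSum φ (fun ξ => S (ω.2, ξ)) (fun k => X k ω.1) N t x‖ₑ ^ 2 ≤
          C * (N : ℝ≥0∞) ^ η * (sqFun φ (fun ξ => S (ω.2, ξ)) N t x +
            (N : ℝ≥0∞) ^ (-1 - 2 * s)) := by
  set L : ℕ := T + (3 * d + 2) * (2 * d + 1) + 1 with hL
  -- The order of the moment is chosen last, so large that the loss `(L + 1)/(m + 1)` is at most
  -- `η`.
  obtain ⟨m, hm⟩ := exists_nat_gt ((L + 1) / η)
  have hmη : ((L + 1) / (m + 1) : ℝ) ≤ η := by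
    rw [div_lt_iff₀ hη] at hm
    rw [div_le_iff₀ (by positivity)]
    nlinarith
  filter_upwards [hX.ae_gridMoment_lt_top hφ hS hfin m T,
    Measure.quasiMeasurePreserving_fst.ae hX.ae_growth,
    Measure.quasiMeasurePreserving_snd.ae hfin] with ω hQ hgrow hA
  obtain ⟨Ca, hCa, ha⟩ := hgrow
  exact exists_pointwise_bound_of_gridMoment hφ (hS.comp_measurable measurable_prodMk_left) hA
    hCa ha hQ hη hmη

/-! ### The square function on a truncated cone -/

theorem isClosed_cone (N : ℕ) (t₀ : ℝ) (x₀ : E d) : IsClosed (cone N t₀ x₀) := by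
  have : cone N t₀ x₀ = {p : ℝ × E d | t₀ ≤ p.1} ∩ ({p : ℝ × E d | p.1 ≤ t₀ + N} ∩
      ⋂ i, {p : ℝ × E d | |p.2 i - x₀ i| ≤ 2 * (N : ℝ) - p.1 + t₀}) := by
    ext p; simp [cone]
  rw [this]
  exact (isClosed_le (by fun_prop) (by fun_prop)).inter
    ((isClosed_le (by fun_prop) (by fun_prop)).inter
      (isClosed_iInter fun i => isClosed_le (by fun_prop) (by fun_prop)))

theorem lintegral_cone_rpow_le (N : ℕ) (t₀ : ℝ) (x₀ : E d) {u : ℝ × E d → ℝ} (hu : AEMeasurable u)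
    {p : ℝ≥0∞} (hp0 : p ≠ 0) (hpt : p ≠ ∞) :
    ∫⁻ z in cone N t₀ x₀, ‖u z‖ₑ ^ p.toReal ≤
      N * normLinfLq p (cone N t₀ x₀) u ^ p.toReal := by
  set K := cone N t₀ x₀ with hK
  have hKm : MeasurableSet K := (isClosed_cone N t₀ x₀).measurableSet
  have hpr : 0 < p.toReal := ENNReal.toReal_pos hp0 hpt
  have hsl : ∀ t : ℝ, MeasurableSet {x : E d | (t, x) ∈ K} := fun t =>
    measurable_prodMk_left hKm
  rw [← lintegral_indicator hKm, Measure.volume_eq_prod,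
    lintegral_prod _ (((hu.enorm.pow_const _)).indicator hKm)]
  have h1 : ∀ t : ℝ, ∫⁻ x, K.indicator (fun z => ‖u z‖ₑ ^ p.toReal) (t, x) =
      eLpNorm (fun x => u (t, x)) p (volume.restrict {x | (t, x) ∈ K}) ^ p.toReal := by
    intro t
    rw [eLpNorm_eq_lintegral_rpow_enorm_toReal hp0 hpt, ← ENNReal.rpow_mul, one_div,
      inv_mul_cancel₀ hpr.ne', ENNReal.rpow_one, ← lintegral_indicator (hsl t)]
    rfl
  have h2 : ∀ᵐ t : ℝ, ∫⁻ x, K.indicator (fun z => ‖u z‖ₑ ^ p.toReal) (t, x) ≤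
      (Set.Icc t₀ (t₀ + N)).indicator (fun _ => normLinfLq p K u ^ p.toReal) t := by
    filter_upwards [ENNReal.ae_le_essSup (fun t : ℝ =>
      eLpNorm (fun x => u (t, x)) p (volume.restrict {x | (t, x) ∈ K}))] with t ht
    by_cases hI : t ∈ Set.Icc t₀ (t₀ + N)
    · rw [h1 t, Set.indicator_of_mem hI]
      exact ENNReal.rpow_le_rpow ht hpr.le
    · have : ∀ x, K.indicator (fun z => ‖u z‖ₑ ^ p.toReal) (t, x) = 0 := fun x =>
        Set.indicator_of_notMem (fun h => hI ⟨h.1, h.2.1⟩) _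
      simp [this]
  refine (lintegral_mono_ae h2).trans (le_of_eq ?_)
  rw [lintegral_indicator measurableSet_Icc, setLIntegral_const, Real.volume_Icc, mul_comm]
  simp

/-! ### Packet velocities and concentration near light cones. -/

theorem norm_vel (k : Fin d → ℤ) : ‖vel k‖ = ‖latt k‖ / jb (latt k) := by
  rw [vel, norm_smul, Real.norm_eq_abs, abs_of_pos (inv_pos.2 (jb_pos _)), inv_mul_eq_div]

theorem norm_le_jb (ξ : E d) : ‖ξ‖ ≤ jb ξ :=
  Real.le_sqrt_of_sq_le (by linarith)

theorem norm_vel_le_one (k : Fin d → ℤ) : ‖vel k‖ ≤ 1 := by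
  rw [norm_vel, div_le_one (jb_pos _)]
  exact norm_le_jb _

/-- From `⟨k⟩² - |k|² = 1` the speed defect is at most `⟨k⟩^{-2}`. Within a time `N` a packet thus
lags behind the light cone by at most `1/N`. -/
theorem one_sub_norm_vel_le {N : ℕ} (hN : 2 ≤ N) {k : Fin d → ℤ} (hk : k ∈ shell d N) :
    1 - ‖vel k‖ ≤ ((N : ℝ) ^ 2)⁻¹ := by
  have h1 := le_norm_latt_of_mem_shell (by omega : N ≠ 1) hk
  have h2 := norm_le_jb (latt k)
  have h3 := jb_sq (latt k)
  have h4 := jb_pos (latt k)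
  have hN0 : (0 : ℝ) < N := by exact_mod_cast (by omega : 0 < N)
  rw [norm_vel, one_sub_div h4.ne', div_le_iff₀ h4, ← div_eq_inv_mul, le_div_iff₀ (by positivity)]
  have h5 : jb (latt k) * (jb (latt k) - ‖latt k‖) ≤ 1 := by nlinarith
  have h6 : (N : ℝ) ^ 2 ≤ jb (latt k) ^ 2 := pow_le_pow_left₀ hN0.le (by linarith) 2
  calc (jb (latt k) - ‖latt k‖) * (N : ℝ) ^ 2 ≤ (jb (latt k) - ‖latt k‖) * jb (latt k) ^ 2 :=
        mul_le_mul_of_nonneg_left h6 (by linarith)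
    _ = jb (latt k) * (jb (latt k) * (jb (latt k) - ‖latt k‖)) := by ring
    _ ≤ jb (latt k) * 1 := by gcongr
    _ = jb (latt k) := mul_one _

/-- The `N^{5δ}`-neighbourhood of the light cone with vertex `(t₀, y)`. -/
def fluxSet (δ : ℝ) (N : ℕ) (t₀ : ℝ) (y : E d) : Set (ℝ × E d) :=
  {p : ℝ × E d | (t₀ ≤ p.1 ∧ p.1 ≤ t₀ + N) ∧ |‖p.2 - y‖ - (|p.1 - t₀|)| ≤ (N : ℝ) ^ (5 * δ)}

theorem isClosed_fluxSet (δ : ℝ) (N : ℕ) (t₀ : ℝ) (y : E d) : IsClosed (fluxSet δ N t₀ y) := by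
  have : fluxSet δ N t₀ y = ({p : ℝ × E d | t₀ ≤ p.1} ∩ {p : ℝ × E d | p.1 ≤ t₀ + N}) ∩
      {p : ℝ × E d | |‖p.2 - y‖ - (|p.1 - t₀|)| ≤ (N : ℝ) ^ (5 * δ)} := rfl
  rw [this]
  exact ((isClosed_le (by fun_prop) (by fun_prop)).inter
    (isClosed_le (by fun_prop) (by fun_prop))).inter (isClosed_le (by fun_prop) (by fun_prop))

/-- Wave packets travel, up to tails, along the light cone of their initial position. -/
theorem tail_le_of_notMem_fluxSet {δ : ℝ} (hδ : 0 < δ) {M : ℕ} (hM : 1 ≤ min (5 * δ) 1 * M)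
    {N : ℕ} (hN : 1 ≤ N) {k : Fin d → ℤ} (hk : k ∈ shell d N) {t₀ : ℝ} {x₀ : E d} {σ : ℝ}
    (hσ : |σ| = 1) {p : ℝ × E d} (hp : p ∈ cone N t₀ x₀) {y : E d}
    (hy : ¬ ((∀ i, |y i - x₀ i| ≤ 3 * (N : ℝ)) ∧ p ∈ fluxSet δ N t₀ y)) :
    ((1 + ‖p.2 - y + (σ * (p.1 - t₀)) • vel k‖) ^ M)⁻¹ ≤ 2 ^ M * (N : ℝ)⁻¹ := by
  obtain ⟨hp1, hp2, hp3⟩ := hp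
  have hN1 : (1 : ℝ) ≤ N := by exact_mod_cast hN
  have hN0 : (0 : ℝ) < N := by linarith
  set τ := σ * (p.1 - t₀) with hτ
  have hτa : |τ| = p.1 - t₀ := by
    rw [hτ, abs_mul, hσ, one_mul, abs_of_nonneg (by linarith)]
  rcases eq_or_ne N 1 with h1 | h1
  · subst h1
    have h2 : ((1 + ‖p.2 - y + τ • vel k‖) ^ M)⁻¹ ≤ 1 :=
      inv_le_one_of_one_le₀ (one_le_pow₀ (by linarith [norm_nonneg (p.2 - y + τ • vel k)]))
    simpa using h2.trans (one_le_pow₀ (by norm_num : (1 : ℝ) ≤ 2))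
  have hN2 : 2 ≤ N := by omega
  have hN2' : (2 : ℝ) ≤ N := by exact_mod_cast hN2
  -- The cap at one makes `r ≤ N/2`, so a packet found in the cone after time `|τ|` started within
  -- `(2N - |τ|) + N/2 + |τ| ≤ 3N` of `x₀`, in the range of vertices allowed in `flux`.
  set δ' := min (5 * δ) 1 with hδ'
  have hδ'0 : 0 < δ' := lt_min (by linarith) one_pos
  set r : ℝ := (N : ℝ) ^ δ' / 2 with hr
  have hr1 : 1 ≤ (N : ℝ) ^ δ' := Real.one_le_rpow hN1 hδ'0.le
  have hrN : (N : ℝ) ^ δ' ≤ N := by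
    simpa using Real.rpow_le_rpow_of_exponent_le hN1 (min_le_right (5 * δ) 1)
  rcases le_or_gt r ‖p.2 - y + τ • vel k‖ with hfar | hnear
  -- Far from the packet the decay of order `M` wins, since `δ' M ≥ 1` gives `r^{-M} ≤ 2^M / N`.
  · have h2 : r ^ M ≤ (1 + ‖p.2 - y + τ • vel k‖) ^ M :=
      pow_le_pow_left₀ (by positivity) (by linarith) M
    have h3 : (N : ℝ) ≤ ((N : ℝ) ^ δ') ^ M := by
      rw [← Real.rpow_mul_natCast hN0.le]
      simpa using Real.rpow_le_rpow_of_exponent_le hN1 hM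
    calc ((1 + ‖p.2 - y + τ • vel k‖) ^ M)⁻¹ ≤ (r ^ M)⁻¹ := by gcongr
      _ = 2 ^ M * (((N : ℝ) ^ δ') ^ M)⁻¹ := by rw [hr, div_pow, inv_div, div_eq_mul_inv]
      _ ≤ _ := by gcongr
  · exfalso
    have hv := norm_vel_le_one k
    refine hy ⟨fun i => ?_, ⟨hp1, hp2⟩, ?_⟩
    · have e1 := hp3 i
      have e2 := abs_coord_le_norm (p.2 - y + τ • vel k) i
      have e3 : |(τ • vel k) i| ≤ p.1 - t₀ := by
        refine (abs_coord_le_norm _ i).trans ?_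
        rw [norm_smul, Real.norm_eq_abs, hτa]
        exact mul_le_of_le_one_right (by linarith) hv
      have e4 : y i - x₀ i = (p.2 i - x₀ i) - (p.2 - y + τ • vel k) i + (τ • vel k) i := by
        simp only [PiLp.add_apply, PiLp.sub_apply]; ring
      rw [e4]
      refine (abs_add_le _ _).trans ?_
      have e5 := abs_sub (p.2 i - x₀ i) ((p.2 - y + τ • vel k) i)
      linarith
    -- One half of `N^{δ'}` is spent on the packet width `r`, the other half covers the delay `1/N ≤
    -- 1/2`.
    · have e1 : |‖p.2 - y‖ - ‖τ • vel k‖| ≤ ‖p.2 - y + τ • vel k‖ := by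
        have := abs_norm_sub_norm_le (p.2 - y) (-(τ • vel k))
        rwa [norm_neg, sub_neg_eq_add] at this
      have e2 : |‖τ • vel k‖ - (|p.1 - t₀|)| ≤ 1 / 2 := by
        rw [norm_smul, Real.norm_eq_abs, hτa, abs_of_nonneg (by linarith : 0 ≤ p.1 - t₀)]
        have h3 : (p.1 - t₀) * ‖vel k‖ - (p.1 - t₀) = -((p.1 - t₀) * (1 - ‖vel k‖)) := by ring
        rw [h3, abs_neg, abs_of_nonneg (mul_nonneg (by linarith) (by linarith))]
        calc (p.1 - t₀) * (1 - ‖vel k‖) ≤ N * ((N : ℝ) ^ 2)⁻¹ :=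
              mul_le_mul (by linarith) (one_sub_norm_vel_le hN2 hk) (by linarith) hN0.le
          _ = (N : ℝ)⁻¹ := by field_simp
          _ ≤ 1 / 2 := by rw [one_div]; gcongr
      have e3 := abs_sub_le ‖p.2 - y‖ ‖τ • vel k‖ (|p.1 - t₀|)
      have e4 : (N : ℝ) ^ δ' ≤ (N : ℝ) ^ (5 * δ) :=
        Real.rpow_le_rpow_of_exponent_le hN1 (min_le_left _ _)
      change |‖p.2 - y‖ - (|p.1 - t₀|)| ≤ (N : ℝ) ^ (5 * δ)
      linarith

/-- Near the light cone with vertex `(t₀, y)` the weight is at most one and the flux takes over.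
Elsewhere the weight is `O(1/N)`, which compensates for the duration `N` of the truncated cone. Only
vertices at time `t₀` are needed. -/
theorem lintegral_cone_tail_le (hd : 2 < d) {δ : ℝ} (hδ : 0 < δ) {M : ℕ}
    (hM : 1 ≤ min (5 * δ) 1 * M) {N : ℕ} (hN : 1 ≤ N) {k : Fin d → ℤ} (hk : k ∈ shell d N)
    (t₀ : ℝ) (x₀ : E d) {σ : ℝ} (hσ : |σ| = 1) {u : ℝ × E d → ℝ} (hu : AEMeasurable u) (y : E d) :
    ∫⁻ p in cone N t₀ x₀, ENNReal.ofReal (((1 + ‖p.2 - y + (σ * (p.1 - t₀)) • vel k‖) ^ M)⁻¹) *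
        ‖u p‖ₑ ^ (2 * d / (d - 2) : ℝ) ≤
      2 ^ M * (flux δ N t₀ x₀ u + normLinfLq (ENNReal.ofReal (2 * d / (d - 2)))
        (cone N t₀ x₀) u ^ (2 * d / (d - 2) : ℝ)) := by
  have hd' : (2 : ℝ) < d := by exact_mod_cast hd
  set q : ℝ := 2 * d / (d - 2) with hq
  have hq0 : 0 < q := div_pos (by linarith) (by linarith)
  have hN0 : (0 : ℝ) < N := by exact_mod_cast hN
  set K := cone N t₀ x₀ with hK
  have hKm : MeasurableSet K := (isClosed_cone N t₀ x₀).measurableSet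
  set A : Set (ℝ × E d) := {p | (∀ i, |y i - x₀ i| ≤ 3 * (N : ℝ)) ∧ p ∈ fluxSet δ N t₀ y} with hA
  have hflux : ∫⁻ p in K, A.indicator (fun p => ‖u p‖ₑ ^ q) p ≤ flux δ N t₀ x₀ u := by
    by_cases hy : ∀ i, |y i - x₀ i| ≤ 3 * (N : ℝ)
    · have hAe : A = fluxSet δ N t₀ y := by ext p; simp [hA, hy]
      rw [hAe]
      calc _ ≤ ∫⁻ p, (fluxSet δ N t₀ y).indicator (fun p => ‖u p‖ₑ ^ q) p :=
            setLIntegral_le_lintegral _ _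
        _ = ∫⁻ p in fluxSet δ N t₀ y, ‖u p‖ₑ ^ q :=
            lintegral_indicator (isClosed_fluxSet δ N t₀ y).measurableSet _
        _ ≤ _ := by
            rw [flux]
            refine le_iSup₂_of_le t₀ ⟨le_rfl, by linarith⟩ ?_
            exact le_iSup₂ (f := fun (x' : E d) (_ : ∀ i, |x' i - x₀ i| ≤ 3 * (N : ℝ)) =>
              ∫⁻ p in fluxSet δ N t₀ x', ‖u p‖ₑ ^ q) y hy
    · have hAe : A = ∅ := by ext p; simp only [hA, hy, false_and]; rfl
      simp [hAe]
  have hLq := lintegral_cone_rpow_le N t₀ x₀ hu (p := ENNReal.ofReal q) (by simpa using hq0)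
    ENNReal.ofReal_ne_top
  rw [ENNReal.toReal_ofReal hq0.le] at hLq
  calc _ ≤ ∫⁻ p in K, (A.indicator (fun p => ‖u p‖ₑ ^ q) p +
        ENNReal.ofReal (2 ^ M * (N : ℝ)⁻¹) * ‖u p‖ₑ ^ q) := by
        refine setLIntegral_mono' hKm fun p hp => ?_
        by_cases h : p ∈ A
        · rw [Set.indicator_of_mem h]
          refine le_trans ?_ le_self_add
          refine mul_le_of_le_one_left zero_le (ENNReal.ofReal_le_one.2 ?_)
          exact inv_le_one_of_one_le₀ (one_le_pow₀ (by
            linarith [norm_nonneg (p.2 - y + (σ * (p.1 - t₀)) • vel k)]))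
        · rw [Set.indicator_of_notMem h, zero_add]
          gcongr
          exact tail_le_of_notMem_fluxSet hδ hM hN hk hσ hp h
    _ = (∫⁻ p in K, A.indicator (fun p => ‖u p‖ₑ ^ q) p) +
          ENNReal.ofReal (2 ^ M * (N : ℝ)⁻¹) * ∫⁻ p in K, ‖u p‖ₑ ^ q := by
        rw [lintegral_add_right' _ ((hu.enorm.pow_const _).restrict.const_mul _),
          lintegral_const_mul' _ _ ENNReal.ofReal_ne_top]
    _ ≤ flux δ N t₀ x₀ u + ENNReal.ofReal (2 ^ M * (N : ℝ)⁻¹) *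
          (N * normLinfLq (ENNReal.ofReal q) K u ^ q) := by gcongr
    _ = flux δ N t₀ x₀ u + 2 ^ M * normLinfLq (ENNReal.ofReal q) K u ^ q := by
        rw [← mul_assoc, ← ENNReal.ofReal_natCast N, ← ENNReal.ofReal_mul (by positivity),
          mul_assoc, inv_mul_cancel₀ hN0.ne', mul_one, ENNReal.ofReal_pow (by norm_num),
          ENNReal.ofReal_ofNat]
    _ ≤ _ := by
        rw [mul_add]
        gcongr
        exact le_mul_of_one_le_left zero_le (one_le_pow₀ (by norm_num))

/-- Propagation writes each packet in terms of its values at time `t₀`. After Tonelli, the integral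
over the cone for a fixed starting point `y` is bounded independently of `y` by
`lintegral_cone_tail_le`, and what is left is the mass of the packet. The sign `σ` covers both
half-waves by time reversal. -/
theorem exists_cone_estimate (hd : 2 < d) (s : ℝ) {δ : ℝ} (hδ : 0 < δ) : ∃ C : ℝ≥0,
    ∀ φ : E d → ℝ, IsUnitCutoff d φ → ∀ B : E d → ℂ, StronglyMeasurable B → wnorm s B < ∞ →
    ∀ N : ℕ, 1 ≤ N → ∀ (t₀ : ℝ) (x₀ : E d) (σ : ℝ), |σ| = 1 → ∀ u : ℝ × E d → ℝ, AEMeasurable u →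
      ∫⁻ p in cone N t₀ x₀, sqFun φ B N (σ * p.1) p.2 * ‖u p‖ₑ ^ (2 * d / (d - 2) : ℝ) ≤
        C * wnorm s B * (N * (N : ℝ≥0∞) ^ (-1 - 2 * s)) *
          (flux δ N t₀ x₀ u + normLinfLq (ENNReal.ofReal (2 * d / (d - 2)))
            (cone N t₀ x₀) u ^ (2 * d / (d - 2) : ℝ)) := by
  have hδ'0 : 0 < min (5 * δ) 1 := lt_min (by linarith) one_pos
  -- Two demands on the decay order: `M > d` for an integrable kernel, and `M min(5δ, 1) ≥ 1` for
  -- tails of size `1/N`.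
  obtain ⟨M₀, hM₀⟩ := exists_nat_gt (1 / min (5 * δ) 1)
  set M := max M₀ (d + 1) with hMdef
  have hMd : d < M := lt_of_lt_of_le (Nat.lt_succ_self d) (le_max_right _ _)
  have hM : 1 ≤ min (5 * δ) 1 * M := by
    rw [div_lt_iff₀ hδ'0] at hM₀
    have : (M₀ : ℝ) ≤ M := by exact_mod_cast le_max_left _ _
    nlinarith
  obtain ⟨C₁, hC₁⟩ := exists_propagation hMd
  obtain ⟨C₂, hC₂⟩ := exists_lintegral_piece_le d
  obtain ⟨C₃, hC₃⟩ := exists_sum_cutSq_le d s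
  refine ⟨C₁ * 2 ^ M * C₂ * C₃, fun φ hφ B hB hA N hN t₀ x₀ σ hσ u hu => ?_⟩
  set q : ℝ := 2 * d / (d - 2) with hq
  set K := cone N t₀ x₀ with hK
  have hKm : MeasurableSet K := (isClosed_cone N t₀ x₀).measurableSet
  set Z := flux δ N t₀ x₀ u + normLinfLq (ENNReal.ofReal q) K u ^ q with hZ
  have hpiece : ∀ k ∈ shell d N,
      ∫⁻ p in K, ‖piece φ B k (σ * p.1) p.2‖ₑ ^ 2 * ‖u p‖ₑ ^ q ≤
        C₁ * (2 ^ M * Z * (C₂ * cutSq φ B k)) := by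
    intro k hk
    have hfin := cutSq_lt_top hφ hB hA hN hk
    have hcont := continuous_piece_right hφ hB hfin (σ * t₀)
    have hwm : Measurable fun z : (ℝ × E d) × E d => ENNReal.ofReal
        (((1 + ‖z.1.2 - z.2 + (σ * (z.1.1 - t₀)) • vel k‖) ^ M)⁻¹) := by
      have : Continuous fun z : (ℝ × E d) × E d =>
          ((1 + ‖z.1.2 - z.2 + (σ * (z.1.1 - t₀)) • vel k‖) ^ M)⁻¹ :=
        Continuous.inv₀ (by fun_prop) fun y => by positivity
      exact this.measurable.ennreal_ofReal
    calc _ ≤ ∫⁻ p in K, ∫⁻ y, C₁ * (ENNReal.ofReal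
          (((1 + ‖p.2 - y + (σ * (p.1 - t₀)) • vel k‖) ^ M)⁻¹) *
            ‖piece φ B k (σ * t₀) y‖ₑ ^ 2 * ‖u p‖ₑ ^ q) := by
          refine setLIntegral_mono' hKm fun p hp => ?_
          have hτ : |σ * (p.1 - t₀)| ≤ N := by
            rw [abs_mul, hσ, one_mul, abs_of_nonneg (by linarith [hp.1])]
            linarith [hp.2.1]
          have h1 := hC₁ φ hφ B hB N hN k hk hfin (σ * t₀) (σ * (p.1 - t₀)) hτ p.2
          have h2 : σ * t₀ + σ * (p.1 - t₀) = σ * p.1 := by ring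
          rw [h2] at h1
          have hm1 : Measurable fun y => ENNReal.ofReal
              (((1 + ‖p.2 - y + (σ * (p.1 - t₀)) • vel k‖) ^ M)⁻¹) *
                ‖piece φ B k (σ * t₀) y‖ₑ ^ 2 :=
            (hwm.comp (g := fun z : (ℝ × E d) × E d => ENNReal.ofReal
              (((1 + ‖z.1.2 - z.2 + (σ * (z.1.1 - t₀)) • vel k‖) ^ M)⁻¹))
              (measurable_prodMk_left (x := p))).mul (hcont.enorm.measurable.pow_const 2)
          rw [lintegral_const_mul' _ _ ENNReal.coe_ne_top, lintegral_mul_const _ hm1, ← mul_assoc]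
          gcongr
      _ = ∫⁻ y, ∫⁻ p in K, C₁ * (ENNReal.ofReal
          (((1 + ‖p.2 - y + (σ * (p.1 - t₀)) • vel k‖) ^ M)⁻¹) *
            ‖piece φ B k (σ * t₀) y‖ₑ ^ 2 * ‖u p‖ₑ ^ q) := by
          refine lintegral_lintegral_swap (AEMeasurable.const_mul (AEMeasurable.mul ?_ ?_) _)
          · exact (hwm.mul ((hcont.enorm.measurable.pow_const 2).comp
              measurable_snd)).aemeasurable
          · exact ((hu.enorm.pow_const q).restrict).comp_fst
      _ ≤ ∫⁻ y, C₁ * ((2 ^ M * Z) * ‖piece φ B k (σ * t₀) y‖ₑ ^ 2) := by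
          refine lintegral_mono fun y => ?_
          rw [lintegral_const_mul' _ _ ENNReal.coe_ne_top]
          gcongr
          calc _ = (∫⁻ p in K, ENNReal.ofReal
                (((1 + ‖p.2 - y + (σ * (p.1 - t₀)) • vel k‖) ^ M)⁻¹) * ‖u p‖ₑ ^ q) *
                ‖piece φ B k (σ * t₀) y‖ₑ ^ 2 := by
                rw [← lintegral_mul_const' _ _ (ENNReal.pow_ne_top enorm_ne_top)]
                refine lintegral_congr fun p => ?_
                ring
            _ ≤ _ := by
                gcongr
                exact lintegral_cone_tail_le hd hδ hM hN hk t₀ x₀ hσ hu y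
      _ ≤ _ := by
          rw [lintegral_const_mul' _ _ ENNReal.coe_ne_top,
            lintegral_const_mul _ (hcont.enorm.measurable.pow_const 2)]
          gcongr
          exact hC₂ φ hφ B hB k hfin _
  unfold sqFun
  simp_rw [Finset.sum_mul]
  rw [lintegral_finsetSum' _ fun k hk => ?_]
  · calc _ ≤ ∑ k ∈ shell d N, C₁ * (2 ^ M * Z * (C₂ * cutSq φ B k)) := Finset.sum_le_sum hpiece
      _ = C₁ * (2 ^ M * Z * (C₂ * ∑ k ∈ shell d N, cutSq φ B k)) := by
          simp_rw [Finset.mul_sum]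
      _ ≤ C₁ * (2 ^ M * Z * (C₂ * (C₃ * wnorm s B * (N * (N : ℝ≥0∞) ^ (-1 - 2 * s))))) := by
          gcongr
          exact sum_cutSq_le_of_le hN (hC₃ φ hφ B hB N hN)
      _ = _ := by push_cast; ring
  · have hc := (continuous_piece hφ hB (cutSq_lt_top hφ hB hA hN hk)).comp
      (f := fun p : ℝ × E d => (σ * p.1, p.2)) (by fun_prop)
    exact (hc.enorm.measurable.pow_const 2).aemeasurable.mul (hu.enorm.pow_const q).restrict

/-! ### The trilinear estimate -/

theorem lintegral_mul_mul_rpow_sq_le {α : Type*} [MeasurableSpace α] {ν : Measure α}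
    {f g h : α → ℝ≥0∞} (hf : AEMeasurable f ν) (hg : AEMeasurable g ν) (hh : AEMeasurable h ν)
    (r : ℝ) :
    (∫⁻ x, f x * g x * h x ^ r ∂ν) ^ 2 ≤
      (∫⁻ x, g x ^ 2 ∂ν) * ∫⁻ x, f x ^ 2 * h x ^ (2 * r) ∂ν := by
  have := lintegral_mul_sq_le (F := g) (G := fun x => f x * h x ^ r) hg (hf.mul (hh.pow_const r))
  calc (∫⁻ x, f x * g x * h x ^ r ∂ν) ^ 2 = (∫⁻ x, g x * (f x * h x ^ r) ∂ν) ^ 2 := by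
        congr 1
        exact lintegral_congr fun x => by ring
    _ ≤ _ := this
    _ = _ := by
        congr 1
        refine lintegral_congr fun x => ?_
        rw [mul_pow, mul_comm 2 r, ENNReal.rpow_mul, ENNReal.rpow_two]

theorem lintegral_sq_mul_rpow_add_sq_le {α : Type*} [MeasurableSpace α] {ν : Measure α}
    {f h : α → ℝ≥0∞} (hf : AEMeasurable f ν) (hh : AEMeasurable h ν) {a b : ℝ} (ha : 0 ≤ a)
    (hb : 0 ≤ b) :
    (∫⁻ x, f x ^ 2 * h x ^ (a + b) ∂ν) ^ 2 ≤
      (∫⁻ x, f x ^ 2 * h x ^ (2 * a) ∂ν) * ∫⁻ x, f x ^ 2 * h x ^ (2 * b) ∂ν := by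
  have := lintegral_mul_sq_le (F := fun x => f x * h x ^ a) (G := fun x => f x * h x ^ b)
    (hf.mul (hh.pow_const a)) (hf.mul (hh.pow_const b))
  have e : ∀ (r : ℝ) x, (f x * h x ^ r) ^ 2 = f x ^ 2 * h x ^ (2 * r) := fun r x => by
    rw [mul_pow, mul_comm 2 r, ENNReal.rpow_mul, ENNReal.rpow_two]
  simp_rw [e] at this
  refine le_trans (le_of_eq ?_) this
  congr 1
  refine lintegral_congr fun x => ?_
  rw [ENNReal.rpow_add_of_nonneg _ _ ha hb]; ring

theorem rpow_le_add_one (c : ℝ≥0∞) {r : ℝ} (hr0 : 0 ≤ r) (hr1 : r ≤ 1) : c ^ r ≤ c + 1 :=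
  calc c ^ r ≤ (c + 1) ^ r := ENNReal.rpow_le_rpow le_self_add hr0
    _ ≤ (c + 1) ^ (1 : ℝ) := ENNReal.rpow_le_rpow_of_exponent_le le_add_self hr1
    _ = c + 1 := ENNReal.rpow_one _

theorem pow_rpow_eq (a : ℝ≥0∞) (n : ℕ) (r : ℝ) : (a ^ n) ^ r = a ^ (n * r) := by
  rw [← ENNReal.rpow_natCast, ← ENNReal.rpow_mul]

theorem le_of_sq_le_mul {I c n U₁ Φ U : ℝ≥0∞}
    (h : I ^ 2 ≤ c * n * U₁ ^ 2 * (Φ + U ^ 4)) :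
    I ≤ (c + 1) * n ^ (1 / 2 : ℝ) * U₁ * (U ^ 2 + Φ ^ (1 / 2 : ℝ)) := by
  have h1 := ENNReal.rpow_le_rpow h (by norm_num : (0 : ℝ) ≤ 1 / 2)
  simp only [ENNReal.mul_rpow_of_nonneg _ _ (by norm_num : (0 : ℝ) ≤ 1 / 2), pow_rpow_eq] at h1
  norm_num at h1
  calc I ≤ _ := h1
    _ ≤ (c + 1) * n ^ (1 / 2 : ℝ) * U₁ * (Φ ^ (1 / 2 : ℝ) + (U ^ 4) ^ (1 / 2 : ℝ)) := by
        gcongr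
        · exact rpow_le_add_one c (by norm_num) (by norm_num)
        · exact ENNReal.rpow_add_le_add_rpow _ _ (by norm_num) (by norm_num)
    _ = _ := by
        rw [pow_rpow_eq, add_comm (Φ ^ _)]
        norm_num

theorem le_of_pow_four_le_mul {I c n U₁ U₂ Φ U : ℝ≥0∞}
    (h : I ^ 4 ≤ c ^ 2 * n * U₁ ^ 4 * U₂ ^ 2 * (Φ + U ^ (10 / 3 : ℝ))) :
    I ≤ (c + 1) * n ^ (1 / 4 : ℝ) * U₁ * U₂ ^ (1 / 2 : ℝ) *
      (U ^ (5 / 6 : ℝ) + Φ ^ (1 / 4 : ℝ)) := by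
  have h1 := ENNReal.rpow_le_rpow h (by norm_num : (0 : ℝ) ≤ 1 / 4)
  simp only [ENNReal.mul_rpow_of_nonneg _ _ (by norm_num : (0 : ℝ) ≤ 1 / 4), pow_rpow_eq] at h1
  norm_num at h1
  calc I ≤ _ := h1
    _ ≤ (c + 1) * n ^ (1 / 4 : ℝ) * U₁ * U₂ ^ (1 / 2 : ℝ) *
          (Φ ^ (1 / 4 : ℝ) + (U ^ (10 / 3 : ℝ)) ^ (1 / 4 : ℝ)) := by
        gcongr
        · exact rpow_le_add_one c (by norm_num) (by norm_num)
        · exact ENNReal.rpow_add_le_add_rpow _ _ (by norm_num) (by norm_num)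
    _ = _ := by
        rw [← ENNReal.rpow_mul, add_comm (Φ ^ _)]
        norm_num

section Estimate

variable {φ : E d → ℝ} {B : E d → ℂ} {s δ : ℝ}

/-- Each packet has frequencies in a set of bounded volume, so its supremum is controlled by its
`L²` norm without any power of `N`. -/
theorem exists_sqFun_le (hφ : IsUnitCutoff d φ) (hB : StronglyMeasurable B)
    (hA : wnorm s B < ∞) : ∃ C : ℝ≥0, ∀ N : ℕ, 1 ≤ N → ∀ t x,
      sqFun φ B N t x ≤ C * (N * (N : ℝ≥0∞) ^ (-1 - 2 * s)) := by
  obtain ⟨C, hC⟩ := exists_sum_cutSq_le d s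
  set vol := volume (Metric.closedBall (0 : E d) d)
  have hvf : vol * (C * wnorm s B) < ∞ := ENNReal.mul_lt_top
    (isCompact_closedBall _ _).measure_lt_top (ENNReal.mul_lt_top ENNReal.coe_lt_top hA)
  refine ⟨(vol * (C * wnorm s B)).toNNReal, fun N hN t x => ?_⟩
  rw [ENNReal.coe_toNNReal hvf.ne]
  calc sqFun φ B N t x ≤ ∑ k ∈ shell d N, vol * cutSq φ B k :=
        Finset.sum_le_sum fun k _ => enorm_piece_sq_le hφ hB t x
    _ = vol * ∑ k ∈ shell d N, cutSq φ B k := by rw [Finset.mul_sum]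
    _ ≤ vol * (C * wnorm s B * (N * (N : ℝ≥0∞) ^ (-1 - 2 * s))) := by
        gcongr
        exact sum_cutSq_le_of_le hN (hC φ hφ B hB N hN)
    _ = _ := by ring

theorem rpow_quarter_mul {N : ℕ} (hN : 1 ≤ N) (s : ℝ) :
    (N : ℝ≥0∞) ^ (1 / 4 : ℝ) * (N * (N : ℝ≥0∞) ^ (-1 - 2 * s)) =
      (N : ℝ≥0∞) ^ (1 / 4 - 2 * s) := by
  have h0 : (N : ℝ≥0∞) ≠ 0 := by exact_mod_cast (by omega : N ≠ 0)
  have ht : (N : ℝ≥0∞) ≠ ∞ := ENNReal.natCast_ne_top N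
  nth_rewrite 2 [← ENNReal.rpow_one (N : ℝ≥0∞)]
  rw [← ENNReal.rpow_add _ _ h0 ht, ← ENNReal.rpow_add _ _ h0 ht]
  ring_nf

/-- The remainder `N^{-1-2s}` of the pointwise bound is paid for by integration in time: over the
cone it gains a factor `N` and is then of the size `N^{-2s}` of the main term. For the power `2` of
`u` there is no flux, and the uniform bound of the square function is used instead. -/
theorem exists_weighted_bounds (hd : 2 < d) (hφ : IsUnitCutoff d φ) (hB : StronglyMeasurable B)
    (hA : wnorm s B < ∞) (hδ : 0 < δ) (K : ℝ≥0) : ∃ C : ℝ≥0, ∀ N : ℕ, 1 ≤ N →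
    ∀ (t₀ : ℝ) (x₀ : E d) (σ : ℝ), |σ| = 1 → ∀ F : ℝ × E d → ℂ,
    (∀ p ∈ cone N t₀ x₀, ‖F p‖ₑ ^ 2 ≤ K * (N : ℝ≥0∞) ^ (1 / 4 : ℝ) *
      (sqFun φ B N (σ * p.1) p.2 + (N : ℝ≥0∞) ^ (-1 - 2 * s))) →
    ∀ u : ℝ × E d → ℝ, AEMeasurable u →
      (∫⁻ p in cone N t₀ x₀, ‖F p‖ₑ ^ 2 * ‖u p‖ₑ ^ (2 : ℝ) ≤
        C * (N : ℝ≥0∞) ^ (1 / 4 - 2 * s) * (N * normLinfLq 2 (cone N t₀ x₀) u ^ 2)) ∧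
      (∫⁻ p in cone N t₀ x₀, ‖F p‖ₑ ^ 2 * ‖u p‖ₑ ^ (2 * d / (d - 2) : ℝ) ≤
        C * (N : ℝ≥0∞) ^ (1 / 4 - 2 * s) * (flux δ N t₀ x₀ u +
          normLinfLq (ENNReal.ofReal (2 * d / (d - 2))) (cone N t₀ x₀) u ^
            (2 * d / (d - 2) : ℝ))) := by
  obtain ⟨C₁, hC₁⟩ := exists_sqFun_le hφ hB hA
  obtain ⟨C₂, hC₂⟩ := exists_cone_estimate hd s hδ
  have hd' : (2 : ℝ) < d := by exact_mod_cast hd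
  refine ⟨K * (C₁ + 1) + K * (C₂ * (wnorm s B).toNNReal + 1),
    fun N hN t₀ x₀ σ hσ F hF u hu => ?_⟩
  set Kc := cone N t₀ x₀ with hKc
  have hKm : MeasurableSet Kc := (isClosed_cone N t₀ x₀).measurableSet
  have hN1 : (1 : ℝ≥0∞) ≤ N := by exact_mod_cast hN
  set e := (N : ℝ≥0∞) ^ (-1 - 2 * s) with he
  have heN : e ≤ N * e := le_mul_of_one_le_left zero_le hN1
  have hν := rpow_quarter_mul hN s
  rw [← hν]
  have hνt : (N : ℝ≥0∞) ^ (1 / 4 : ℝ) ≠ ∞ :=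
    ENNReal.rpow_ne_top_of_nonneg (by norm_num) (ENNReal.natCast_ne_top N)
  set ν := (N : ℝ≥0∞) ^ (1 / 4 : ℝ)
  push_cast
  rw [ENNReal.coe_toNNReal hA.ne]
  constructor
  · have h2 := lintegral_cone_rpow_le N t₀ x₀ hu (p := 2) (by norm_num) (by norm_num)
    simp only [ENNReal.toReal_ofNat] at h2
    rw [ENNReal.rpow_two] at h2
    calc _ ≤ ∫⁻ p in Kc, K * ν * ((C₁ + 1) * (N * e)) * ‖u p‖ₑ ^ (2 : ℝ) := by
          refine setLIntegral_mono' hKm fun p hp => ?_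
          gcongr
          refine (hF p hp).trans ?_
          gcongr
          rw [add_mul, one_mul]
          exact add_le_add (hC₁ N hN _ _) heN
      _ = K * ν * ((C₁ + 1) * (N * e)) * ∫⁻ p in Kc, ‖u p‖ₑ ^ (2 : ℝ) :=
          lintegral_const_mul'' _ (hu.enorm.pow_const _).restrict
      _ ≤ K * ν * ((C₁ + 1) * (N * e)) * (N * normLinfLq 2 Kc u ^ 2) := by gcongr
      _ = K * (C₁ + 1) * (ν * (N * e)) * (N * normLinfLq 2 Kc u ^ 2) := by ring
      _ ≤ _ := by
          gcongr
          exact le_self_add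
  · set q : ℝ := 2 * d / (d - 2) with hq
    have hq0 : 0 < q := div_pos (by linarith) (by linarith)
    have h2 := lintegral_cone_rpow_le N t₀ x₀ hu (p := ENNReal.ofReal q) (by simpa using hq0)
      ENNReal.ofReal_ne_top
    rw [ENNReal.toReal_ofReal hq0.le] at h2
    set U := normLinfLq (ENNReal.ofReal q) Kc u ^ q with hU
    have h3 := hC₂ φ hφ B hB hA N hN t₀ x₀ σ hσ u hu
    calc _ ≤ ∫⁻ p in Kc, K * ν * (sqFun φ B N (σ * p.1) p.2 * ‖u p‖ₑ ^ q + e * ‖u p‖ₑ ^ q) := by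
          refine setLIntegral_mono' hKm fun p hp => ?_
          rw [← add_mul, ← mul_assoc]
          gcongr
          exact hF p hp
      _ = K * ν * ((∫⁻ p in Kc, sqFun φ B N (σ * p.1) p.2 * ‖u p‖ₑ ^ q) +
            e * ∫⁻ p in Kc, ‖u p‖ₑ ^ q) := by
          have hum := (hu.enorm.pow_const q).restrict (s := Kc)
          rw [lintegral_const_mul' _ _ (ENNReal.mul_ne_top ENNReal.coe_ne_top hνt),
            lintegral_add_right' _ (hum.const_mul e), lintegral_const_mul'' _ hum]
      _ ≤ K * ν * (C₂ * wnorm s B * (N * e) * (flux δ N t₀ x₀ u + U) +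
            e * (N * (flux δ N t₀ x₀ u + U))) := by
          gcongr
          refine h2.trans ?_
          gcongr
          exact le_add_self
      _ = K * (C₂ * wnorm s B + 1) * (ν * (N * e)) * (flux δ N t₀ x₀ u + U) := by ring
      _ ≤ _ := by
          gcongr
          exact le_add_self

/-- Each `|F|²` contributes `N^{1/4-2s}` and each energy norm integrated over the cone a factor `N`.
For `d = 4` the square of the integral carries `N^{5/4-2s}`, for `d = 5` its fourth power carries
`N^{7/2-4s}`. The roots `5/8 - s` and `7/8 - s` do not exceed `(d + 2)/8 - s`, so `2dδ` is spare
room, and the loss `N^{1/4}` fits exactly when `d = 5`. -/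
theorem exists_wave_estimate (hd : d = 4 ∨ d = 5) (hφ : IsUnitCutoff d φ)
    (hB : StronglyMeasurable B) (hA : wnorm s B < ∞) (hδ : 0 < δ) (K : ℝ≥0) : ∃ C : ℝ≥0,
    ∀ N : ℕ, 1 ≤ N → ∀ (t₀ : ℝ) (x₀ : E d) (σ : ℝ), |σ| = 1 → ∀ F : ℝ × E d → ℂ, Measurable F →
    (∀ p ∈ cone N t₀ x₀, ‖F p‖ₑ ^ 2 ≤ K * (N : ℝ≥0∞) ^ (1 / 4 : ℝ) *
      (sqFun φ B N (σ * p.1) p.2 + (N : ℝ≥0∞) ^ (-1 - 2 * s))) →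
    ∀ u₁ u₂ : ℝ × E d → ℝ, AEMeasurable u₁ → AEMeasurable u₂ →
      ∫⁻ p in cone N t₀ x₀, ‖F p‖ₑ * ‖u₁ p‖ₑ * ‖u₂ p‖ₑ ^ (4 / (d - 2) : ℝ) ≤
        C * (N : ℝ≥0∞) ^ (-s + (d + 2) / 8 + 2 * d * δ : ℝ) *
          normLinfLq 2 (cone N t₀ x₀) u₁ *
          normLinfLq 2 (cone N t₀ x₀) u₂ ^ ((d - 4) / 2 : ℝ) *
          (normLinfLq (ENNReal.ofReal (2 * d / (d - 2)))
              (cone N t₀ x₀) u₂ ^ (d * (6 - d) / (2 * (d - 2)) : ℝ) +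
            flux δ N t₀ x₀ u₂ ^ ((6 - d) / 4 : ℝ)) := by
  obtain ⟨C, hC⟩ := exists_weighted_bounds (by omega) hφ hB hA hδ K
  refine ⟨C + 1, fun N hN t₀ x₀ σ hσ F hFm hF u₁ u₂ hu₁ hu₂ => ?_⟩
  obtain ⟨hH, hG⟩ := hC N hN t₀ x₀ σ hσ F hF u₂ hu₂
  have h1 := lintegral_cone_rpow_le N t₀ x₀ hu₁ (p := 2) (by norm_num) (by norm_num)
  simp only [ENNReal.toReal_ofNat, ENNReal.rpow_two] at h1
  have h0 : (N : ℝ≥0∞) ≠ 0 := by exact_mod_cast (by omega : N ≠ 0)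
  have ht : (N : ℝ≥0∞) ≠ ∞ := ENNReal.natCast_ne_top N
  have hN1 : (1 : ℝ≥0∞) ≤ N := by exact_mod_cast hN
  set Kc := cone N t₀ x₀ with hKc
  have hfm : AEMeasurable (fun p => ‖F p‖ₑ) (volume.restrict Kc) := hFm.enorm.aemeasurable
  have hum₁ : AEMeasurable (fun p => ‖u₁ p‖ₑ) (volume.restrict Kc) := hu₁.enorm.restrict
  have hum₂ : AEMeasurable (fun p => ‖u₂ p‖ₑ) (volume.restrict Kc) := hu₂.enorm.restrict
  set U₁ := normLinfLq 2 Kc u₁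
  set U₂ := normLinfLq 2 Kc u₂
  rcases hd with rfl | rfl
  · norm_num at hH hG ⊢
    set Φ := flux δ N t₀ x₀ u₂
    set U := normLinfLq 4 Kc u₂
    have h2 := lintegral_mul_mul_rpow_sq_le hfm hum₁ hum₂ 2
    norm_num at h2
    set I := ∫⁻ p in Kc, ‖F p‖ₑ * ‖u₁ p‖ₑ * ‖u₂ p‖ₑ ^ 2
    have h3 : I ^ 2 ≤ C * (N : ℝ≥0∞) ^ (5 / 4 - 2 * s) * U₁ ^ 2 * (Φ + U ^ 4) := by
      refine h2.trans ((mul_le_mul' h1 hG).trans (le_of_eq ?_))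
      have : (N : ℝ≥0∞) ^ (5 / 4 - 2 * s) = N * (N : ℝ≥0∞) ^ (1 / 4 - 2 * s) := by
        nth_rewrite 2 [← ENNReal.rpow_one (N : ℝ≥0∞)]
        rw [← ENNReal.rpow_add _ _ h0 ht]; ring_nf
      rw [this]; ring
    refine (le_of_sq_le_mul h3).trans ?_
    gcongr
    rw [← ENNReal.rpow_mul]
    exact ENNReal.rpow_le_rpow_of_exponent_le hN1 (by linarith)
  · norm_num at hH hG ⊢
    have h2 := lintegral_mul_mul_rpow_sq_le hfm hum₁ hum₂ (4 / 3)
    have h4 := lintegral_sq_mul_rpow_add_sq_le hfm hum₂ (a := 1) (b := 5 / 3) (by norm_num)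
      (by norm_num)
    norm_num at h2 h4
    set Φ := flux δ N t₀ x₀ u₂
    set U := normLinfLq (ENNReal.ofReal (10 / 3)) Kc u₂
    set I := ∫⁻ p in Kc, ‖F p‖ₑ * ‖u₁ p‖ₑ * ‖u₂ p‖ₑ ^ (4 / 3 : ℝ)
    have h3 : I ^ 4 ≤ (C : ℝ≥0∞) ^ 2 * (N : ℝ≥0∞) ^ (7 / 2 - 4 * s) * U₁ ^ 4 * U₂ ^ 2 *
        (Φ + U ^ (10 / 3 : ℝ)) := by
      have e1 : (N : ℝ≥0∞) ^ (7 / 2 - 4 * s) =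
          (N : ℝ≥0∞) ^ 3 * ((N : ℝ≥0∞) ^ (1 / 4 - 2 * s)) ^ 2 := by
        rw [← ENNReal.rpow_natCast, ← ENNReal.rpow_natCast, ← ENNReal.rpow_mul,
          ← ENNReal.rpow_add _ _ h0 ht]
        push_cast
        ring_nf
      calc I ^ 4 = (I ^ 2) ^ 2 := by ring
        _ ≤ ((∫⁻ x in Kc, ‖u₁ x‖ₑ ^ 2) *
              ∫⁻ x in Kc, ‖F x‖ₑ ^ 2 * ‖u₂ x‖ₑ ^ (8 / 3 : ℝ)) ^ 2 := by gcongr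
        _ = (∫⁻ x in Kc, ‖u₁ x‖ₑ ^ 2) ^ 2 *
              (∫⁻ x in Kc, ‖F x‖ₑ ^ 2 * ‖u₂ x‖ₑ ^ (8 / 3 : ℝ)) ^ 2 := mul_pow _ _ _
        _ ≤ (N * U₁ ^ 2) ^ 2 * ((C * (N : ℝ≥0∞) ^ (1 / 4 - 2 * s) * (N * U₂ ^ 2)) *
              (C * (N : ℝ≥0∞) ^ (1 / 4 - 2 * s) * (Φ + U ^ (10 / 3 : ℝ)))) := by
            refine mul_le_mul' (pow_le_pow_left₀ zero_le h1 2) (h4.trans (mul_le_mul' hH hG))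
        _ = _ := by rw [e1]; ring
    refine (le_of_pow_four_le_mul h3).trans ?_
    gcongr
    rw [← ENNReal.rpow_mul]
    exact ENNReal.rpow_le_rpow_of_exponent_le hN1 (by linarith)

end Estimate

/-! ### The wave as a tempered distribution -/

/-- Evaluating `smulLeftCLM` as a multiplication requires symbols of temperate growth. Here each
derivative is a power of `I` times the function itself. -/
theorem hasTemperateGrowth_cexp_mul_I :
    Function.HasTemperateGrowth fun x : ℝ => Complex.exp (x * Complex.I) := by
  refine ⟨(Complex.ofRealCLM.contDiff.mul contDiff_const).cexp, fun n => ⟨0, 1, fun x => ?_⟩⟩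
  have h : iteratedDeriv n (fun x : ℝ => Complex.exp (x * Complex.I)) =
      fun x : ℝ => Complex.I ^ n * Complex.exp (x * Complex.I) := by
    induction n with
    | zero => simp
    | succ n ih =>
      rw [iteratedDeriv_succ, ih]
      funext x
      have h1 : HasDerivAt (fun x : ℝ => (x : ℂ) * Complex.I) Complex.I x := by
        simpa using (Complex.ofRealCLM.hasDerivAt (x := x)).mul_const Complex.I
      rw [(h1.cexp.const_mul (Complex.I ^ n)).deriv]
      ring
  rw [norm_iteratedFDeriv_eq_norm_iteratedDeriv, h]
  simp [Complex.norm_exp_ofReal_mul_I]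

theorem jb_eq_rpow (ξ : E d) : jb ξ = (1 + ‖ξ‖ ^ 2) ^ (1 / 2 : ℝ) := by
  rw [jb, Real.sqrt_eq_rpow]

theorem hasTemperateGrowth_smul_two_pi :
    Function.HasTemperateGrowth fun ξ : E d => (2 * Real.pi) • ξ :=
  ((2 * Real.pi) • ContinuousLinearMap.id ℝ (E d)).hasTemperateGrowth

theorem hasTemperateGrowth_halfWave_phase (a : ℝ) : Function.HasTemperateGrowth fun ξ : E d =>
    Complex.exp (a * jb ((2 * Real.pi) • ξ) * Complex.I) := by
  have h1 : Function.HasTemperateGrowth fun ξ : E d => a * jb ((2 * Real.pi) • ξ) := by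
    simp_rw [jb_eq_rpow]
    exact (Function.HasTemperateGrowth.const a).mul
      ((Function.hasTemperateGrowth_one_add_norm_sq_rpow (E d) (1 / 2)).comp
        hasTemperateGrowth_smul_two_pi)
  have := hasTemperateGrowth_cexp_mul_I.comp h1
  simpa [Function.comp_def] using this

theorem hasTemperateGrowth_inv_jb : Function.HasTemperateGrowth fun ξ : E d =>
    ((jb ((2 * Real.pi) • ξ))⁻¹ : ℂ) := by
  have h1 : Function.HasTemperateGrowth fun ξ : E d => (jb ((2 * Real.pi) • ξ))⁻¹ := by
    simp_rw [jb_eq_rpow, ← Real.rpow_neg (by positivity : 0 ≤ 1 + ‖(2 * Real.pi) • _‖ ^ 2)]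
    exact (Function.hasTemperateGrowth_one_add_norm_sq_rpow (E d) (-(1 / 2))).comp
      hasTemperateGrowth_smul_two_pi
  have := Function.Complex.hasTemperateGrowth_ofReal.comp h1
  simpa [Function.comp_def] using this

section Cutoff

variable {φ : E d → ℝ}

theorem IsUnitCutoff.hasCompactSupport (hφ : IsUnitCutoff d φ) : HasCompactSupport φ := by
  refine HasCompactSupport.intro (isCompact_closedBall (0 : E d) (d * 1)) fun x hx => ?_
  refine hφ.eq_zero x ?_
  by_contra h
  push Not at h
  exact hx (mem_closedBall_zero_iff.2 (norm_le_card_mul zero_le_one h))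

/-- The cut-off `φ` as a complex valued Schwartz function. -/
def IsUnitCutoff.schwartz (hφ : IsUnitCutoff d φ) : 𝓢(E d, ℂ) :=
  HasCompactSupport.toSchwartzMap (f := fun x => (φ x : ℂ))
    (hφ.hasCompactSupport.comp_left Complex.ofReal_zero)
    (Complex.ofRealCLM.contDiff.comp hφ.smooth)

theorem IsUnitCutoff.hasTemperateGrowth (hφ : IsUnitCutoff d φ) (k : Fin d → ℤ) :
    Function.HasTemperateGrowth fun ξ : E d => (φ ((2 * Real.pi) • ξ - latt k) : ℂ) := by
  have h := hφ.schwartz.hasTemperateGrowth.comp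
    ((hasTemperateGrowth_smul_two_pi (d := d)).sub (Function.HasTemperateGrowth.const (latt k)))
  exact h

/-- All multipliers and cut-offs are transposed onto the test function and the inner `𝓕⁻ 𝓕` cancels.
This leaves `f` and `g` tested on `φ_l 𝓕 Θ`, the form in which their randomized sums are known. -/
theorem halfWave_apply (f g : 𝓢'(E d, ℂ)) (ε : ℤˣ) (k l : Fin d → ℤ) (t : ℝ) (ψ : 𝓢(E d, ℂ)) :
    halfWave φ f g ε k l t ψ =
      (1 / 2 : ℂ) * (f (SchwartzMap.smulLeftCLM ℂ (fun x => (φ (x - latt l) : ℂ))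
        (𝓕 (SchwartzMap.smulLeftCLM ℂ (fun ξ => (φ ((2 * Real.pi) • ξ - latt k) : ℂ))
          (SchwartzMap.smulLeftCLM ℂ (fun ξ => Complex.exp (((ε : ℤ) : ℂ) * Complex.I * t *
            jb ((2 * Real.pi) • ξ))) (𝓕⁻ ψ))))) -
        (((ε : ℤ) : ℂ) * Complex.I) * g (SchwartzMap.smulLeftCLM ℂ (fun x => (φ (x - latt l) : ℂ))
        (𝓕 (SchwartzMap.smulLeftCLM ℂ (fun ξ => (φ ((2 * Real.pi) • ξ - latt k) : ℂ))
          (SchwartzMap.smulLeftCLM ℂ (fun ξ => ((jb ((2 * Real.pi) • ξ))⁻¹ : ℂ))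
          (SchwartzMap.smulLeftCLM ℂ (fun ξ => Complex.exp (((ε : ℤ) : ℂ) * Complex.I * t *
            jb ((2 * Real.pi) • ξ))) (𝓕⁻ ψ))))))) := by
  have h1 : ∀ (m : E d → ℂ) (u : 𝓢'(E d, ℂ)) (ψ : 𝓢(E d, ℂ)), fmult m u ψ =
      u (𝓕 (SchwartzMap.smulLeftCLM ℂ (fun ξ => m ((2 * Real.pi) • ξ)) (𝓕⁻ ψ))) :=
    fun m u ψ => rfl
  have h2 : ∀ (c : ℂ) (u : 𝓢'(E d, ℂ)) (ψ : 𝓢(E d, ℂ)), (c • u) ψ = c * u ψ := fun _ _ _ => rfl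
  have h3 : ∀ (u v : 𝓢'(E d, ℂ)) (ψ : 𝓢(E d, ℂ)), (u - v) ψ = u ψ - v ψ := fun _ _ _ => rfl
  unfold halfWave block
  simp only [h1, h2, h3, smulLeftCLM_apply_apply, FourierTransform.fourierInv_fourier_eq]

end Cutoff

/-! ### Combining the two initial data into one amplitude. -/

section Amplitude

/-- The amplitude `b_f - i ε ⟨·⟩⁻¹ b_g` of the half-wave with sign `ε`. -/
def amplitude (ε : ℤˣ) (b c : E d → ℂ) (ξ : E d) : ℂ :=
  b ξ - ((ε : ℤ) : ℂ) * Complex.I * ((jb ((2 * Real.pi) • ξ))⁻¹ : ℂ) * c ξ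

variable {b c : E d → ℂ} {s : ℝ}

theorem stronglyMeasurable_amplitude (ε : ℤˣ) (hb : StronglyMeasurable b)
    (hc : StronglyMeasurable c) : StronglyMeasurable (amplitude ε b c) := by
  have h : Continuous fun ξ : E d => ((jb ((2 * Real.pi) • ξ))⁻¹ : ℂ) :=
    Continuous.inv₀ (by fun_prop) fun ξ => by exact_mod_cast (jb_pos _).ne'
  exact hb.sub ((Continuous.stronglyMeasurable (by fun_prop)).mul hc)

theorem norm_unit_mul_I (ε : ℤˣ) : ‖((ε : ℤ) : ℂ) * Complex.I‖ = 1 := by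
  rcases Int.units_eq_one_or ε with rfl | rfl <;> simp

/-- The factor `⟨2πξ⟩^{-1} ≤ (1 + ‖ξ‖²)^{-1/2}` supplies the derivative by which the second datum is
rougher. -/
theorem wnorm_amplitude_lt_top (ε : ℤˣ) (hb : StronglyMeasurable b)
    (hbf : wnorm s b < ∞) (hcf : wnorm (s - 1) c < ∞) : wnorm s (amplitude ε b c) < ∞ := by
  have hbm : Measurable fun ξ : E d => ENNReal.ofReal ((1 + ‖ξ‖ ^ 2) ^ s) * ‖b ξ‖ₑ ^ 2 := by
    have := hb.measurable
    fun_prop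
  have hpt : ∀ ξ : E d, ENNReal.ofReal ((1 + ‖ξ‖ ^ 2) ^ s) * ‖amplitude ε b c ξ‖ₑ ^ 2 ≤
      2 * (ENNReal.ofReal ((1 + ‖ξ‖ ^ 2) ^ s) * ‖b ξ‖ₑ ^ 2 +
        ENNReal.ofReal ((1 + ‖ξ‖ ^ 2) ^ (s - 1)) * ‖c ξ‖ₑ ^ 2) := by
    intro ξ
    have h1 : ‖amplitude ε b c ξ‖ₑ ^ 2 ≤ 2 * (‖b ξ‖ₑ ^ 2 +
        ENNReal.ofReal ((1 + ‖ξ‖ ^ 2) ^ (-1 : ℝ)) * ‖c ξ‖ₑ ^ 2) := by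
      rw [amplitude, sub_eq_add_neg]
      refine (enorm_add_sq_le _ _).trans ?_
      gcongr
      rw [enorm_neg, enorm_mul, mul_pow]
      gcongr
      rw [← ofReal_norm, norm_mul, norm_unit_mul_I, one_mul, norm_inv, Complex.norm_real,
        Real.norm_eq_abs, abs_of_pos (jb_pos _), ← ENNReal.ofReal_pow (inv_nonneg.2 (jb_pos _).le),
        inv_pow, jb_sq, Real.rpow_neg_one]
      refine ENNReal.ofReal_le_ofReal (inv_anti₀ (by positivity) ?_)
      rw [norm_smul, Real.norm_eq_abs, abs_of_pos (by positivity : 0 < 2 * Real.pi)]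
      have : ‖ξ‖ ≤ 2 * Real.pi * ‖ξ‖ :=
        le_mul_of_one_le_left (norm_nonneg _) (by nlinarith [Real.pi_gt_three])
      gcongr
    calc _ ≤ ENNReal.ofReal ((1 + ‖ξ‖ ^ 2) ^ s) * (2 * (‖b ξ‖ₑ ^ 2 +
        ENNReal.ofReal ((1 + ‖ξ‖ ^ 2) ^ (-1 : ℝ)) * ‖c ξ‖ₑ ^ 2)) := by gcongr
      _ = _ := by
        rw [sub_eq_add_neg, Real.rpow_add (by positivity), ENNReal.ofReal_mul (by positivity)]
        ring
  refine lt_of_le_of_lt (lintegral_mono hpt) ?_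
  rw [lintegral_const_mul' _ _ (by norm_num), lintegral_add_left hbm]
  exact ENNReal.mul_lt_top (by norm_num) (ENNReal.add_lt_top.2 ⟨hbf, hcf⟩)

end Amplitude

/-! ### Identification of the distributional series with a continuous function. -/

section Representation

variable {φ : E d → ℝ} {B b c : E d → ℂ} {s : ℝ} {k : Fin d → ℤ}

theorem integral_piece_mul (hφ : IsUnitCutoff d φ) (hB : StronglyMeasurable B)
    (hfin : cutSq φ B k < ∞) (t : ℝ) (ψ : 𝓢(E d, ℂ)) :
    ∫ z, piece φ B k t z * ψ z = ∫ ξ, cut φ B k ξ *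
      (Complex.exp (t * jb ((2 * Real.pi) • ξ) * Complex.I) * (𝓕⁻ ψ) ξ) := by
  have hG := integrable_packet hφ hB hfin t
  set G : E d → ℂ := fun ξ => cut φ B k ξ *
    Complex.exp (t * jb ((2 * Real.pi) • ξ) * Complex.I) with hGdef
  have h_int : Integrable (fun q : E d × E d => G q.2 * ech q.1 q.2 * ψ q.1)
      (volume.prod volume) := by
    have h1 := (ψ.integrable (μ := volume)).mul_prod hG
    refine h1.mono ?_ (.of_forall fun q => by simp [mul_comm])
    exact ((hG.aestronglyMeasurable.comp_snd).mul
      (Continuous.aestronglyMeasurable (by fun_prop))).mul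
        (ψ.continuous.comp continuous_fst).aestronglyMeasurable
  calc ∫ z, piece φ B k t z * ψ z = ∫ z, ∫ ξ, G ξ * ech z ξ * ψ z := by
        refine integral_congr_ae (.of_forall fun z => ?_)
        simp only [piece_eq_packet]
        rw [integral_mul_const]
    _ = ∫ ξ, ∫ z, G ξ * ech z ξ * ψ z := integral_integral_swap h_int
    _ = _ := by
        refine integral_congr_ae (.of_forall fun ξ => ?_)
        simp only
        rw [SchwartzMap.fourierInv_coe, fourierInv_eq_ech, ← mul_assoc, ← integral_const_mul]
        refine integral_congr_ae (.of_forall fun z => ?_)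
        simp only [hGdef]
        rw [ech_comm z ξ]; ring

theorem integrable_cut_mul (hφ : IsUnitCutoff d φ) (hB : StronglyMeasurable B)
    (hfin : cutSq φ B k < ∞) (t : ℝ) (ψ : 𝓢(E d, ℂ)) : Integrable fun ξ => cut φ B k ξ *
      (Complex.exp (t * jb ((2 * Real.pi) • ξ) * Complex.I) * ψ ξ) := by
  obtain ⟨C, -, hC⟩ := exists_decay ψ 0
  simp_rw [← mul_assoc]
  exact (integrable_packet hφ hB hfin t).mul_bdd ψ.continuous.aestronglyMeasurable
    (.of_forall fun ξ => by simpa using hC ξ)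

/-- The two expansions are applied to the test functions produced by `halfWave_apply`; the factor
`⟨·⟩⁻¹` is shifted from the test function onto the amplitude. -/
theorem hasSum_halfWave (hφ : IsUnitCutoff d φ) {f g : 𝓢'(E d, ℂ)} {y : (Fin d → ℤ) → ℝ}
    (hb : StronglyMeasurable b) (hc : StronglyMeasurable c) (hbf : cutSq φ b k < ∞)
    (hcf : cutSq φ c k < ∞)
    (hbs : ∀ Θ : 𝓢(E d, ℂ), HasSum (fun l : Fin d → ℤ => (y l : ℂ) *
      f (SchwartzMap.smulLeftCLM ℂ (fun x => (φ (x - latt l) : ℂ)) (𝓕 Θ))) (∫ ξ, b ξ * Θ ξ))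
    (hcs : ∀ Θ : 𝓢(E d, ℂ), HasSum (fun l : Fin d → ℤ => (y l : ℂ) *
      g (SchwartzMap.smulLeftCLM ℂ (fun x => (φ (x - latt l) : ℂ)) (𝓕 Θ))) (∫ ξ, c ξ * Θ ξ))
    (ε : ℤˣ) (t : ℝ) (ψ : 𝓢(E d, ℂ)) :
    HasSum (fun l : Fin d → ℤ => (y l : ℂ) * halfWave φ f g ε k l t ψ)
      ((1 / 2 : ℂ) * ∫ ξ, cut φ (amplitude ε b c) k ξ *
        (Complex.exp ((((ε : ℤ) : ℝ) * t : ℝ) * jb ((2 * Real.pi) • ξ) * Complex.I) *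
          (𝓕⁻ ψ) ξ)) := by
  set a : ℝ := ((ε : ℤ) : ℝ) * t with ha
  have hexp : (fun ξ : E d => Complex.exp (((ε : ℤ) : ℂ) * Complex.I * t *
      jb ((2 * Real.pi) • ξ))) =
      fun ξ => Complex.exp (a * jb ((2 * Real.pi) • ξ) * Complex.I) := by
    funext ξ
    congr 1
    rw [ha]; push_cast; ring
  set w : 𝓢(E d, ℂ) := 𝓕⁻ ψ with hw
  set J : 𝓢(E d, ℂ) := SchwartzMap.smulLeftCLM ℂ
    (fun ξ => ((jb ((2 * Real.pi) • ξ))⁻¹ : ℂ)) w with hJ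
  have hJa : ∀ ξ, J ξ = ((jb ((2 * Real.pi) • ξ))⁻¹ : ℂ) * w ξ := fun ξ => by
    rw [hJ, SchwartzMap.smulLeftCLM_apply_apply hasTemperateGrowth_inv_jb, smul_eq_mul]
  set Θ : 𝓢(E d, ℂ) := SchwartzMap.smulLeftCLM ℂ
    (fun ξ => (φ ((2 * Real.pi) • ξ - latt k) : ℂ)) (SchwartzMap.smulLeftCLM ℂ
      (fun ξ => Complex.exp (a * jb ((2 * Real.pi) • ξ) * Complex.I)) w) with hΘ
  set Θ' : 𝓢(E d, ℂ) := SchwartzMap.smulLeftCLM ℂ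
    (fun ξ => (φ ((2 * Real.pi) • ξ - latt k) : ℂ)) (SchwartzMap.smulLeftCLM ℂ
      (fun ξ => ((jb ((2 * Real.pi) • ξ))⁻¹ : ℂ)) (SchwartzMap.smulLeftCLM ℂ
      (fun ξ => Complex.exp (a * jb ((2 * Real.pi) • ξ) * Complex.I)) w)) with hΘ'
  have hΘa : ∀ ξ, b ξ * Θ ξ = cut φ b k ξ *
      (Complex.exp (a * jb ((2 * Real.pi) • ξ) * Complex.I) * w ξ) := fun ξ => by
    rw [hΘ, SchwartzMap.smulLeftCLM_apply_apply (hφ.hasTemperateGrowth k),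
      SchwartzMap.smulLeftCLM_apply_apply (hasTemperateGrowth_halfWave_phase a), cut]
    simp only [smul_eq_mul]; ring
  have hΘ'a : ∀ ξ, c ξ * Θ' ξ = cut φ c k ξ *
      (Complex.exp (a * jb ((2 * Real.pi) • ξ) * Complex.I) * J ξ) := fun ξ => by
    rw [hΘ', SchwartzMap.smulLeftCLM_apply_apply (hφ.hasTemperateGrowth k),
      SchwartzMap.smulLeftCLM_apply_apply hasTemperateGrowth_inv_jb,
      SchwartzMap.smulLeftCLM_apply_apply (hasTemperateGrowth_halfWave_phase a), cut, hJa]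
    simp only [smul_eq_mul]; ring
  have hsum := (((hbs Θ).sub ((hcs Θ').mul_left (((ε : ℤ) : ℂ) * Complex.I))).mul_left
    (1 / 2 : ℂ))
  have hval : (1 / 2 : ℂ) * ((∫ ξ, b ξ * Θ ξ) - ((ε : ℤ) : ℂ) * Complex.I * ∫ ξ, c ξ * Θ' ξ) =
      (1 / 2 : ℂ) * ∫ ξ, cut φ (amplitude ε b c) k ξ *
        (Complex.exp (a * jb ((2 * Real.pi) • ξ) * Complex.I) * w ξ) := by
    congr 1
    simp_rw [hΘa, hΘ'a]
    rw [← integral_const_mul, ← integral_sub (integrable_cut_mul hφ hb hbf a w)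
      ((integrable_cut_mul hφ hc hcf a J).const_mul _)]
    refine integral_congr_ae (.of_forall fun ξ => ?_)
    simp only [hJa, cut, amplitude]
    ring
  rw [hval] at hsum
  refine hsum.congr_fun fun l => ?_
  rw [halfWave_apply, hexp]
  ring

theorem integrable_piece_mul (hφ : IsUnitCutoff d φ) (hB : StronglyMeasurable B)
    (hfin : cutSq φ B k < ∞) (t : ℝ) (ψ : 𝓢(E d, ℂ)) :
    Integrable fun z => piece φ B k t z * ψ z := by
  refine (ψ.integrable (μ := volume)).bdd_mul (c := ∫ ξ, ‖cut φ B k ξ‖)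
    (continuous_piece_right hφ hB hfin t).aestronglyMeasurable (.of_forall fun z => ?_)
  refine (norm_integral_le_integral_norm _).trans (le_of_eq ?_)
  simp [norm_cexp_real_mul_real_mul_I]

/-- At each time the candidate is bounded and continuous, hence a tempered distribution. Convergence
is pointwise on Schwartz functions, and since the shell is finite it reduces to `hasSum_halfWave`
for single `k`. -/
theorem isShellWave_of_hasSum (hφ : IsUnitCutoff d φ) {f g : 𝓢'(E d, ℂ)}
    {x y : (Fin d → ℤ) → ℝ} (hb : StronglyMeasurable b) (hc : StronglyMeasurable c)
    (hbf : wnorm s b < ∞) (hcf : wnorm (s - 1) c < ∞)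
    (hbs : ∀ Θ : 𝓢(E d, ℂ), HasSum (fun l : Fin d → ℤ => (y l : ℂ) *
      f (SchwartzMap.smulLeftCLM ℂ (fun x => (φ (x - latt l) : ℂ)) (𝓕 Θ))) (∫ ξ, b ξ * Θ ξ))
    (hcs : ∀ Θ : 𝓢(E d, ℂ), HasSum (fun l : Fin d → ℤ => (y l : ℂ) *
      g (SchwartzMap.smulLeftCLM ℂ (fun x => (φ (x - latt l) : ℂ)) (𝓕 Θ))) (∫ ξ, c ξ * Θ ξ))
    (ε : ℤˣ) {N : ℕ} (hN : 1 ≤ N) :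
    IsShellWave φ f g x y ε N fun p =>
      (1 / 2 : ℂ) * shellSum φ (amplitude ε b c) x N (((ε : ℤ) : ℝ) * p.1) p.2 := by
  have hBm := stronglyMeasurable_amplitude ε hb hc
  have hBf := wnorm_amplitude_lt_top ε hb hbf hcf
  have hfin : ∀ k ∈ shell d N, cutSq φ (amplitude ε b c) k < ∞ := fun k hk =>
    cutSq_lt_top hφ hBm hBf hN hk
  set B := amplitude ε b c with hBdef
  have hcont : Continuous fun p : ℝ × E d =>
      (1 / 2 : ℂ) * shellSum φ B x N (((ε : ℤ) : ℝ) * p.1) p.2 := by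
    refine continuous_const.mul (continuous_finsetSum _ fun k hk => continuous_const.mul ?_)
    exact (continuous_piece hφ hBm (hfin k hk)).comp
      (f := fun p : ℝ × E d => (((ε : ℤ) : ℝ) * p.1, p.2)) (by fun_prop)
  refine ⟨hcont, fun t => ?_⟩
  set a : ℝ := ((ε : ℤ) : ℝ) * t with ha
  set G : E d → ℂ := fun z => (1 / 2 : ℂ) * shellSum φ B x N a z with hG
  have hGc : Continuous G := hcont.comp (f := fun z : E d => (t, z)) (by fun_prop)
  have hGb : ∀ z, ‖G z‖ ≤ ∑ k ∈ shell d N, ‖(x k : ℂ)‖ * ∫ ξ, ‖cut φ B k ξ‖ := by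
    intro z
    rw [hG]
    simp only [norm_mul]
    refine (mul_le_of_le_one_left (norm_nonneg _) (by norm_num)).trans ?_
    refine (norm_sum_le _ _).trans (Finset.sum_le_sum fun k _ => ?_)
    rw [norm_mul]
    gcongr
    refine (norm_integral_le_integral_norm _).trans (le_of_eq ?_)
    simp [norm_cexp_real_mul_real_mul_I]
  have hGL : MemLp G ∞ volume := memLp_top_of_bound hGc.aestronglyMeasurable _ (.of_forall hGb)
  have h_int : ∀ ψ : 𝓢(E d, ℂ), Integrable fun z => G z * ψ z := fun ψ =>
    (ψ.integrable (μ := volume)).bdd_mul hGc.aestronglyMeasurable (.of_forall hGb)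
  have hU : ∀ ψ : 𝓢(E d, ℂ), (Lp.toTemperedDistribution (hGL.toLp G) : 𝓢'(E d, ℂ)) ψ =
      ∫ z, G z * ψ z := by
    intro ψ
    rw [Lp.toTemperedDistribution_apply]
    refine integral_congr_ae ?_
    filter_upwards [hGL.coeFn_toLp] with z hz
    rw [hz, smul_eq_mul, mul_comm]
  refine ⟨Lp.toTemperedDistribution (hGL.toLp G), ?_, fun ψ => ⟨h_int ψ, hU ψ⟩⟩
  rw [HasSum, PointwiseConvergenceCLM.tendsto_iff_forall_tendsto]
  intro ψ
  rw [hU ψ]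
  have hval : ∫ z, G z * ψ z = ∑ k ∈ shell d N, (x k : ℂ) * ((1 / 2 : ℂ) * ∫ ξ, cut φ B k ξ *
      (Complex.exp (a * jb ((2 * Real.pi) • ξ) * Complex.I) * (𝓕⁻ ψ) ξ)) := by
    have h1 : ∀ z, G z * ψ z =
        ∑ k ∈ shell d N, ((x k : ℂ) * (1 / 2)) * (piece φ B k a z * ψ z) := fun z => by
      simp only [hG, shellSum]
      rw [Finset.mul_sum, Finset.sum_mul]
      exact Finset.sum_congr rfl fun k _ => by ring
    simp_rw [h1]
    rw [integral_finsetSum _ fun k hk =>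
      (integrable_piece_mul hφ hBm (hfin k hk) a ψ).const_mul _]
    refine Finset.sum_congr rfl fun k hk => ?_
    rw [integral_const_mul, integral_piece_mul hφ hBm (hfin k hk) a ψ]
    ring
  rw [hval]
  have hk : ∀ k ∈ shell d N, HasSum (fun l => (x k : ℂ) * ((y l : ℂ) * halfWave φ f g ε k l t ψ))
      ((x k : ℂ) * ((1 / 2 : ℂ) * ∫ ξ, cut φ B k ξ *
        (Complex.exp (a * jb ((2 * Real.pi) • ξ) * Complex.I) * (𝓕⁻ ψ) ξ))) := fun k hk =>
    (hasSum_halfWave hφ hb hc (cutSq_lt_top hφ hb hbf hN hk) (cutSq_lt_top hφ hc hcf hN hk)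
      hbs hcs ε t ψ).mul_left _
  have hs := hasSum_sum hk
  refine Filter.Tendsto.congr (fun J => ?_) hs
  have hadd : ∀ (I : Finset (Fin d → ℤ)) (u : (Fin d → ℤ) → 𝓢'(E d, ℂ)),
      (∑ i ∈ I, u i) ψ = ∑ i ∈ I, u i ψ := by
    intro I u
    classical
    induction I using Finset.induction_on with
    | empty => rfl
    | insert i I hi ih =>
      rw [Finset.sum_insert hi, Finset.sum_insert hi, ← ih]; rfl
  rw [hadd]
  refine Finset.sum_congr rfl fun l _ => ?_
  rw [hadd]
  refine Finset.sum_congr rfl fun k _ => ?_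
  have h2 : ∀ (c : ℂ) (u : 𝓢'(E d, ℂ)), (c • u) ψ = c * u ψ := fun _ _ => rfl
  rw [h2, mul_assoc]

end Representation

/-! ### Assembling the estimate -/

/-- The half-wave with sign `ε` and frequencies in the shell of size `N`. -/
def shellWave (φ : E d → ℝ) (b c : E d → ℂ) (a : (Fin d → ℤ) → ℝ) (ε : ℤˣ) (N : ℕ)
    (p : ℝ × E d) : ℂ :=
  (1 / 2 : ℂ) * shellSum φ (amplitude ε b c) a N (((ε : ℤ) : ℝ) * p.1) p.2

theorem enorm_shellWave_sq_le (φ : E d → ℝ) (b c : E d → ℂ) (a : (Fin d → ℤ) → ℝ) (ε : ℤˣ)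
    (N : ℕ) (p : ℝ × E d) : ‖shellWave φ b c a ε N p‖ₑ ^ 2 ≤
      ‖shellSum φ (amplitude ε b c) a N (((ε : ℤ) : ℝ) * p.1) p.2‖ₑ ^ 2 := by
  rw [shellWave, enorm_mul]
  gcongr
  refine mul_le_of_le_one_left zero_le ?_
  rw [← ofReal_norm]
  exact ENNReal.ofReal_le_one.2 (by norm_num)

theorem abs_unit_cast (ε : ℤˣ) : |((ε : ℤ) : ℝ)| = 1 := by
  rcases Int.units_eq_one_or ε with rfl | rfl <;> simp

/-- The last time interval starts no later than `N^{θ+1}` and has length `N`; this fixes the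
exponent `T = ⌈θ⌉₊ + 1` in the pointwise bound. -/
theorem abs_time_le {N j : ℕ} (hN : 1 ≤ N) {θ : ℝ} (hj : (j : ℝ) ≤ (N : ℝ) ^ θ) {t : ℝ}
    (h0 : (j * N : ℝ) ≤ t) (h1 : t ≤ j * N + N) : |t| ≤ 2 * (N : ℝ) ^ (⌈θ⌉₊ + 1) := by
  have hN1 : (1 : ℝ) ≤ N := by exact_mod_cast hN
  have h2 : (N : ℝ) ^ θ ≤ (N : ℝ) ^ ⌈θ⌉₊ := by
    rw [← Real.rpow_natCast]
    exact Real.rpow_le_rpow_of_exponent_le hN1 (Nat.le_ceil θ)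
  have h3 : (1 : ℝ) ≤ (N : ℝ) ^ ⌈θ⌉₊ := one_le_pow₀ hN1
  have h4 : (0 : ℝ) ≤ j * N := by positivity
  rw [abs_of_nonneg (h4.trans h0), pow_succ]
  nlinarith

theorem stronglyMeasurable_amplitude_param {Ω : Type*} [MeasurableSpace Ω] {S S' : Ω × E d → ℂ}
    (hS : StronglyMeasurable S) (hS' : StronglyMeasurable S') (ε : ℤˣ) :
    StronglyMeasurable fun p : Ω × E d =>
      amplitude ε (fun ξ => S (p.1, ξ)) (fun ξ => S' (p.1, ξ)) p.2 := by
  have h : Continuous fun ξ : E d =>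
      ((ε : ℤ) : ℂ) * Complex.I * ((jb ((2 * Real.pi) • ξ))⁻¹ : ℂ) :=
    continuous_const.mul
      (Continuous.inv₀ (by fun_prop) fun ξ => by exact_mod_cast (jb_pos _).ne')
  exact hS.sub ((h.stronglyMeasurable.comp_measurable (measurable_snd (α := Ω))).mul hS')

end RandomKG

end

/-! ### The theorem: choice of `ω` and of a common constant. -/

theorem mainTheorem4
    {d : ℕ} (hd : d = 4 ∨ d = 5)
    {φ : RandomKG.E d → ℝ} (hφ : RandomKG.IsUnitCutoff d φ)
    {Ω₁ Ω₂ : Type*} [MeasurableSpace Ω₁] [MeasurableSpace Ω₂]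
    (μ₁ : Measure Ω₁) (μ₂ : Measure Ω₂) [IsProbabilityMeasure μ₁] [IsProbabilityMeasure μ₂]
    {X : (Fin d → ℤ) → Ω₁ → ℝ} {Y : (Fin d → ℤ) → Ω₂ → ℝ}
    (hX : RandomKG.IsRandomizer X μ₁) (hY : RandomKG.IsRandomizer Y μ₂)
    {s : ℝ} {f g : 𝓢'(RandomKG.E d, ℂ)} (hf : MemSobolev s 2 f) (hg : MemSobolev (s - 1) 2 g)
    {θ δ : ℝ} (hθ : 0 < θ) (hδ : 0 < δ) :
    ∀ᵐ ω ∂(μ₁.prod μ₂),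
      ∃ F : ℤˣ → ℕ → ℝ × RandomKG.E d → ℂ,
        (∀ (ε : ℤˣ) (n : ℕ), RandomKG.IsShellWave φ f g (fun k => X k ω.1) (fun l => Y l ω.2)
          ε (2 ^ n) (F ε (2 ^ n))) ∧
        ∃ C : ℝ≥0, ∀ (ε : ℤˣ) (N : ℕ), (∃ n : ℕ, N = 2 ^ n) →
          ∀ (t₀ : ℝ), (∃ j : ℕ, (j : ℝ) ≤ (N : ℝ) ^ θ ∧ t₀ = j * N) →
          ∀ (x₀ : RandomKG.E d), (∃ z : Fin d → ℤ, x₀ = (N : ℝ) • RandomKG.latt z) →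
          ∀ u₁ u₂ : ℝ × RandomKG.E d → ℝ, AEMeasurable u₁ → AEMeasurable u₂ →
            ∫⁻ p in RandomKG.cone N t₀ x₀,
                ‖F ε N p‖ₑ * ‖u₁ p‖ₑ * ‖u₂ p‖ₑ ^ (4 / (d - 2) : ℝ) ≤
              C * (N : ℝ≥0∞) ^ (-s + (d + 2) / 8 + 2 * d * δ : ℝ) *
                RandomKG.normLinfLq 2 (RandomKG.cone N t₀ x₀) u₁ *
                RandomKG.normLinfLq 2 (RandomKG.cone N t₀ x₀) u₂ ^ ((d - 4) / 2 : ℝ) *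
                (RandomKG.normLinfLq (ENNReal.ofReal (2 * d / (d - 2)))
                    (RandomKG.cone N t₀ x₀) u₂ ^ (d * (6 - d) / (2 * (d - 2)) : ℝ) +
                  RandomKG.flux δ N t₀ x₀ u₂ ^ ((6 - d) / 4 : ℝ)) := by
  obtain ⟨hf', hhf⟩ := RandomKG.exists_isFourierSide hf
  obtain ⟨hg', hhg⟩ := RandomKG.exists_isFourierSide hg
  obtain ⟨S, hS, hSae⟩ := hY.exists_randomized_side hhf hφ.schwartz
  obtain ⟨S', hS', hSae'⟩ := hY.exists_randomized_side hhg hφ.schwartz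
  have hfin : ∀ ε : ℤˣ, ∀ᵐ ω ∂μ₂, RandomKG.wnorm s (fun ξ =>
      RandomKG.amplitude ε (fun ξ => S (ω, ξ)) (fun ξ => S' (ω, ξ)) ξ) < ∞ := by
    intro ε
    filter_upwards [hSae, hSae'] with ω h1 h2
    exact RandomKG.wnorm_amplitude_lt_top ε (hS.comp_measurable measurable_prodMk_left) h1.1 h2.1
  have hpt := fun ε : ℤˣ => hX.ae_pointwise_bound hφ
    (RandomKG.stronglyMeasurable_amplitude_param hS hS' ε) (hfin ε) (⌈θ⌉₊ + 1)
    (by norm_num : (0 : ℝ) < 1 / 4)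
  filter_upwards [ae_all_iff.2 hpt, Measure.quasiMeasurePreserving_snd.ae hSae,
    Measure.quasiMeasurePreserving_snd.ae hSae'] with ω hω h1 h2
  set b : RandomKG.E d → ℂ := fun ξ => S (ω.2, ξ)
  set c : RandomKG.E d → ℂ := fun ξ => S' (ω.2, ξ)
  have hb : StronglyMeasurable b := hS.comp_measurable measurable_prodMk_left
  have hc : StronglyMeasurable c := hS'.comp_measurable measurable_prodMk_left
  have hwave : ∀ (ε : ℤˣ) (N : ℕ), 1 ≤ N → RandomKG.IsShellWave φ f g (fun k => X k ω.1)
      (fun l => Y l ω.2) ε N (RandomKG.shellWave φ b c (fun k => X k ω.1) ε N) :=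
    fun ε N hN => RandomKG.isShellWave_of_hasSum hφ hb hc h1.1 h2.1 h1.2 h2.2 ε hN
  refine ⟨RandomKG.shellWave φ b c (fun k => X k ω.1),
    fun ε n => hwave ε _ Nat.one_le_two_pow, ?_⟩
  choose K hK using hω
  choose C hC using fun ε : ℤˣ => RandomKG.exists_wave_estimate (B := RandomKG.amplitude ε b c) hd hφ
    (RandomKG.stronglyMeasurable_amplitude ε hb hc)
    (RandomKG.wnorm_amplitude_lt_top ε hb h1.1 h2.1) hδ (K ε)
  -- There are only two signs, so the sum of their constants serves both. The sign enters the
  -- estimate as the time reversal `σ = ε`.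
  refine ⟨∑ ε, C ε, fun ε N hN t₀ ht₀ x₀ _ u₁ u₂ hu₁ hu₂ => ?_⟩
  obtain ⟨j, hj, rfl⟩ := ht₀
  have hN1 : 1 ≤ N := by
    obtain ⟨n, rfl⟩ := hN
    exact Nat.one_le_two_pow
  refine (hC ε N hN1 (j * N) x₀ ((ε : ℤ) : ℝ) (RandomKG.abs_unit_cast ε) _
    (hwave ε N hN1).continuous.measurable (fun p hp => ?_) u₁ u₂ hu₁ hu₂).trans ?_
  · refine (RandomKG.enorm_shellWave_sq_le φ b c _ ε N p).trans (hK ε N hN _ ?_ p.2)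
    rw [abs_mul, RandomKG.abs_unit_cast, one_mul]
    exact RandomKG.abs_time_le hN1 hj hp.1 hp.2.1
  · gcongr
    exact Finset.single_le_sum (fun _ _ => zero_le) (Finset.mem_univ ε)
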